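/- Let $(a_n)_{n\ge1},(b_n)_{n\ge1}$ be complex sequences with $a_1b_1\neq0$ and let $(\lambda_n)_{n\ge1},(\mu_n)_{n\ge1}$ be strictly increasing sequences of positive numbers tending to $\infty$. Assume: (A1) The series $\phi(s)=\sum_{n\ge1}a_n\lambda_n^{-s}$ and $\psi(s)=\sum_{n\ge1}b_n\mu_n^{-s}$ converge absolutely in $\Re s\ge\sigma^*$, for some $\sigma^*>0$. (A2) For some $d\ge1$, $\alpha_\nu>0$, $\beta_\nu,\widetilde\beta_\nu\in\mathbb C$ ($1\le\nu\le d$) and $\omega\in\mathbb C$ with $|\omega|=1$, the functions $\Delta(s)=\prod_{\nu\le d}\Gamma(\alpha_\nu s+\beta_\nu)$ and $\widetilde\Delta(s)=\prod_{\nu\le d}\Gamma(\alpha_\nu s+\widetilde\beta_\nu)$ satisfy $\Delta(s)\phi(s)=\omega\,\widetilde\Delta(1-s)\psi(1-s)$. (A3) $\Delta\phi$ and $\widetilde\Delta\psi$ extend meromorphically to $\mathbb C$ (so that (A2) is an identity of meromorphic functions on $\mathbb C$); for some $R>0$ all singularities of $\Delta\phi$ lie in the open disk $|s|<R$; and $\Delta(\sigma+it)\phi(\sigma+it)\to0$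 as $|t|\to\infty$, uniformly in every strip $b\le\sigma\le b'$. Put $A=\sum_\nu\alpha_\nu$, $B=\sum_\nu\beta_\nu$, $\widetilde B=\sum_\nu\widetilde\beta_\nu$, $h=\prod_\nu(2A/\alpha_\nu)^{2\alpha_\nu}$, define $\vartheta,\xi\in\mathbb R$ by $$-\vartheta+i\xi=\frac1{4A}-\frac12-\frac{B-\widetilde B}{2A},$$ and put $$e_0=\sqrt{\tfrac2\pi}\prod_\nu\Big(\frac{2A}{\alpha_\nu}\Big)^{\alpha_\nu+\beta_\nu-\widetilde\beta_\nu},\qquad \varsigma=\omega e_0\,\frac{b_1}{|b_1|}.$$ Then there are arbitrarily small $\delta>0$ for which there exist positive constants $c_0,c_+,c_-$, where $\delta,c_0,c_+,c_-$ depend at most on $\sigma^*$, the sequences in (A1) and the parameters in (A2), with the following property. Let $\varphi_0:\mathbb R\to[0,1]$ be any smooth function supported on $[-1,1]$ with $1\le\int_{\mathbb R}\varphi_0\le2$. For all sufficiently large $x$, put $L=\delta^{-1}x^{1/(2A)}$, $\varphi(u)=\varphi_0((u-1)L)$, $\widehat\varphi(s)=\int_0^\infty\varphi(u)u^{s-1}\,du$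 and $$S_\varphi(y)=\sum_{n\ge1}a_n\varphi\Big(\frac{\lambda_n}{y}\Big)-\frac1{2\pi i}\oint_{|s|=R}\phi(s)\widehat\varphi(s)y^s\,ds.$$ Then there are $x_+,x_-\in[x-c_0x^{1-1/(2A)},\,x+c_0x^{1-1/(2A)}]$ such that $$\Re\Big(\varsigma^{-1}\frac{S_\varphi(x_+)}{(\mu_1hx_+)^{i\xi}}\Big)>c_+x^{1-\vartheta}L^{-1}\quad\text{and}\quad-\Re\Big(\varsigma^{-1}\frac{S_\varphi(x_-)}{(\mu_1hx_-)^{i\xi}}\Big)>c_-x^{1-\vartheta}L^{-1}.$$ -/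

import Mathlib

open scoped ContDiff

noncomputable section

namespace LocalMean

/-- The coefficients and parameters of two general Dirichlet series and of the gamma factors
in their functional equation.  Sequences are indexed from `0`: the entry at `n` is the term
with number `n + 1`, so `a 0`, `b 0`, `lam 0`, `mu 0` are the first terms. -/
structure Data (d : ℕ) where
  /-- coefficients of the first series -/
  a : ℕ → ℂ
  /-- coefficients of the second series -/
  b : ℕ → ℂ
  /-- frequencies of the first series -/
  lam : ℕ → ℝ
  /-- frequencies of the second series -/
  mu : ℕ → ℝ
  /-- both series converge absolutely for `sigmaStar ≤ re s` -/
  sigmaStar : ℝ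
  /-- the real parameters of the gamma factors -/
  alpha : Fin d → ℝ
  /-- the complex parameters of the gamma factors on the left-hand side -/
  beta : Fin d → ℂ
  /-- the complex parameters of the gamma factors on the right-hand side -/
  betaTilde : Fin d → ℂ
  /-- the constant in the functional equation -/
  omega : ℂ

namespace Data

variable {d : ℕ} (P : Data d)

/-- The series `∑ aₙ λₙ⁻ˢ`. -/
def phiSeries (s : ℂ) : ℂ := ∑' n, P.a n * (P.lam n : ℂ) ^ (-s)

/-- The series `∑ bₙ μₙ⁻ˢ`. -/
def psiSeries (s : ℂ) : ℂ := ∑' n, P.b n * (P.mu n : ℂ) ^ (-s)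

/-- `Δ(s) = ∏ Γ(α_ν s + β_ν)`. -/
def Delta (s : ℂ) : ℂ := ∏ ν, Complex.Gamma (P.alpha ν * s + P.beta ν)

/-- The gamma factor with the parameters `betaTilde`. -/
def DeltaTilde (s : ℂ) : ℂ := ∏ ν, Complex.Gamma (P.alpha ν * s + P.betaTilde ν)

/-- The standing conditions on the sequences and on the parameters, with the absolute
convergence of both series in a closed half-plane. -/
structure Admissible : Prop where
  d_pos : 0 < d
  a_ne : P.a 0 ≠ 0
  b_ne : P.b 0 ≠ 0
  lam_pos : ∀ n, 0 < P.lam n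
  lam_mono : StrictMono P.lam
  lam_tendsto : Filter.Tendsto P.lam Filter.atTop Filter.atTop
  mu_pos : ∀ n, 0 < P.mu n
  mu_mono : StrictMono P.mu
  mu_tendsto : Filter.Tendsto P.mu Filter.atTop Filter.atTop
  sigmaStar_pos : 0 < P.sigmaStar
  phi_abs : ∀ s : ℂ, P.sigmaStar ≤ s.re → Summable fun n => ‖P.a n * (P.lam n : ℂ) ^ (-s)‖
  psi_abs : ∀ s : ℂ, P.sigmaStar ≤ s.re → Summable fun n => ‖P.b n * (P.mu n : ℂ) ^ (-s)‖
  alpha_pos : ∀ ν, 0 < P.alpha ν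
  omega_norm : ‖P.omega‖ = 1

/-- `Phi` and `Psi` are the meromorphic continuations to `ℂ` of the two series, they satisfy
the functional equation `Δ(s) φ(s) = ω Δ~(1-s) ψ(1-s)`, all singularities of `Δ φ` lie in the
open disk `‖s‖ < R`, and `Δ φ` tends to `0` uniformly in vertical strips.

The functional equation is an identity of meromorphic functions, so it is required off a
discrete closed set, and "no singularity at `s`" means that the order at `s` is nonnegative:
the values that Lean's functions take at poles or removable singularities are irrelevant. -/
structure FunctionalEquation (Phi Psi : ℂ → ℂ) (R : ℝ) : Prop where
  phi_mero : ∀ s, MeromorphicAt Phi s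
  psi_mero : ∀ s, MeromorphicAt Psi s
  phi_eq : ∀ s : ℂ, P.sigmaStar < s.re → Phi s = P.phiSeries s
  psi_eq : ∀ s : ℂ, P.sigmaStar < s.re → Psi s = P.psiSeries s
  func_eq : ∀ᶠ s in Filter.codiscrete ℂ,
    P.Delta s * Phi s = P.omega * P.DeltaTilde (1 - s) * Psi (1 - s)
  R_pos : 0 < R
  regular : ∀ s : ℂ, R ≤ ‖s‖ → 0 ≤ meromorphicOrderAt (fun z => P.Delta z * Phi z) s
  decay : ∀ b b' ε : ℝ, 0 < ε → ∃ T : ℝ, ∀ s : ℂ, b ≤ s.re → s.re ≤ b' → T ≤ |s.im| →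
    ‖P.Delta s * Phi s‖ < ε

/-- `A = ∑ α_ν`. -/
def A : ℝ := ∑ ν, P.alpha ν

/-- `B = ∑ β_ν`. -/
def B : ℂ := ∑ ν, P.beta ν

/-- The sum of the parameters `betaTilde`. -/
def BTilde : ℂ := ∑ ν, P.betaTilde ν

/-- `h = ∏ (2A/α_ν)^(2α_ν)`. -/
def h : ℝ := ∏ ν, (2 * P.A / P.alpha ν) ^ (2 * P.alpha ν)

/-- `1/(4A) - 1/2 - (B - B~)/(2A) = -ϑ + iξ`. -/
def shift : ℂ := 1 / (4 * (P.A : ℂ)) - 1 / 2 - (P.B - P.BTilde) / (2 * (P.A : ℂ))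

/-- The real number `ϑ`. -/
def vartheta : ℝ := -P.shift.re

/-- The real number `ξ`. -/
def xi : ℝ := P.shift.im

/-- `e₀ = √(2/π) ∏ (2A/α_ν)^(α_ν + β_ν - β~_ν)`. -/
def e0 : ℂ := (Real.sqrt (2 / Real.pi) : ℂ) *
  ∏ ν, ((2 * P.A / P.alpha ν : ℝ) : ℂ) ^ ((P.alpha ν : ℂ) + P.beta ν - P.betaTilde ν)

/-- `ς = ω e₀ b₁ / |b₁|`. -/
def varsigma : ℂ := P.omega * P.e0 * P.b 0 / (‖P.b 0‖ : ℂ)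

/-- The residual term `(2πi)⁻¹ ∮_{‖s‖=R} φ(s) w^(s) yˢ ds`, with `w^` the Mellin transform of
the weight `w`. -/
def M (Phi : ℂ → ℂ) (R : ℝ) (w : ℝ → ℝ) (y : ℝ) : ℂ :=
  (2 * (Real.pi : ℂ) * Complex.I)⁻¹ *
    ∮ s in C(0, R), Phi s * mellin (fun u => (w u : ℂ)) s * (y : ℂ) ^ s

/-- The local weighted mean `∑ aₙ w(λₙ/y)` without its residual term. -/
def S (Phi : ℂ → ℂ) (R : ℝ) (w : ℝ → ℝ) (y : ℝ) : ℂ :=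
  (∑' n, P.a n * (w (P.lam n / y) : ℂ)) - M Phi R w y

/-- `Re (ς⁻¹ S(y) / (μ₁ h y)^(iξ))`. -/
def normalizedMean (Phi : ℂ → ℂ) (R : ℝ) (w : ℝ → ℝ) (y : ℝ) : ℝ :=
  (P.varsigma⁻¹ * (P.S Phi R w y / ((P.mu 0 * P.h * y : ℝ) : ℂ) ^ (Complex.I * P.xi))).re

/-- `L = δ⁻¹ x^(1/(2A))`. -/
def L (δ x : ℝ) : ℝ := δ⁻¹ * x ^ (1 / (2 * P.A))

end Data

/-- The smooth functions that weights are made from. -/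
structure IsProfile (φ₀ : ℝ → ℝ) : Prop where
  smooth : ContDiff ℝ ∞ φ₀
  supp : Function.support φ₀ ⊆ Set.Icc (-1) 1
  nonneg : ∀ u, 0 ≤ φ₀ u
  le_one : ∀ u, φ₀ u ≤ 1
  one_le_integral : 1 ≤ ∫ u, φ₀ u
  integral_le_two : ∫ u, φ₀ u ≤ 2

/-- The rescaled weight `u ↦ φ₀((u - 1)L)`. -/
def weight (φ₀ : ℝ → ℝ) (L : ℝ) (u : ℝ) : ℝ := φ₀ ((u - 1) * L)

end LocalMean

end

/-! The mean is, by Mellin inversion, the integral of `φ(s) ŵ(s) yˢ` on a line to the right, where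
`ŵ` is the Mellin transform of the weight (`weightMellin`). When the line is moved far to the left,
across the disc that contains all singularities of `Δφ`, the residual term `M` appears, and the
functional equation applies: `S(y)` is the integral of `ω (Δ~(1-s)/Δ(s)) ψ(1-s) ŵ(s) yˢ` on a line
`re s = -c` (`FunctionalEquation.S_eq_integral`). The growth of `φ` inside the strip is controlled
only through the decay of `Δφ` and the growth of `1/Δ`, so a factor `exp(ηs²)` is inserted for the
shift and removed afterwards (`integral_vertical_sub_eq_circleIntegral_of_gaussian`).

Stirling's formula (`Gamma_eq_exp_stirlingExponent`) replaces the quotient `Δ~(1-s)/Δ(s)` by a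
constant times `hˢ Γ(κ - 2As)` times two exponentials, with a relative error `O(1/|t|)`
(`Admissible.exists_norm_gammaQuotient_sub_le`). Euler's integral for the Gamma function, rotated to
the imaginary axis, evaluates the resulting Mellin convolution
(`integral_Gamma_mul_weightMellin`). In the variable `Y = y^{1/2A}` this gives an expansion of the
normalised mean as `y^{1-ϑ} ∑ cₙ ∫ r^{κ-1} w(r) 2 cos(ρₙYr + θ) dr`, with a positive first
coefficient `c₀`, frequencies `ρₙ = (hμₙ)^{1/2A}` and a weight `w` of width and mass of order `1/L`
about `r = 1` (`FunctionalEquation.exists_abs_normalizedMean_sub_le`). As the rapid decay of `ŵ` sets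
in at `|t|` of order `L`, the relative error `O(1/|t|)` saves one factor `L`, and with `L` of order
`Y` the total error is smaller than the main term by a factor of order `Y^{-1/2}`.

For `δ` small the width `1/L` is so small that `cos(ρ₀Yr + θ)` hardly varies with `r` on the support
of `w`. In a window of fixed length in `Y`, the series is averaged against a smooth kernel times
`1 ± cos(ρ₀Y + re θ)`: the first frequency resonates, all other combinations of frequencies stay away
from `0` by a fixed proportion of `ρₙ` and are suppressed by a power of the length of the window, and
that length is chosen by the absolute convergence of `ψ` (`exists_abs_le_mul_re_tsum`). So the mean
takes values of both signs and of the order of the main term in each such window, and a window of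
fixed length about `x^{1/2A}` in `Y` is one of length of order `x^{1-1/2A}` about `x` in `y`. -/

open Complex Filter Topology

namespace LocalMean

/-! ### Stirling's formula for the complex Gamma function -/

/-- The terms of Gudermann's series for the remainder in Stirling's formula. -/
noncomputable def gudermann (z : ℂ) : ℂ := (z + 1 / 2) * (log (z + 1) - log z) - 1

/-- The remainder `log Γ(z) - (z - 1/2) log z + z - log √(2π)` in Stirling's formula, as
Gudermann's series. -/
noncomputable def stirlingRemainder (z : ℂ) : ℂ := ∑' k : ℕ, gudermann (z + k)

lemma log_add_eq_add_log_one_add_div {z w : ℂ} (hz : 0 < z.re) (hzw : 0 < (z + w).re) :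
    log (z + w) = log z + log (1 + w / z) := by
  have hz0 : z ≠ 0 := fun h => by simp [h] at hz
  have hzw0 : z + w ≠ 0 := fun h => by rw [h] at hzw; simp at hzw
  have h1 : 1 + w / z = (z + w) / z := by field_simp
  have a1 := abs_lt.1 ((abs_arg_lt_pi_div_two_iff).2 (Or.inl hz))
  have a2 := abs_lt.1 ((abs_arg_lt_pi_div_two_iff).2 (Or.inl hzw))
  have h2 : log ((z + w) / z) = log (z + w) - log z := by
    rw [div_eq_mul_inv]
    have hinv : (z⁻¹).arg = -z.arg := by
      rw [arg_inv, if_neg]; intro h; linarith [Real.pi_pos]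
    have hl : log z⁻¹ = -log z := log_inv z (fun h => by linarith [Real.pi_pos])
    rw [log_mul hzw0 (inv_ne_zero hz0) ?_, hl]
    · ring
    · rw [hinv]; constructor <;> linarith
  rw [h1, h2]; ring

lemma norm_gudermann_le {z : ℂ} (hz : 2 ≤ z.re) : ‖gudermann z‖ ≤ 2 / ‖z‖ ^ 2 := by
  have hz2 : 2 ≤ ‖z‖ := hz.trans (re_le_norm z)
  have hz0 : z ≠ 0 := fun h => by simp [h] at hz2; linarith
  have hlog : log (z + 1) - log z = log (1 + z⁻¹) := by
    rw [log_add_eq_add_log_one_add_div (by linarith) (by simp; linarith)]; simp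
  set x := z⁻¹ with hx
  have hxn : ‖x‖ = ‖z‖⁻¹ := norm_inv z
  have hx2 : ‖x‖ ≤ 1 / 2 := by
    rw [hxn]; simpa using inv_anti₀ (by norm_num) hz2
  have hx0 : 0 < ‖x‖ := by rw [hxn]; positivity
  have hb := norm_log_sub_logTaylor_le 2 (z := x) (by linarith)
  have ht : logTaylor 3 x = x - x ^ 2 / 2 := by
    simp [logTaylor, Finset.sum_range_succ]; ring
  norm_num at hb
  rw [ht] at hb
  have hzx : z = x⁻¹ := by simp [hx]
  have hxne : x ≠ 0 := norm_pos_iff.1 hx0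
  have key : gudermann z = -(x ^ 2 / 4) + (z + 1 / 2) * (log (1 + x) - (x - x ^ 2 / 2)) := by
    unfold gudermann
    rw [hlog, hzx]; field_simp; ring
  have hz1 : ‖z + 1 / 2‖ ≤ (5 / 4) * ‖x‖⁻¹ := by
    calc ‖z + 1 / 2‖ ≤ ‖z‖ + 1 / 2 := by
          refine (norm_add_le _ _).trans (by norm_num)
      _ ≤ _ := by rw [hxn, inv_inv]; linarith
  have hb' : ‖log (1 + x) - (x - x ^ 2 / 2)‖ ≤ ‖x‖ ^ 3 * (2 / 3) := by
    refine hb.trans ?_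
    have : (1 - ‖x‖)⁻¹ ≤ 2 := by
      rw [inv_le_comm₀ (by linarith) (by norm_num)]; linarith
    have h3 : 0 ≤ ‖x‖ ^ 3 := by positivity
    nlinarith
  rw [key]
  calc _ ≤ ‖x‖ ^ 2 / 4 + (5 / 4) * ‖x‖⁻¹ * (‖x‖ ^ 3 * (2 / 3)) := by
        refine (norm_add_le _ _).trans (add_le_add (by simp) ?_)
        rw [norm_mul]
        gcongr
    _ = ‖x‖ ^ 2 * (13 / 12) := by field_simp; ring
    _ ≤ 2 * ‖x‖ ^ 2 := by nlinarith [sq_nonneg ‖x‖]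
    _ = _ := by rw [hxn]; field_simp

lemma norm_add_natCast_ge {z : ℂ} (hz : 0 ≤ z.re) (k : ℕ) :
    (‖z‖ + k) ^ 2 ≤ 2 * ‖z + k‖ ^ 2 := by
  have h1 : ‖z + k‖ ^ 2 = ‖z‖ ^ 2 + 2 * k * z.re + k ^ 2 := by
    rw [← normSq_eq_norm_sq, ← normSq_eq_norm_sq, normSq_apply, normSq_apply]; simp; ring
  have : 0 ≤ (k : ℝ) * z.re := by positivity
  nlinarith [sq_nonneg (‖z‖ - k)]

lemma norm_gudermann_add_natCast_le {z : ℂ} (hz : 2 ≤ z.re) (k : ℕ) :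
    ‖gudermann (z + k)‖ ≤ 4 * ((‖z‖ + k - 1)⁻¹ - (‖z‖ + (k + 1 : ℕ) - 1)⁻¹) := by
  have hz2 : 2 ≤ ‖z‖ := hz.trans (re_le_norm z)
  have hk : (0 : ℝ) ≤ k := k.cast_nonneg
  have h1 := norm_gudermann_le (z := z + k) (by simp; linarith)
  refine h1.trans ?_
  have h2 := norm_add_natCast_ge (z := z) (by linarith) k
  have h3 : 0 < (‖z‖ + k) := by linarith
  have h4 : 0 < ‖z‖ + k - 1 := by linarith
  have h5 : (‖z‖ + (k + 1 : ℕ) - 1) = ‖z‖ + k := by push_cast; ring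
  rw [h5, inv_sub_inv h4.ne' h3.ne', ← mul_div_assoc]
  have h6 : 0 < ‖z + k‖ ^ 2 := by nlinarith
  rw [div_le_div_iff₀ h6 (by positivity)]
  nlinarith

lemma tendsto_inv_add_natCast_sub_one (r : ℝ) :
    Tendsto (fun n : ℕ => (r + n - 1)⁻¹) atTop (𝓝 0) := by
  refine tendsto_inv_atTop_zero.comp ?_
  have := tendsto_atTop_add_const_left atTop (r - 1) (tendsto_natCast_atTop_atTop (R := ℝ))
  refine this.congr fun n => by ring

lemma hasSum_telescoping_inv {r : ℝ} (hr : 1 < r) :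
    HasSum (fun k : ℕ => 4 * ((r + k - 1)⁻¹ - (r + (k + 1 : ℕ) - 1)⁻¹)) (4 * (r - 1)⁻¹) := by
  refine HasSum.mul_left 4 ?_
  have hnn : ∀ k : ℕ, 0 ≤ (r + k - 1)⁻¹ - (r + (k + 1 : ℕ) - 1)⁻¹ := fun k => by
    have hk : (0 : ℝ) ≤ k := k.cast_nonneg
    rw [sub_nonneg]
    apply inv_anti₀ <;> push_cast <;> linarith
  rw [hasSum_iff_tendsto_nat_of_nonneg hnn]
  have : ∀ n : ℕ, ∑ i ∈ Finset.range n, ((r + i - 1)⁻¹ - (r + (i + 1 : ℕ) - 1)⁻¹)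
      = (r - 1)⁻¹ - (r + n - 1)⁻¹ := fun n => by
    rw [Finset.sum_range_sub' (fun i : ℕ => (r + i - 1)⁻¹)]; simp
  simp_rw [this]
  simpa using (tendsto_inv_add_natCast_sub_one r).const_sub (r - 1)⁻¹

lemma summable_gudermann {z : ℂ} (hz : 2 ≤ z.re) : Summable fun k : ℕ => gudermann (z + k) :=
  Summable.of_norm_bounded
    (hasSum_telescoping_inv (r := ‖z‖) (by linarith [hz.trans (re_le_norm z)])).summable
    (norm_gudermann_add_natCast_le hz)

lemma norm_stirlingRemainder_le {z : ℂ} (hz : 2 ≤ z.re) : ‖stirlingRemainder z‖ ≤ 8 / ‖z‖ := by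
  have hz2 : 2 ≤ ‖z‖ := hz.trans (re_le_norm z)
  refine (tsum_of_norm_bounded (hasSum_telescoping_inv (r := ‖z‖) (by linarith))
    (norm_gudermann_add_natCast_le hz)).trans ?_
  rw [← div_eq_mul_inv, div_le_div_iff₀ (by linarith) (by linarith)]
  linarith

lemma stirlingRemainder_eq {z : ℂ} (hz : 2 ≤ z.re) :
    stirlingRemainder z = gudermann z + stirlingRemainder (z + 1) := by
  unfold stirlingRemainder
  rw [(summable_gudermann hz).tsum_eq_zero_add]
  simp only [Nat.cast_zero, add_zero, Nat.cast_add, Nat.cast_one]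
  congr 1
  refine tsum_congr fun k => by ring_nf

/-- The exponent in Stirling's formula, up to the constant `log √(2π)`. -/
noncomputable def stirlingExponent (z : ℂ) : ℂ := (z - 1 / 2) * log z - z + stirlingRemainder z

/-- The functional equation of `log Γ`, by telescoping of Gudermann's series. -/
lemma stirlingExponent_add_one {z : ℂ} (hz : 2 ≤ z.re) :
    stirlingExponent (z + 1) = stirlingExponent z + log z := by
  unfold stirlingExponent
  rw [stirlingRemainder_eq hz, gudermann]; ring

lemma Gamma_mul_exp_stirlingExponent_add_nat {z : ℂ} (hz : 2 ≤ z.re) (n : ℕ) :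
    Gamma (z + n) * exp (-stirlingExponent (z + n)) = Gamma z * exp (-stirlingExponent z) := by
  induction n with
  | zero => simp
  | succ n ih =>
    rw [← ih]
    have hre : 2 ≤ (z + n).re := by simp; linarith [(n.cast_nonneg : (0 : ℝ) ≤ n)]
    have h0 : z + n ≠ 0 := fun h => by rw [h] at hre; simp at hre; linarith
    push_cast
    rw [← add_assoc, stirlingExponent_add_one hre, Gamma_add_one _ h0, neg_add, exp_add,
      exp_neg (log _), exp_log h0]
    field_simp

lemma Gamma_add_natCast_add_one {z : ℂ} (hz : 0 < z.re) (n : ℕ) :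
    Gamma (z + (n + 1 : ℕ)) = Gamma z * ∏ j ∈ Finset.range (n + 1), (z + j) := by
  have h0 (n : ℕ) : z + n ≠ 0 := fun h => by
    have := congrArg re h; simp at this; linarith [(n.cast_nonneg : (0 : ℝ) ≤ n)]
  induction n with
  | zero => simp [Gamma_add_one z (by simpa using h0 0)]; ring
  | succ n ih =>
    rw [Finset.prod_range_succ, ← mul_assoc, ← ih, mul_comm, ← Gamma_add_one _ (h0 _)]
    push_cast; ring_nf

lemma tendsto_stirling_log (z : ℂ) (hz : 0 < z.re) :
    Tendsto (fun n : ℕ => (n + z + 1 / 2) * (log (n : ℂ) - log (z + (n + 1 : ℕ)))) atTop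
      (𝓝 (-(z + 1))) := by
  have h1 : Tendsto (fun n : ℕ => (n : ℂ) * log (1 + (z + 1) / n)) atTop (𝓝 (z + 1)) := by
    refine tendsto_nat_mul_log_one_add_of_tendsto ?_
    refine tendsto_const_nhds.congr' ?_
    filter_upwards [eventually_ne_atTop 0] with n hn
    have : (n : ℂ) ≠ 0 := by exact_mod_cast hn
    field_simp
  have h0 : Tendsto (fun n : ℕ => (z + 1) / n) atTop (𝓝 0) :=
    tendsto_const_div_atTop_nhds_zero_nat _
  have h2 : Tendsto (fun n : ℕ => (z + 1 / 2) * log (1 + (z + 1) / n)) atTop (𝓝 0) := by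
    have : Tendsto (fun n : ℕ => log (1 + (z + 1) / n)) atTop (𝓝 (log (1 + 0))) :=
      (h0.const_add 1).clog (by simp)
    simpa using this.const_mul (z + 1 / 2)
  have h3 := (h1.add h2).neg
  rw [add_zero] at h3
  refine h3.congr' ?_
  filter_upwards [eventually_gt_atTop 0] with n hn
  have hn' : (0 : ℝ) < n := by exact_mod_cast hn
  have : z + (n + 1 : ℕ) = n + (z + 1) := by push_cast; ring
  rw [this, log_add_eq_add_log_one_add_div (z := n) (w := z + 1) (by simpa using hn')
    (by simp; linarith)]
  ring

/-- **Stirling's formula**, exact form: the remainder is `O(1/‖z‖)` by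
`norm_stirlingRemainder_le`. -/
theorem Gamma_eq_exp_stirlingExponent {z : ℂ} (hz : 2 ≤ z.re) :
    Gamma z = Real.sqrt (2 * Real.pi) * exp (stirlingExponent z) := by
  have hG : Gamma z ≠ 0 := Gamma_ne_zero_of_re_pos (by linarith)
  suffices h : Gamma z * exp (-stirlingExponent z) = Real.sqrt (2 * Real.pi) by
    rw [← h, mul_assoc, ← exp_add]; simp
  -- `Γ(z) exp(-stirlingExponent z)` is invariant under `z ↦ z + 1`, so it is the limit of its
  -- values at `z + n + 1`; that limit follows from Euler's limit for `Γ(z)` together with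
  -- Stirling's formula for `n!`
  have hconst : Tendsto (fun n : ℕ => Gamma (z + (n + 1 : ℕ)) *
      exp (-stirlingExponent (z + (n + 1 : ℕ)))) atTop
      (𝓝 (Gamma z * exp (-stirlingExponent z))) :=
    tendsto_const_nhds.congr fun n => (Gamma_mul_exp_stirlingExponent_add_nat hz (n + 1)).symm
  refine tendsto_nhds_unique hconst ?_
  have hR : Tendsto (fun n : ℕ => stirlingRemainder (z + (n + 1 : ℕ))) atTop (𝓝 0) := by
    have h0 := (tendsto_inv_add_natCast_sub_one 3).const_mul 8
    rw [mul_zero] at h0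
    refine squeeze_zero_norm (fun n => ?_) h0
    have hn0 : (0 : ℝ) ≤ n := n.cast_nonneg
    have hre : 2 + (n : ℝ) ≤ (z + (n + 1 : ℕ)).re := by simp; linarith
    refine (norm_stirlingRemainder_le (by linarith)).trans ?_
    rw [div_eq_mul_inv]
    gcongr
    · linarith
    · linarith [hre.trans (re_le_norm _)]
  have hS : Tendsto (fun n : ℕ => ((Stirling.stirlingSeq n : ℝ) : ℂ)) atTop
      (𝓝 ((Real.sqrt Real.pi : ℝ) : ℂ)) :=
    (continuous_ofReal.tendsto _).comp Stirling.tendsto_stirlingSeq_sqrt_pi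
  have hQ : Tendsto (fun n : ℕ => Gamma z / GammaSeq z n) atTop (𝓝 1) := by
    have := (tendsto_const_nhds (x := Gamma z)).div (GammaSeq_tendsto_Gamma z) hG
    rwa [div_self hG] at this
  have hE : Tendsto (fun n : ℕ => exp ((n + z + 1 / 2) * (log (n : ℂ) - log (z + (n + 1 : ℕ)))
      + (z + 1) - stirlingRemainder (z + (n + 1 : ℕ)))) atTop (𝓝 1) := by
    have := ((tendsto_stirling_log z (by linarith)).add_const (z + 1)).sub hR
    simpa [Function.comp_def] using (continuous_exp.tendsto _).comp this
  have hfin := (hQ.mul (hS.mul hE)).const_mul ((Real.sqrt 2 : ℝ) : ℂ)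
  rw [one_mul, mul_one, ← ofReal_mul, ← Real.sqrt_mul (by norm_num)] at hfin
  refine hfin.congr' ?_
  filter_upwards [eventually_gt_atTop 0] with n hn
  have hn' : (0 : ℝ) < n := by exact_mod_cast hn
  have hnC : (n : ℂ) ≠ 0 := by exact_mod_cast hn.ne'
  have hfact : ((n.factorial : ℝ) : ℂ) = ((Stirling.stirlingSeq n : ℝ) : ℂ) *
      ((Real.sqrt 2 : ℝ) : ℂ) * exp (log n / 2 + n * log n - n) := by
    have : (n.factorial : ℝ) = Stirling.stirlingSeq n * Real.sqrt 2 *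
        Real.exp (Real.log n / 2 + n * Real.log n - n) := by
      rw [Stirling.stirlingSeq, Real.exp_sub, Real.exp_add, mul_comm (n : ℝ), Real.exp_mul,
        Real.exp_log hn', Real.sqrt_mul (by norm_num), Real.sqrt_eq_rpow (n : ℝ), Real.rpow_def_of_pos hn',
        div_pow, ← Real.exp_nat_mul, mul_one, Real.rpow_natCast, mul_one_div]
      field_simp
    rw [this]; push_cast; rfl
  have hprod : ∏ j ∈ Finset.range (n + 1), (z + j) = (n : ℂ) ^ z * n.factorial / GammaSeq z n := by
    have hp : ∏ j ∈ Finset.range (n + 1), (z + (j : ℂ)) ≠ 0 :=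
      Finset.prod_ne_zero_iff.2 fun j _ h => by
        have := congrArg re h; simp at this; linarith [(j.cast_nonneg : (0 : ℝ) ≤ j)]
    have hq : (n : ℂ) ^ z * n.factorial ≠ 0 :=
      mul_ne_zero (by simp [cpow_eq_zero_iff, hnC]) (by exact_mod_cast n.factorial_ne_zero)
    rw [GammaSeq, div_div_cancel₀ hq]
  rw [Gamma_add_natCast_add_one (by linarith), hprod, cpow_def_of_ne_zero hnC,
    ← ofReal_natCast n.factorial, hfact, stirlingExponent]
  have : exp ((n + z + 1 / 2) * (log (n : ℂ) - log (z + (n + 1 : ℕ)))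
      + (z + 1) - stirlingRemainder (z + (n + 1 : ℕ))) =
      exp (log n * z) * exp (log n / 2 + n * log n - n) *
      exp (-((z + (n + 1 : ℕ) - 1 / 2) * log (z + (n + 1 : ℕ)) - (z + (n + 1 : ℕ))
        + stirlingRemainder (z + (n + 1 : ℕ)))) := by
    rw [← exp_add, ← exp_add]; congr 1; push_cast; ring
  rw [this]; ring

end LocalMean

open Complex Filter Topology

namespace LocalMean

/-! ### Growth of the Gamma function on vertical lines and strips -/

/-- Stirling's formula for `Γ(αw + γ)`, expanded about `αw`. -/
theorem exists_Gamma_mul_add_eq {α : ℝ} (hα : 0 < α) (γ : ℂ) :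
    ∃ W C : ℝ, 1 ≤ W ∧ 0 ≤ C ∧ ∀ w : ℂ, W ≤ w.re → ∃ e : ℂ, ‖e‖ ≤ C / ‖w‖ ∧
      Gamma (α * w + γ) = Real.sqrt (2 * Real.pi) *
        exp ((α * w + γ - 1 / 2) * (Real.log α + log w) - α * w + e) := by
  refine ⟨1 + (2 * ‖γ‖ + 2) / α, (‖γ‖ ^ 2 + ‖γ - 1 / 2‖ * (3 / 2 * ‖γ‖) + 16) / α, ?_, by positivity,
    fun w hw => ?_⟩
  · have : 0 ≤ (2 * ‖γ‖ + 2) / α := by positivity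
    linarith
  have hre : 2 * ‖γ‖ + 2 ≤ α * w.re := by
    have : (2 * ‖γ‖ + 2) / α ≤ w.re := by linarith
    rw [div_le_iff₀ hα] at this; linarith
  have hwre : 0 < w.re := by
    have : 0 ≤ (2 * ‖γ‖ + 2) / α := by positivity
    linarith
  have hw0 : w ≠ 0 := fun h => by simp [h] at hwre
  have hαC : (α : ℂ) ≠ 0 := by exact_mod_cast hα.ne'
  have hwn : 0 < ‖w‖ := norm_pos_iff.2 hw0
  have hαw : 2 * ‖γ‖ + 2 ≤ α * ‖w‖ := hre.trans (by gcongr; exact re_le_norm w)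
  have hγre : -‖γ‖ ≤ γ.re := by linarith [abs_le.1 (abs_re_le_norm γ)]
  have hγ0 := norm_nonneg γ
  set z := α * w + γ with hz
  have hzre : 2 ≤ z.re := by simp [hz]; linarith
  set u := γ / (α * w) with hu
  have hun : ‖u‖ = ‖γ‖ / (α * ‖w‖) := by simp [hu, abs_of_pos hα]
  have hu2 : ‖u‖ ≤ 1 / 2 := by
    rw [hun, div_le_iff₀ (by positivity)]; linarith
  have hlog : log z = Real.log α + log w + log (1 + u) := by
    rw [hz, log_add_eq_add_log_one_add_div (by simp; positivity) (by rw [← hz]; linarith),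
      log_ofReal_mul hα hw0]
  have hzn : α * ‖w‖ / 2 ≤ ‖z‖ := by
    have := norm_sub_norm_le (α * w) (-γ)
    rw [sub_neg_eq_add, ← hz, norm_neg, norm_mul, norm_real, Real.norm_of_nonneg hα.le] at this
    linarith
  refine ⟨α * w * (log (1 + u) - u) + (γ - 1 / 2) * log (1 + u) + stirlingRemainder z, ?_, ?_⟩
  · have h1 : ‖α * w * (log (1 + u) - u)‖ ≤ ‖γ‖ ^ 2 / (α * ‖w‖) := by
      rw [norm_mul, norm_mul, norm_real, Real.norm_of_nonneg hα.le]
      have := norm_log_one_add_sub_self_le (z := u) (by linarith)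
      have h3 : (1 - ‖u‖)⁻¹ ≤ 2 := by
        rw [inv_le_comm₀ (by linarith) (by norm_num)]; linarith
      have h4 : ‖log (1 + u) - u‖ ≤ ‖u‖ ^ 2 := by nlinarith [sq_nonneg ‖u‖]
      calc _ ≤ α * ‖w‖ * ‖u‖ ^ 2 := by gcongr
        _ = _ := by rw [hun]; field_simp
    have h2 : ‖(γ - 1 / 2) * log (1 + u)‖ ≤ ‖γ - 1 / 2‖ * (3 / 2 * ‖γ‖) / (α * ‖w‖) := by
      rw [norm_mul, mul_div_assoc, mul_div_assoc, ← hun]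
      gcongr
      exact norm_log_one_add_half_le_self hu2
    have h3 : ‖stirlingRemainder z‖ ≤ 16 / (α * ‖w‖) := by
      refine (norm_stirlingRemainder_le hzre).trans ?_
      rw [div_le_div_iff₀ (by linarith) (by positivity)]; linarith
    calc _ ≤ ‖γ‖ ^ 2 / (α * ‖w‖) + ‖γ - 1 / 2‖ * (3 / 2 * ‖γ‖) / (α * ‖w‖) + 16 / (α * ‖w‖) :=
          (norm_add₃_le).trans (by gcongr)
      _ = _ := by field_simp
  · rw [Gamma_eq_exp_stirlingExponent hzre, stirlingExponent, hlog]
    congr 2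
    have : α * w * u = γ := by rw [hu]; field_simp
    linear_combination this + (Real.log α + log w + log (1 + u) - 1) * hz

/-- The argument of `c - it` approaches `∓π/2` at the rate `c/|t|`. -/
lemma mul_arg_sub_mul_I_le {c : ℝ} (hc : 0 < c) (t : ℝ) :
    t * arg (c - t * I) ≤ c - Real.pi / 2 * |t| := by
  have harg : arg (c - t * I) = -Real.arctan (t / c) := by
    have h1 := tan_arg (c - t * I)
    have h2 := abs_lt.1 ((abs_arg_lt_pi_div_two_iff (z := c - t * I)).2 (Or.inl (by simpa using hc)))
    rw [← Real.arctan_tan h2.1 h2.2, h1, ← Real.arctan_neg]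
    simp [neg_div]
  have key : ∀ x : ℝ, 0 ≤ x → Real.pi / 2 * x - c ≤ x * Real.arctan (x / c) := fun x hx => by
    rcases hx.eq_or_lt with h | h
    · simp [← h]; exact hc.le
    · have h3 := Real.arctan_inv_of_pos (div_pos h hc)
      have h4 : Real.arctan (x / c)⁻¹ ≤ (x / c)⁻¹ := by
        simpa using Real.le_tan (Real.arctan_nonneg.2 (by positivity)) (Real.arctan_lt_pi_div_two (x / c)⁻¹)
      have h5 : x * (x / c)⁻¹ = c := by field_simp
      have h6 := mul_le_mul_of_nonneg_left h4 hx
      rw [h3] at h6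
      nlinarith
  rw [harg]
  rcases le_total 0 t with h | h
  · rw [abs_of_nonneg h]; linarith [key t h]
  · have := key (-t) (by linarith)
    rw [neg_div, Real.arctan_neg] at this
    rw [abs_of_nonpos h]; linarith

/-- The order of growth of `Γ(αw + γ)` on the line `re w = c`, as an upper bound: the exponential
decay `e^{-πα|t|/2}` times the power `|t|^{αc + re γ - 1/2}`. -/
theorem exists_norm_Gamma_mul_exp_le {α : ℝ} (hα : 0 < α) (γ : ℂ) :
    ∃ W : ℝ, 1 ≤ W ∧ ∀ c : ℝ, W ≤ c → 0 ≤ α * c + γ.re - 1 / 2 → ∃ C : ℝ, 0 ≤ C ∧ ∀ t : ℝ,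
      ‖Gamma (α * (c - t * I) + γ)‖ * Real.exp (Real.pi / 2 * α * |t|) ≤
        C * (1 + |t|) ^ (α * c + γ.re - 1 / 2) := by
  obtain ⟨W, C, hW, hC, h⟩ := exists_Gamma_mul_add_eq hα γ
  refine ⟨W, hW, fun c hc he => ?_⟩
  set e := α * c + γ.re - 1 / 2
  refine ⟨Real.sqrt (2 * Real.pi) * Real.exp (e * Real.log α + (‖γ‖ * ‖(Real.log α : ℂ)‖)
    + e * Real.log (1 + c) + ‖γ‖ * Real.pi + α * c + C), by positivity, fun t => ?_⟩
  set w : ℂ := c - t * I with hw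
  have hwre : w.re = c := by simp [hw]
  have hwim : w.im = -t := by simp [hw]
  have hc0 : 0 < c := by linarith
  obtain ⟨ε, hε, hG⟩ := h w (by rw [hwre]; exact hc)
  have hwn1 : 1 ≤ ‖w‖ := (by linarith : 1 ≤ c).trans (hwre ▸ re_le_norm w)
  have hwn : ‖w‖ ≤ (1 + c) * (1 + |t|) := by
    have : ‖w‖ ≤ c + |t| := by
      have := norm_sub_le (c : ℂ) (t * I)
      simpa [abs_of_pos hc0] using this
    nlinarith [abs_nonneg t]
  have hε1 : ε.re ≤ C := (re_le_norm ε).trans (hε.trans (div_le_self hC hwn1))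
  have harg := mul_arg_sub_mul_I_le hc0 t
  rw [← hw] at harg
  rw [hG, norm_mul, norm_real, Real.norm_of_nonneg (Real.sqrt_nonneg _), norm_exp, mul_assoc,
    ← Real.exp_add, Real.rpow_def_of_pos (by positivity), mul_assoc (Real.sqrt _), ← Real.exp_add]
  refine mul_le_mul_of_nonneg_left (Real.exp_le_exp.2 ?_) (Real.sqrt_nonneg _)
  have hlogw : Real.log ‖w‖ ≤ Real.log (1 + c) + Real.log (1 + |t|) := by
    rw [← Real.log_mul (by positivity) (by positivity)]
    exact Real.log_le_log (by linarith) hwn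
  have hre : ((α * w + γ - 1 / 2) * (Real.log α + log w) - α * w + ε).re =
      e * Real.log α + e * Real.log ‖w‖ - (-(α * t) + γ.im) * arg w - α * c + ε.re := by
    have : (1 / 2 : ℂ).im = 0 := by norm_num
    simp [mul_re, hwre, hwim, log_re, log_im, e]
    ring
  rw [hre]
  have h1 : e * Real.log ‖w‖ ≤ e * (Real.log (1 + c) + Real.log (1 + |t|)) := by gcongr
  have h2 : -(γ.im * arg w) ≤ ‖γ‖ * Real.pi := by
    refine (neg_le_abs _).trans ?_
    rw [abs_mul]
    gcongr
    · exact abs_im_le_norm γ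
    · exact abs_arg_le_pi w
  have h3 : 0 ≤ ‖γ‖ * ‖(Real.log α : ℂ)‖ := by positivity
  have h4 : α * (t * arg w) ≤ α * (c - Real.pi / 2 * |t|) := by gcongr
  nlinarith

/-- `1/Γ` grows slower than any Gaussian in vertical strips. -/
theorem exists_norm_Gamma_inv_le (b b' : ℝ) {η : ℝ} (hη : 0 < η) :
    ∃ C : ℝ, 0 ≤ C ∧ ∀ z : ℂ, b ≤ z.re → z.re ≤ b' → ‖(Gamma z)⁻¹‖ ≤ C * Real.exp (η * z.im ^ 2) := by
  suffices H : ∀ m : ℕ, ∀ b b' : ℝ, 2 ≤ b + m → ∀ η : ℝ, 0 < η → ∃ C : ℝ, 0 ≤ C ∧ ∀ z : ℂ,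
      b ≤ z.re → z.re ≤ b' → ‖(Gamma z)⁻¹‖ ≤ C * Real.exp (η * z.im ^ 2) by
    obtain ⟨m, hm⟩ := exists_nat_ge (2 - b)
    exact H m b b' (by linarith) η hη
  intro m
  induction m with
  | zero =>
    intro b b' hb η hη
    simp only [Nat.cast_zero, add_zero] at hb
    set M := max b b' with hM
    have hMb : 2 ≤ M := hb.trans (le_max_left _ _)
    -- `‖log z‖ ≤ δ‖z‖ + K` for any `δ > 0`, so the exponent in Stirling's formula is at most
    -- `3δ‖z‖² + Q`, and `3δ < η`
    set δ := η / 4 with hδ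
    have hδ0 : 0 < δ := by positivity
    set K := |Real.log δ| + Real.pi with hK
    have hK0 : 0 ≤ K := by positivity
    set Q := (K + δ + 1) ^ 2 / (4 * (2 * δ)) + K + 8 with hQ
    refine ⟨Real.exp (3 * δ * M ^ 2 + Q), by positivity, fun z hz1 hz2 => ?_⟩
    have hzn : 2 ≤ ‖z‖ := (hb.trans hz1).trans (re_le_norm z)
    have hlog : ‖log z‖ ≤ δ * ‖z‖ + K := by
      have h1 : ‖log z‖ ≤ |(log z).re| + |(log z).im| := norm_le_abs_re_add_abs_im _
      rw [log_re, log_im] at h1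
      have h2 : |Real.log ‖z‖| ≤ δ * ‖z‖ + |Real.log δ| := by
        rw [abs_of_nonneg (Real.log_nonneg (by linarith))]
        have := Real.log_le_sub_one_of_pos (x := δ * ‖z‖) (by positivity)
        rw [Real.log_mul hδ0.ne' (by linarith)] at this
        linarith [neg_abs_le (Real.log δ)]
      linarith [abs_arg_le_pi z]
    have hS : ‖stirlingExponent z‖ ≤ 3 * δ * ‖z‖ ^ 2 + Q := by
      have h1 : ‖(z - 1 / 2) * log z‖ ≤ (‖z‖ + 1) * (δ * ‖z‖ + K) := by
        rw [norm_mul]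
        gcongr
        refine (norm_sub_le _ _).trans (by norm_num)
      have h2 : ‖stirlingRemainder z‖ ≤ 8 :=
        (norm_stirlingRemainder_le (hb.trans hz1)).trans (div_le_self (by norm_num) (by linarith))
      have h3 : ‖stirlingExponent z‖ ≤ ‖(z - 1 / 2) * log z‖ + ‖z‖ + ‖stirlingRemainder z‖ :=
        (norm_add_le _ _).trans (by gcongr; exact norm_sub_le _ _)
      have h4 : (K + δ + 1) * ‖z‖ ≤ 2 * δ * ‖z‖ ^ 2 + (K + δ + 1) ^ 2 / (4 * (2 * δ)) := by
        have h5 : 2 * δ * ‖z‖ ^ 2 + (K + δ + 1) ^ 2 / (4 * (2 * δ)) - (K + δ + 1) * ‖z‖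
            = 2 * δ * (‖z‖ - (K + δ + 1) / (4 * δ)) ^ 2 := by field_simp; ring
        have : 0 ≤ 2 * δ * (‖z‖ - (K + δ + 1) / (4 * δ)) ^ 2 := by positivity
        linarith
      have h6 : ‖stirlingExponent z‖ ≤ δ * ‖z‖ ^ 2 + (K + δ + 1) * ‖z‖ + K + 8 := by
        nlinarith
      linarith
    rw [Gamma_eq_exp_stirlingExponent (hb.trans hz1), mul_inv, ← exp_neg, norm_mul, norm_exp,
      norm_inv, norm_real, Real.norm_of_nonneg (Real.sqrt_nonneg _), ← Real.exp_add]
    have hsq : (Real.sqrt (2 * Real.pi))⁻¹ ≤ 1 := by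
      apply inv_le_one_of_one_le₀
      rw [Real.one_le_sqrt]; linarith [Real.pi_gt_three]
    have hz2 : ‖z‖ ^ 2 ≤ M ^ 2 + z.im ^ 2 := by
      rw [← normSq_eq_norm_sq, normSq_apply]
      have : z.re ≤ M := hz2.trans (le_max_right _ _)
      nlinarith
    calc _ ≤ 1 * Real.exp (3 * δ * M ^ 2 + Q + η * z.im ^ 2) := by
          gcongr
          have : (-stirlingExponent z).re ≤ ‖stirlingExponent z‖ := by
            simpa using (re_le_norm (-stirlingExponent z))
          have h7 : 3 * δ * ‖z‖ ^ 2 ≤ 3 * δ * (M ^ 2 + z.im ^ 2) := by gcongr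
          have h8 : 3 * δ * z.im ^ 2 ≤ η * z.im ^ 2 := by gcongr; linarith
          linarith
      _ = _ := one_mul _
  | succ m ih =>
    intro b b' hb η hη
    -- `1/Γ(z) = z/Γ(z + 1)`: the factor `z` is absorbed by half of the exponent
    obtain ⟨C, hC, h⟩ := ih (b + 1) (b' + 1) (by push_cast at hb; linarith) (η / 2) (by positivity)
    set N := |b| + |b'| + 1 with hN
    refine ⟨C * (N + 2 / η), by positivity, fun z hz1 hz2 => ?_⟩
    rw [one_div_Gamma_eq_self_mul_one_div_Gamma_add_one z, norm_mul]
    have h1 := h (z + 1) (by simpa using hz1) (by simpa using hz2)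
    simp only [add_im, one_im, add_zero] at h1
    have hzn : ‖z‖ ≤ N + z.im ^ 2 := by
      have hr : |z.re| ≤ |b| + |b'| := abs_le.2
        ⟨by linarith [neg_abs_le b, abs_nonneg b'], by linarith [le_abs_self b', abs_nonneg b]⟩
      have : |z.im| ≤ 1 + z.im ^ 2 := by nlinarith [sq_abs z.im, sq_nonneg (|z.im| - 1)]
      linarith [norm_le_abs_re_add_abs_im z]
    have hexp : η / 2 * z.im ^ 2 + 1 ≤ Real.exp (η / 2 * z.im ^ 2) := Real.add_one_le_exp _
    have hx : N + z.im ^ 2 ≤ (N + 2 / η) * Real.exp (η / 2 * z.im ^ 2) := by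
      have h2 : (2 / η) * (η / 2 * z.im ^ 2) = z.im ^ 2 := by field_simp
      have h3 : 1 ≤ Real.exp (η / 2 * z.im ^ 2) := Real.one_le_exp (by positivity)
      have h4 : (2 / η) * (η / 2 * z.im ^ 2 + 1) ≤ 2 / η * Real.exp (η / 2 * z.im ^ 2) := by gcongr
      have h5 : N * 1 ≤ N * Real.exp (η / 2 * z.im ^ 2) := by gcongr
      have : 0 < 2 / η := by positivity
      linarith
    calc _ ≤ ((N + 2 / η) * Real.exp (η / 2 * z.im ^ 2)) * (C * Real.exp (η / 2 * z.im ^ 2)) := by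
          gcongr; exact hzn.trans hx
      _ = C * (N + 2 / η) * (Real.exp (η / 2 * z.im ^ 2) * Real.exp (η / 2 * z.im ^ 2)) := by ring
      _ = _ := by rw [← Real.exp_add]; ring_nf

end LocalMean

open Complex Filter Topology

namespace LocalMean

/-! ### The quotient of the gamma factors and its model -/

namespace Data

variable {d : ℕ} (P : Data d)

/-- `κ = A + B~ - B + 1/2`, the shift for which `Γ(2Aw + κ)` is the model of the gamma factors. -/
noncomputable def kappa : ℂ := P.A + P.BTilde - P.B + 1 / 2

/-- The constant `∏ (2A/α_ν)^(-α_ν + β_ν - β~_ν)`, which is the amplitude of the model of the gamma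
factors up to `1/√(2π)`. -/
noncomputable def ampl : ℂ :=
  ∏ ν, ((2 * P.A / P.alpha ν : ℝ) : ℂ) ^ (-(P.alpha ν : ℂ) + P.beta ν - P.betaTilde ν)

/-- The quotient `Δ~(1-s)/Δ(s)`, with `1/Γ` rewritten by the reflection formula, so that far to the
left all Gamma functions are taken at arguments with large positive real part. -/
noncomputable def gammaQuotient (s : ℂ) : ℂ :=
  ∏ ν, Gamma (P.alpha ν * (1 - s) + P.betaTilde ν) *
    (Gamma (1 - (P.alpha ν * s + P.beta ν)) * sin (Real.pi * (P.alpha ν * s + P.beta ν)) / Real.pi)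

/-- The two dominant exponentials in `∏ 2 sin π(α_ν s + β_ν)`: one of them dominates for
`im s → ∞`, the other for `im s → -∞`. -/
noncomputable def trigSum (s : ℂ) : ℂ :=
  I ^ d * exp (-(Real.pi * (P.A * s + P.B) * I)) + (-I) ^ d * exp (Real.pi * (P.A * s + P.B) * I)

/-- The model of `Δ~(1-s)/Δ(s)` by a single Gamma function times two exponentials. -/
noncomputable def modelQuotient (s : ℂ) : ℂ :=
  (Real.sqrt (2 * Real.pi) : ℂ)⁻¹ * P.ampl * (P.h : ℂ) ^ s * Gamma (P.kappa - 2 * P.A * s) *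
    P.trigSum s

/-- The order of growth of `Δ~(1-s)/Δ(s)` on the line `re s = -c`. -/
noncomputable def growth (c : ℝ) : ℝ := 2 * P.A * c + P.kappa.re - 1 / 2

variable {P}

lemma Admissible.A_pos (hP : P.Admissible) : 0 < P.A := by
  have : Nonempty (Fin d) := ⟨⟨0, hP.d_pos⟩⟩
  exact Finset.sum_pos (fun ν _ => hP.alpha_pos ν) Finset.univ_nonempty

lemma Admissible.ratio_pos (hP : P.Admissible) (ν : Fin d) : 0 < 2 * P.A / P.alpha ν :=
  div_pos (mul_pos two_pos hP.A_pos) (hP.alpha_pos ν)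

lemma Admissible.h_pos (hP : P.Admissible) : 0 < P.h :=
  Finset.prod_pos fun ν _ => Real.rpow_pos_of_pos (hP.ratio_pos ν) _

lemma Admissible.log_h (hP : P.Admissible) :
    Real.log P.h = ∑ ν, 2 * P.alpha ν * Real.log (2 * P.A / P.alpha ν) := by
  rw [h, Real.log_prod fun ν _ => (Real.rpow_pos_of_pos (hP.ratio_pos ν) _).ne']
  exact Finset.sum_congr rfl fun ν _ => Real.log_rpow (hP.ratio_pos ν) _

lemma Admissible.ampl_eq (hP : P.Admissible) : P.ampl = exp (∑ ν,
    (Real.log (2 * P.A / P.alpha ν) : ℂ) * (-(P.alpha ν : ℂ) + P.beta ν - P.betaTilde ν)) := by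
  rw [ampl, exp_sum]
  refine Finset.prod_congr rfl fun ν _ => ?_
  rw [cpow_def_of_ne_zero (by exact_mod_cast (hP.ratio_pos ν).ne'),
    ofReal_log (hP.ratio_pos ν).le]

/-- Stirling's formula turns the product of all Gamma functions into a single one, with a
relative error `O(1/‖w‖)`. -/
theorem Admissible.exists_prod_Gamma_eq (hP : P.Admissible) :
    ∃ W C : ℝ, 1 ≤ W ∧ 0 ≤ C ∧ ∀ w : ℂ, W ≤ w.re → ∃ e : ℂ, ‖e‖ ≤ C / ‖w‖ ∧
      (∏ ν, Gamma (P.alpha ν * w + (P.alpha ν + P.betaTilde ν)) *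
        Gamma (P.alpha ν * w + (1 - P.beta ν))) =
      (2 * Real.pi : ℂ) ^ d * (Real.sqrt (2 * Real.pi) : ℂ)⁻¹ * P.ampl * (P.h : ℂ) ^ (-w) *
        Gamma (P.kappa + 2 * P.A * w) * exp e := by
  have hA := hP.A_pos
  choose W1 C1 hW1 hC1 h1 using fun ν =>
    exists_Gamma_mul_add_eq (hP.alpha_pos ν) (P.alpha ν + P.betaTilde ν)
  choose W2 C2 hW2 hC2 h2 using fun ν => exists_Gamma_mul_add_eq (hP.alpha_pos ν) (1 - P.beta ν)
  obtain ⟨W0, C0, hW0, hC0, h0⟩ := exists_Gamma_mul_add_eq (mul_pos two_pos hA) P.kappa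
  have s1 : 0 ≤ ∑ ν, W1 ν := Finset.sum_nonneg fun ν _ => by linarith [hW1 ν]
  have s2 : 0 ≤ ∑ ν, W2 ν := Finset.sum_nonneg fun ν _ => by linarith [hW2 ν]
  refine ⟨∑ ν, W1 ν + ∑ ν, W2 ν + W0, ∑ ν, C1 ν + ∑ ν, C2 ν + C0, by linarith, ?_, fun w hw => ?_⟩
  · have := Finset.sum_nonneg fun ν (_ : ν ∈ Finset.univ) => hC1 ν
    have := Finset.sum_nonneg fun ν (_ : ν ∈ Finset.univ) => hC2 ν
    linarith
  have l1 : ∀ ν, W1 ν ≤ w.re := fun ν => by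
    have := Finset.single_le_sum (fun ν _ => by linarith [hW1 ν] : ∀ ν ∈ Finset.univ, 0 ≤ W1 ν)
      (Finset.mem_univ ν)
    linarith
  have l2 : ∀ ν, W2 ν ≤ w.re := fun ν => by
    have := Finset.single_le_sum (fun ν _ => by linarith [hW2 ν] : ∀ ν ∈ Finset.univ, 0 ≤ W2 ν)
      (Finset.mem_univ ν)
    linarith
  choose e1 he1 hG1 using fun ν => h1 ν w (l1 ν)
  choose e2 he2 hG2 using fun ν => h2 ν w (l2 ν)
  obtain ⟨e0, he0, hG0⟩ := h0 w (by linarith)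
  have hk : P.kappa + 2 * P.A * w = ((2 * P.A : ℝ) : ℂ) * w + P.kappa := by push_cast; ring
  refine ⟨∑ ν, e1 ν + ∑ ν, e2 ν - e0, ?_, ?_⟩
  · have a1 : ‖∑ ν, e1 ν‖ ≤ ∑ ν, C1 ν / ‖w‖ := norm_sum_le_of_le _ fun ν _ => he1 ν
    have a2 : ‖∑ ν, e2 ν‖ ≤ ∑ ν, C2 ν / ‖w‖ := norm_sum_le_of_le _ fun ν _ => he2 ν
    rw [← Finset.sum_div] at a1 a2
    rw [add_div, add_div]
    exact (norm_sub_le _ _).trans (add_le_add ((norm_add_le _ _).trans (add_le_add a1 a2)) he0)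
  · rw [Finset.prod_mul_distrib, Finset.prod_congr rfl fun ν _ => hG1 ν,
      Finset.prod_congr rfl fun ν _ => hG2 ν, hk, hG0, Finset.prod_mul_distrib,
      Finset.prod_mul_distrib, ← exp_sum, ← exp_sum, Finset.prod_const, Finset.card_univ,
      Fintype.card_fin, hP.ampl_eq, cpow_def_of_ne_zero (by exact_mod_cast hP.h_pos.ne'),
      ← ofReal_log hP.h_pos.le, hP.log_h]
    have hs : (Real.sqrt (2 * Real.pi) : ℂ) * Real.sqrt (2 * Real.pi) = 2 * Real.pi := by
      rw [← ofReal_mul, Real.mul_self_sqrt (by positivity)]; push_cast; ring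
    have hs0 : (Real.sqrt (2 * Real.pi) : ℂ) ≠ 0 := by
      have : 0 < Real.sqrt (2 * Real.pi) := Real.sqrt_pos.2 (by positivity)
      exact_mod_cast this.ne'
    rw [← hs, mul_pow]
    set r := (Real.sqrt (2 * Real.pi) : ℂ)
    set X1 := ∑ ν, ((P.alpha ν * w + (P.alpha ν + P.betaTilde ν) - 1 / 2) *
      (Real.log (P.alpha ν) + log w) - P.alpha ν * w + e1 ν) with hX1
    set X2 := ∑ ν, ((P.alpha ν * w + (1 - P.beta ν) - 1 / 2) *
      (Real.log (P.alpha ν) + log w) - P.alpha ν * w + e2 ν) with hX2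
    set X3 := ∑ ν, (Real.log (2 * P.A / P.alpha ν) : ℂ) *
      (-(P.alpha ν : ℂ) + P.beta ν - P.betaTilde ν) with hX3
    set X4 : ℂ := ((∑ ν, 2 * P.alpha ν * Real.log (2 * P.A / P.alpha ν) : ℝ) : ℂ) * -w with hX4
    set X5 : ℂ := (((2 * P.A : ℝ) : ℂ) * w + P.kappa - 1 / 2) * (Real.log (2 * P.A) + log w)
        - ((2 * P.A : ℝ) : ℂ) * w + e0 with hX5
    have hX : X1 + X2 = X3 + X4 + X5 + (∑ ν, e1 ν + ∑ ν, e2 ν - e0) := by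
      have e5 : X5 = (∑ ν, ((2 * P.alpha ν * w + P.alpha ν + P.betaTilde ν - P.beta ν) *
          (Real.log (2 * P.A) + log w) - 2 * P.alpha ν * w)) + e0 := by
        rw [hX5, Finset.sum_sub_distrib, ← Finset.sum_mul, Finset.sum_sub_distrib,
          Finset.sum_add_distrib, Finset.sum_add_distrib, ← Finset.sum_mul, ← Finset.mul_sum, kappa, BTilde,
          B, A]
        push_cast; ring
      rw [e5, hX4, hX3, ofReal_sum, Finset.sum_mul, hX1, hX2]
      have : ∀ x y z u v e : ℂ, x + y + (z + e) + (u + v - e) = x + y + z + u + v :=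
        fun _ _ _ _ _ _ => by ring
      rw [this, ← Finset.sum_add_distrib, ← Finset.sum_add_distrib, ← Finset.sum_add_distrib,
        ← Finset.sum_add_distrib, ← Finset.sum_add_distrib]
      refine Finset.sum_congr rfl fun ν _ => ?_
      rw [Real.log_div (mul_pos two_pos hA).ne' (hP.alpha_pos ν).ne']
      push_cast; ring
    calc r ^ d * exp X1 * (r ^ d * exp X2) = r ^ d * r ^ d * exp (X1 + X2) := by
          rw [exp_add]; ring
      _ = r ^ d * r ^ d * r⁻¹ * exp X3 * exp X4 * (r * exp X5)
          * exp (∑ ν, e1 ν + ∑ ν, e2 ν - e0) := by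
          rw [hX, exp_add, exp_add, exp_add]; field_simp

/-- The product of sines is dominated by its two extreme exponentials. -/
theorem Admissible.exists_norm_prod_sin_sub_trigSum_le (hP : P.Admissible) :
    ∃ C : ℝ, 0 ≤ C ∧ ∀ s : ℂ,
      ‖∏ ν, 2 * sin (Real.pi * (P.alpha ν * s + P.beta ν)) - P.trigSum s‖ ≤
        C * Real.exp (Real.pi * P.A * |s.im|) / (1 + |s.im|) ∧
      ‖P.trigSum s‖ ≤ C * Real.exp (Real.pi * P.A * |s.im|) := by
  classical
  have : Nonempty (Fin d) := ⟨⟨0, hP.d_pos⟩⟩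
  obtain ⟨ν₀, hν₀⟩ := Finite.exists_min P.alpha
  set m := P.alpha ν₀ with hm
  have hm0 : 0 < m := hP.alpha_pos ν₀
  have hpi := Real.pi_pos
  set K := Real.exp (Real.pi * ∑ ν, |(P.beta ν).im|) with hK
  have hK0 : 0 < K := Real.exp_pos _
  set N : ℝ := ((((Finset.univ : Finset (Fin d)).powerset.erase Finset.univ).erase ∅).card : ℝ) with hN
  -- the product of `2 sin x = i e^{-ix} - i e^{ix}` expanded over the set `S` of factors that
  -- contribute `i e^{-ix}`: the two extreme sets give `trigSum`, and every other term is smaller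
  -- by a factor `e^{-2πm|t|}`
  set F : ℂ → Finset (Fin d) → ℂ := fun s S =>
    (∏ ν ∈ S, I * exp (-(Real.pi * (P.alpha ν * s + P.beta ν) * I))) *
      ∏ ν ∈ Finset.univ \ S, (-I) * exp (Real.pi * (P.alpha ν * s + P.beta ν) * I) with hF
  have hFn : ∀ s S, ‖F s S‖ ≤ K * Real.exp (Real.pi * (|s.im| *
      |∑ ν ∈ S, P.alpha ν - ∑ ν ∈ Finset.univ \ S, P.alpha ν|)) := fun s S => by
    have n1 : ∀ ν, ‖I * exp (-(Real.pi * (P.alpha ν * s + P.beta ν) * I))‖ =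
        Real.exp (Real.pi * (P.alpha ν * s.im + (P.beta ν).im)) := fun ν => by
      rw [norm_mul, norm_I, one_mul, norm_exp]; simp
    have n2 : ∀ ν, ‖(-I) * exp (Real.pi * (P.alpha ν * s + P.beta ν) * I)‖ =
        Real.exp (-(Real.pi * (P.alpha ν * s.im + (P.beta ν).im))) := fun ν => by
      rw [norm_mul, norm_neg, norm_I, one_mul, norm_exp]; simp
    rw [hF, norm_mul, norm_prod, norm_prod, Finset.prod_congr rfl fun ν _ => n1 ν,
      Finset.prod_congr rfl fun ν _ => n2 ν, ← Real.exp_sum, ← Real.exp_sum, ← Real.exp_add, hK,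
      ← Real.exp_add]
    refine Real.exp_le_exp.2 ?_
    rw [Finset.sum_neg_distrib, ← Finset.mul_sum, ← Finset.mul_sum, ← sub_eq_add_neg, ← mul_sub,
      ← mul_add]
    refine mul_le_mul_of_nonneg_left ?_ hpi.le
    rw [Finset.sum_add_distrib, Finset.sum_add_distrib, ← Finset.sum_mul, ← Finset.sum_mul]
    have b1 : (∑ ν ∈ S, P.alpha ν - ∑ ν ∈ Finset.univ \ S, P.alpha ν) * s.im ≤ |s.im| *
      |∑ ν ∈ S, P.alpha ν - ∑ ν ∈ Finset.univ \ S, P.alpha ν| := by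
      rw [mul_comm, ← abs_mul]; exact le_abs_self _
    have b2 : ∑ ν ∈ S, (P.beta ν).im - ∑ ν ∈ Finset.univ \ S, (P.beta ν).im ≤
        ∑ ν, |(P.beta ν).im| := by
      rw [← Finset.sum_sdiff (Finset.subset_univ S), sub_eq_add_neg, add_comm,
        ← Finset.sum_neg_distrib]
      exact add_le_add (Finset.sum_le_sum fun ν _ => neg_le_abs _)
        (Finset.sum_le_sum fun ν _ => le_abs_self _)
    linarith
  have htrig : ∀ s, P.trigSum s = F s Finset.univ + F s ∅ := fun s => by
    simp only [hF, Finset.sdiff_self, Finset.prod_empty, mul_one, Finset.sdiff_empty, one_mul]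
    rw [Finset.prod_mul_distrib, Finset.prod_mul_distrib, ← exp_sum, ← exp_sum, Finset.prod_const,
      Finset.prod_const, Finset.card_univ, Fintype.card_fin, trigSum, Finset.sum_neg_distrib,
      ← Finset.sum_mul, ← Finset.mul_sum, Finset.sum_add_distrib, ← Finset.sum_mul, A, B]
    push_cast; rfl
  have hsplit : ∀ s, ∏ ν, 2 * sin (Real.pi * (P.alpha ν * s + P.beta ν)) - P.trigSum s =
      ∑ S ∈ ((Finset.univ : Finset (Fin d)).powerset.erase Finset.univ).erase ∅, F s S := fun s => by
    have : ∀ ν, 2 * sin (Real.pi * (P.alpha ν * s + P.beta ν)) =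
        I * exp (-(Real.pi * (P.alpha ν * s + P.beta ν) * I)) +
        (-I) * exp (Real.pi * (P.alpha ν * s + P.beta ν) * I) := fun ν => by
      rw [sin, neg_mul]; ring
    rw [Finset.prod_congr rfl fun ν _ => this ν, Finset.prod_add, htrig,
      ← Finset.add_sum_erase _ _ (Finset.mem_powerset_self Finset.univ),
      ← Finset.add_sum_erase (Finset.univ.powerset.erase Finset.univ) _
        (Finset.mem_erase.2 ⟨Finset.univ_nonempty.ne_empty.symm, Finset.empty_mem_powerset _⟩)]
    simp only [hF]; ring
  have hA : ∀ S : Finset (Fin d), ∑ ν ∈ Finset.univ \ S, P.alpha ν + ∑ ν ∈ S, P.alpha ν = P.A :=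
    fun S => Finset.sum_sdiff (Finset.subset_univ S)
  have hpos : ∀ S : Finset (Fin d), S.Nonempty → m ≤ ∑ ν ∈ S, P.alpha ν := fun S hS => by
    obtain ⟨ν, hν⟩ := hS
    exact (hν₀ ν).trans (Finset.single_le_sum (fun ν _ => (hP.alpha_pos ν).le) hν)
  have hext : ∀ S : Finset (Fin d),
      |∑ ν ∈ S, P.alpha ν - ∑ ν ∈ Finset.univ \ S, P.alpha ν| ≤ P.A := fun S => by
    have h1 : 0 ≤ ∑ ν ∈ S, P.alpha ν := Finset.sum_nonneg fun ν _ => (hP.alpha_pos ν).le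
    have h2 : 0 ≤ ∑ ν ∈ Finset.univ \ S, P.alpha ν := Finset.sum_nonneg fun ν _ => (hP.alpha_pos ν).le
    rw [abs_le]; constructor <;> linarith [hA S]
  set M := 1 + 1 / (2 * Real.pi * m) with hM
  have hM0 : 0 < M := by positivity
  refine ⟨N * K * M + 2 * K, by positivity, fun s => ⟨?_, ?_⟩⟩
  · have hb : ∀ S ∈ ((Finset.univ : Finset (Fin d)).powerset.erase Finset.univ).erase ∅,
        ‖F s S‖ ≤ K * M * Real.exp (Real.pi * P.A * |s.im|) / (1 + |s.im|) := fun S hS => by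
      rw [Finset.mem_erase, Finset.mem_erase] at hS
      have g1 := hpos S (Finset.nonempty_iff_ne_empty.2 hS.1)
      have g2 := hpos (Finset.univ \ S) (by
        rw [Finset.sdiff_nonempty]; intro h; exact hS.2.1 (Finset.univ_subset_iff.1 h))
      have g3 : |∑ ν ∈ S, P.alpha ν - ∑ ν ∈ Finset.univ \ S, P.alpha ν| ≤ P.A - 2 * m := by
        rw [abs_le]; constructor <;> linarith [hA S]
      refine (hFn s S).trans ?_
      have g4 : 1 + |s.im| ≤ M * Real.exp (2 * Real.pi * m * |s.im|) := by
        have := Real.add_one_le_exp (2 * Real.pi * m * |s.im|)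
        calc 1 + |s.im| ≤ M * (2 * Real.pi * m * |s.im| + 1) := by
              have h3 : (1 / (2 * Real.pi * m)) * (2 * Real.pi * m * |s.im|) = |s.im| := by field_simp
              have h4 : 0 ≤ 2 * Real.pi * m * |s.im| := by positivity
              have h5 : 0 < 1 / (2 * Real.pi * m) := by positivity
              rw [hM]; nlinarith
          _ ≤ _ := by gcongr
      rw [le_div_iff₀ (by positivity)]
      calc _ ≤ K * Real.exp (Real.pi * (|s.im| * (P.A - 2 * m))) *
            (M * Real.exp (2 * Real.pi * m * |s.im|)) := by gcongr
        _ = K * M * (Real.exp (Real.pi * (|s.im| * (P.A - 2 * m))) *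
            Real.exp (2 * Real.pi * m * |s.im|)) := by ring
        _ = _ := by rw [← Real.exp_add]; ring_nf
    rw [hsplit]
    refine (norm_sum_le_of_le _ hb).trans ?_
    rw [Finset.sum_const, nsmul_eq_mul, ← hN, mul_div_assoc, mul_div_assoc, ← mul_assoc]
    gcongr
    nlinarith
  · rw [htrig]
    have hb : ∀ S, ‖F s S‖ ≤ K * Real.exp (Real.pi * P.A * |s.im|) := fun S => by
      refine (hFn s S).trans ?_
      rw [mul_assoc Real.pi, mul_comm P.A]
      gcongr; exact hext S
    have hE := Real.exp_pos (Real.pi * P.A * |s.im|)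
    have hN0 : 0 ≤ N * K * M := by positivity
    calc _ ≤ K * Real.exp (Real.pi * P.A * |s.im|) + K * Real.exp (Real.pi * P.A * |s.im|) :=
          (norm_add_le _ _).trans (add_le_add (hb _) (hb _))
      _ ≤ _ := by nlinarith

/-- On a vertical line far to the left the gamma quotient agrees with its model up to a relative
error `O(1/|t|)`. -/
theorem Admissible.exists_norm_gammaQuotient_sub_le (hP : P.Admissible) :
    ∃ W : ℝ, 1 ≤ W ∧ ∀ c : ℝ, W ≤ c → 0 ≤ P.growth c → ∃ C : ℝ, 0 ≤ C ∧ ∀ t : ℝ,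
      ‖P.gammaQuotient (-c + t * I) - P.modelQuotient (-c + t * I)‖ ≤
        C * (1 + |t|) ^ (P.growth c - 1) ∧
      ‖P.modelQuotient (-c + t * I)‖ ≤ C * (1 + |t|) ^ P.growth c ∧
      ‖Gamma (P.kappa - 2 * P.A * (-c + t * I))‖ * Real.exp (Real.pi * P.A * |t|) ≤
        C * (1 + |t|) ^ P.growth c := by
  have hA := hP.A_pos
  obtain ⟨W1, C1, hW1, hC1, h1⟩ := hP.exists_prod_Gamma_eq
  obtain ⟨C2, hC2, h2⟩ := hP.exists_norm_prod_sin_sub_trigSum_le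
  obtain ⟨W3, hW3, h3⟩ := exists_norm_Gamma_mul_exp_le (mul_pos two_pos hA) P.kappa
  refine ⟨W1 + W3 + C1, by linarith, fun c hc hg => ?_⟩
  obtain ⟨C3, hC3, h3⟩ := h3 c (by linarith) hg
  set r : ℂ := (Real.sqrt (2 * Real.pi) : ℂ)⁻¹ with hr
  set H := P.h ^ (-c) with hH
  have hH0 : 0 < H := Real.rpow_pos_of_pos hP.h_pos _
  set D := ‖r‖ * ‖P.ampl‖ * H * C3 * C2 with hD
  have hD0 : 0 ≤ D := by positivity
  refine ⟨D * (4 * C1 + 3) + D + C3, by positivity, fun t => ?_⟩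
  set s : ℂ := -c + t * I with hs
  set w : ℂ := c - t * I with hw
  have hsw : s = -w := by rw [hs, hw]; ring
  have hsim : s.im = t := by simp [hs]
  have hsre : s.re = -c := by simp [hs]
  have hwre : w.re = c := by simp [hw]
  have hwim : w.im = -t := by simp [hw]
  have hc1 : 1 ≤ c := by linarith
  have hwn : c ≤ ‖w‖ := hwre ▸ re_le_norm w
  have hwt : |t| ≤ ‖w‖ := by simpa [hwim] using abs_im_le_norm w
  have ht0 := abs_nonneg t
  obtain ⟨e, he, hG⟩ := h1 w (by rw [hwre]; linarith)
  have he1 : ‖e‖ ≤ 1 := he.trans (by rw [div_le_one (by linarith)]; linarith)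
  have he2 : ‖exp e - 1‖ ≤ 4 * C1 / (1 + |t|) := by
    refine (norm_exp_sub_one_le he1).trans ?_
    have : C1 / ‖w‖ ≤ 2 * C1 / (1 + |t|) := by
      rw [div_le_div_iff₀ (by linarith) (by linarith)]; nlinarith
    calc 2 * ‖e‖ ≤ 2 * (2 * C1 / (1 + |t|)) := by gcongr; exact he.trans this
      _ = _ := by ring
  have he3 : ‖exp e‖ ≤ 3 := by
    have := norm_exp_sub_one_le he1
    have h5 : ‖exp e‖ ≤ ‖exp e - 1‖ + 1 := by
      simpa using norm_add_le (exp e - 1) 1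
    linarith
  obtain ⟨hT1, hT2⟩ := h2 s
  rw [hsim] at hT1 hT2
  set T := ∏ ν, 2 * sin (Real.pi * (P.alpha ν * s + P.beta ν)) with hT
  have hΓ := h3 t
  rw [← hw, show Real.pi / 2 * (2 * P.A) = Real.pi * P.A by ring] at hΓ
  rw [show ((2 * P.A : ℝ) : ℂ) * w + P.kappa = P.kappa - 2 * P.A * s by
    rw [hsw]; push_cast; ring] at hΓ
  have hgr : 2 * P.A * c + P.kappa.re - 1 / 2 = P.growth c := rfl
  rw [hgr] at hΓ
  set Γ := Gamma (P.kappa - 2 * P.A * s) with hΓdef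
  set X := (1 + |t|) ^ P.growth c with hX
  have hX0 : 0 < X := Real.rpow_pos_of_pos (by linarith) _
  have hX1 : (1 + |t|) ^ (P.growth c - 1) = X / (1 + |t|) := Real.rpow_sub_one (by linarith) _
  set Q := r * P.ampl * (P.h : ℂ) ^ s * Γ with hQ
  have hQn : ‖Q‖ = ‖r‖ * ‖P.ampl‖ * H * ‖Γ‖ := by
    rw [hQ, norm_mul, norm_mul, norm_mul, norm_cpow_eq_rpow_re_of_pos hP.h_pos, hsre]
  have hgq : P.gammaQuotient s = Q * exp e * T := by
    have hpi : (Real.pi : ℂ) ≠ 0 := by exact_mod_cast Real.pi_ne_zero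
    have hpt : ∀ ν, Gamma (P.alpha ν * (1 - s) + P.betaTilde ν) *
        (Gamma (1 - (P.alpha ν * s + P.beta ν)) * sin (Real.pi * (P.alpha ν * s + P.beta ν)) / Real.pi)
        = Gamma (P.alpha ν * w + (P.alpha ν + P.betaTilde ν)) *
          Gamma (P.alpha ν * w + (1 - P.beta ν)) * (2 * Real.pi : ℂ)⁻¹ *
          (2 * sin (Real.pi * (P.alpha ν * s + P.beta ν))) := fun ν => by
      rw [show P.alpha ν * (1 - s) + P.betaTilde ν = P.alpha ν * w + (P.alpha ν + P.betaTilde ν) by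
        rw [hsw]; ring, show 1 - (P.alpha ν * s + P.beta ν) = P.alpha ν * w + (1 - P.beta ν) by
        rw [hsw]; ring]
      field_simp
    rw [gammaQuotient, Finset.prod_congr rfl fun ν _ => hpt ν, Finset.prod_mul_distrib,
      Finset.prod_mul_distrib, hG, Finset.prod_const, Finset.card_univ, Fintype.card_fin, ← hsw, ← hT,
      hQ, hΓdef, show P.kappa + 2 * P.A * w = P.kappa - 2 * P.A * s by rw [hsw]; ring, inv_pow]
    field_simp
  have hmq : P.modelQuotient s = Q * P.trigSum s := rfl
  set Y := Real.exp (Real.pi * P.A * |t|) with hY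
  have hY0 : 0 < Y := Real.exp_pos _
  have hQY : ‖Q‖ * (C2 * Y) ≤ D * X := by
    rw [hQn]
    calc ‖r‖ * ‖P.ampl‖ * H * ‖Γ‖ * (C2 * Y) = ‖r‖ * ‖P.ampl‖ * H * C2 * (‖Γ‖ * Y) := by ring
      _ ≤ ‖r‖ * ‖P.ampl‖ * H * C2 * (C3 * X) := by gcongr
      _ = _ := by rw [hD]; ring
  refine ⟨?_, ?_, ?_⟩
  · rw [hgq, hmq, hX1]
    have : Q * exp e * T - Q * P.trigSum s =
        Q * (exp e * (T - P.trigSum s) + (exp e - 1) * P.trigSum s) := by ring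
    rw [this, norm_mul]
    have hin : ‖exp e * (T - P.trigSum s) + (exp e - 1) * P.trigSum s‖ ≤
        (4 * C1 + 3) / (1 + |t|) * (C2 * Y) := by
      calc _ ≤ 3 * (C2 * Y / (1 + |t|)) + 4 * C1 / (1 + |t|) * (C2 * Y) := by
            refine (norm_add_le _ _).trans (add_le_add ?_ ?_) <;> rw [norm_mul] <;> gcongr
        _ = _ := by ring
    calc _ ≤ ‖Q‖ * ((4 * C1 + 3) / (1 + |t|) * (C2 * Y)) := by gcongr
      _ = (4 * C1 + 3) / (1 + |t|) * (‖Q‖ * (C2 * Y)) := by ring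
      _ ≤ (4 * C1 + 3) / (1 + |t|) * (D * X) := by gcongr
      _ = D * (4 * C1 + 3) * (X / (1 + |t|)) := by ring
      _ ≤ _ := by gcongr; linarith
  · rw [hmq, norm_mul]
    calc _ ≤ ‖Q‖ * (C2 * Y) := by gcongr
      _ ≤ D * X := hQY
      _ ≤ _ := by
        gcongr
        have : 0 ≤ D * (4 * C1 + 3) := by positivity
        linarith
  · refine hΓ.trans ?_
    gcongr
    have : 0 ≤ D * (4 * C1 + 3) := by positivity
    linarith

end Data

end LocalMean

open Complex Filter Topology MeasureTheory Set
open scoped ContDiff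

namespace LocalMean

/-! ### The Mellin transform of the rescaled weight -/

/-- The Mellin transform of the rescaled weight `u ↦ f((u - 1)L)`. -/
noncomputable def weightMellin (f : ℝ → ℝ) (L : ℝ) (s : ℂ) : ℂ :=
  mellin (fun u => (weight f L u : ℂ)) s

variable {f : ℝ → ℝ} {L : ℝ}

lemma weight_eq_zero (hf : Function.support f ⊆ Icc (-1) 1) (hL : 0 < L) {u : ℝ}
    (hu : u ∉ Icc (1 - 1 / L) (1 + 1 / L)) : weight f L u = 0 := by
  by_contra h
  have := hf h
  refine hu ⟨?_, ?_⟩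
  · have h1 := this.1
    have : -(1 / L) ≤ u - 1 := by
      rw [← neg_div, div_le_iff₀ hL]; exact h1
    linarith
  · have h1 := this.2
    have : u - 1 ≤ 1 / L := by rwa [le_div_iff₀ hL]
    linarith

lemma weight_eq_zero' (hf : Function.support f ⊆ Icc (-1) 1) (hL : 2 ≤ L) {u : ℝ}
    (hu : u < 1 / 2 ∨ 3 / 2 < u) : weight f L u = 0 := by
  refine weight_eq_zero hf (by linarith) fun h => ?_
  have : 1 / L ≤ 1 / 2 := one_div_le_one_div_of_le (by norm_num) hL
  rcases hu with hu | hu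
  · linarith [h.1]
  · linarith [h.2]

lemma continuous_weight (hf : Continuous f) : Continuous (weight f L) := by
  unfold weight; fun_prop

lemma continuousOn_ofReal_cpow_Ioi (z : ℂ) : ContinuousOn (fun u : ℝ => (u : ℂ) ^ z) (Ioi 0) :=
  fun _ hu => (continuousAt_ofReal_cpow_const _ _ (Or.inr (ne_of_gt hu))).continuousWithinAt

lemma weightMellin_eq_setIntegral (hs : Function.support f ⊆ Icc (-1) 1) (hL : 2 ≤ L) (z : ℂ) :
    weightMellin f L z =
      ∫ u in Icc (1 - 1 / L) (1 + 1 / L), (u : ℂ) ^ (z - 1) * (weight f L u : ℂ) := by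
  have h2 : 1 / L ≤ 1 / 2 := one_div_le_one_div_of_le (by norm_num) hL
  unfold weightMellin mellin
  simp only [smul_eq_mul]
  refine setIntegral_eq_of_subset_of_forall_sdiff_eq_zero measurableSet_Ioi ?_ ?_
  · intro u hu; simp only [mem_Ioi]; linarith [hu.1]
  · intro u hu
    rw [weight_eq_zero hs (by linarith) hu.2]; simp

lemma rpow_le_two_rpow_abs {u : ℝ} (h1 : 1 / 2 ≤ u) (h2 : u ≤ 2) (x : ℝ) : u ^ x ≤ 2 ^ |x| := by
  have hu : 0 < u := by linarith
  rw [Real.rpow_def_of_pos hu, Real.rpow_def_of_pos two_pos]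
  refine Real.exp_le_exp.2 ((le_abs_self _).trans ?_)
  rw [abs_mul]
  gcongr
  rw [abs_le]
  constructor
  · rw [← Real.log_inv]; apply Real.log_le_log <;> linarith
  · exact Real.log_le_log hu h2

lemma norm_weightMellin_le (hs : Function.support f ⊆ Icc (-1) 1) {K : ℝ} (hK : ∀ u, |f u| ≤ K)
    (hL : 2 ≤ L) (z : ℂ) : ‖weightMellin f L z‖ ≤ 2 ^ |z.re - 1| * K * 2 / L := by
  have h2 : 1 / L ≤ 1 / 2 := one_div_le_one_div_of_le (by norm_num) hL
  have hL0 : 0 < 1 / L := by positivity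
  rw [weightMellin_eq_setIntegral hs hL]
  refine (norm_setIntegral_le_of_norm_le_const (C := 2 ^ |z.re - 1| * K) (by simp) fun u hu => ?_).trans ?_
  · have hu0 : 0 < u := by linarith [hu.1]
    rw [norm_mul, norm_cpow_eq_rpow_re_of_pos hu0, norm_real, sub_re, one_re]
    gcongr
    · exact rpow_le_two_rpow_abs (by linarith [hu.1]) (by linarith [hu.2]) _
    · exact hK _
  · rw [Measure.real, Real.volume_Icc, ENNReal.toReal_ofReal (by linarith)]
    apply le_of_eq; ring

/-- Integration by parts: each factor `s` costs one factor `L`. -/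
lemma mul_weightMellin (hf : ContDiff ℝ 1 f) (hs : Function.support f ⊆ Icc (-1) 1) (hL : 2 ≤ L)
    (z : ℂ) : z * weightMellin f L z = -(L * weightMellin (deriv f) L (z + 1)) := by
  have hs' : Function.support (deriv f) ⊆ Icc (-1) 1 := by
    refine (subset_tsupport _).trans ((tsupport_deriv_subset (f := f)).trans ?_)
    exact closure_minimal hs isClosed_Icc
  have hI : ∀ g : ℝ → ℝ, Function.support g ⊆ Icc (-1) 1 → ∀ z : ℂ,
      weightMellin g L z = ∫ u in (1 / 4 : ℝ)..2, (u : ℂ) ^ (z - 1) * (weight g L u : ℂ) := by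
    intro g hg z
    rw [intervalIntegral.integral_of_le (by norm_num)]
    unfold weightMellin mellin
    simp only [smul_eq_mul]
    refine setIntegral_eq_of_subset_of_forall_sdiff_eq_zero measurableSet_Ioi ?_ ?_
    · intro u hu; simp only [mem_Ioi]; linarith [hu.1]
    · intro u hu
      rw [weight_eq_zero' hg hL]
      · simp
      · by_contra h
        push Not at h
        exact hu.2 ⟨by linarith [h.1], by linarith [h.2]⟩
  have hd1 : ∀ u ∈ uIcc (1 / 4 : ℝ) 2, HasDerivAt (fun u : ℝ => (u : ℂ) ^ z) (z * (u : ℂ) ^ (z - 1)) u := by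
    intro u hu
    rw [uIcc_of_le (by norm_num)] at hu
    have := ((hasDerivAt_id (u : ℂ)).cpow_const (c := z) (by simp; linarith [hu.1])).comp_ofReal
    simpa using this
  have hd2 : ∀ u ∈ uIcc (1 / 4 : ℝ) 2, HasDerivAt (fun u : ℝ => (weight f L u : ℂ))
      ((L * weight (deriv f) L u : ℝ) : ℂ) u := by
    intro u _
    have h1 : HasDerivAt f (deriv f ((u - 1) * L)) ((u - 1) * L) :=
      (hf.differentiable (by norm_num) _).hasDerivAt
    have h2 : HasDerivAt (fun u : ℝ => (u - 1) * L) L u := by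
      simpa using ((hasDerivAt_id u).sub_const 1).mul_const L
    have := (h1.comp u h2).ofReal_comp
    rw [mul_comm] at this
    exact this
  have hc2 : Continuous (deriv f) := hf.continuous_deriv le_rfl
  have hpow : ∀ z : ℂ, ContinuousOn (fun u : ℝ => (u : ℂ) ^ z) (uIcc (1 / 4 : ℝ) 2) := fun z =>
    (continuousOn_ofReal_cpow_Ioi z).mono fun u hu => by
      rw [uIcc_of_le (by norm_num)] at hu; simp only [mem_Ioi]; linarith [hu.1]
  have hparts := intervalIntegral.integral_mul_deriv_eq_deriv_mul hd1 hd2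
    ((continuousOn_const.mul (hpow _)).intervalIntegrable)
    (by apply Continuous.intervalIntegrable
        exact continuous_ofReal.comp (continuous_const.mul (continuous_weight hc2)))
  rw [weight_eq_zero' hs hL (u := 2) (Or.inr (by norm_num)),
    weight_eq_zero' hs hL (u := 1 / 4) (Or.inl (by norm_num))] at hparts
  rw [hI f hs, hI _ hs', ← intervalIntegral.integral_const_mul, ← intervalIntegral.integral_const_mul]
  have e1 : ∫ u in (1 / 4 : ℝ)..2, (L : ℂ) * ((u : ℂ) ^ (z + 1 - 1) * (weight (deriv f) L u : ℂ)) =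
      ∫ u in (1 / 4 : ℝ)..2, (u : ℂ) ^ z * ((L * weight (deriv f) L u : ℝ) : ℂ) := by
    congr 1; ext u; rw [add_sub_cancel_right]; push_cast; ring
  have e2 : ∫ u in (1 / 4 : ℝ)..2, z * ((u : ℂ) ^ (z - 1) * (weight f L u : ℂ)) =
      ∫ u in (1 / 4 : ℝ)..2, z * (u : ℂ) ^ (z - 1) * (weight f L u : ℂ) := by
    congr 1; ext u; ring
  rw [e1, e2, hparts]; simp

lemma exists_abs_le_of_support (hf : Continuous f) (hs : Function.support f ⊆ Icc (-1) 1) :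
    ∃ K, 0 ≤ K ∧ ∀ u, |f u| ≤ K := by
  obtain ⟨K, hK⟩ := (isCompact_Icc (a := (-1 : ℝ)) (b := 1)).exists_bound_of_continuousOn hf.continuousOn
  refine ⟨max K 0, le_max_right _ _, fun u => ?_⟩
  by_cases hu : u ∈ Icc (-1 : ℝ) 1
  · exact (hK u hu).trans (le_max_left _ _)
  · have : f u = 0 := by by_contra h; exact hu (hs h)
    simp [this]

/-- Decay in `t` to any order `M`, at the cost of `L ^ M`, by repeated integration by parts. -/
lemma exists_pow_mul_norm_weightMellin_le (M : ℕ) : ∀ f : ℝ → ℝ, ContDiff ℝ ∞ f →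
    Function.support f ⊆ Icc (-1) 1 → ∀ σ : ℝ, ∃ C, 0 ≤ C ∧ ∀ L : ℝ, 2 ≤ L → ∀ t : ℝ,
      |t| ^ M * ‖weightMellin f L (σ + t * I)‖ ≤ C * L ^ M / L := by
  induction M with
  | zero =>
    intro f hf hs σ
    obtain ⟨K, hK0, hK⟩ := exists_abs_le_of_support hf.continuous hs
    refine ⟨2 ^ |σ - 1| * K * 2, by positivity, fun L hL t => ?_⟩
    simpa using norm_weightMellin_le hs hK hL (σ + t * I)
  | succ M ih =>
    intro f hf hs σ
    have hs' : Function.support (deriv f) ⊆ Icc (-1) 1 :=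
      (subset_tsupport _).trans ((tsupport_deriv_subset (f := f)).trans
        (closure_minimal hs isClosed_Icc))
    have hf' : ContDiff ℝ ∞ (deriv f) := (contDiff_infty_iff_deriv.1 hf).2
    obtain ⟨C, hC, h⟩ := ih (deriv f) hf' hs' (σ + 1)
    refine ⟨C, hC, fun L hL t => ?_⟩
    have hm := congrArg norm (mul_weightMellin (hf.of_le (by exact_mod_cast le_top)) hs hL (σ + t * I))
    rw [norm_mul, norm_neg, norm_mul, norm_real, Real.norm_of_nonneg (by linarith)] at hm
    have ht : |t| ≤ ‖(σ + t * I : ℂ)‖ := by simpa using abs_im_le_norm (σ + t * I : ℂ)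
    have h1 := h L hL t
    rw [show ((σ + 1 : ℝ) : ℂ) + t * I = σ + t * I + 1 by push_cast; ring] at h1
    calc |t| ^ (M + 1) * ‖weightMellin f L (σ + t * I)‖
        ≤ |t| ^ M * (‖(σ + t * I : ℂ)‖ * ‖weightMellin f L (σ + t * I)‖) := by
          rw [pow_succ, mul_assoc]; gcongr
      _ = L * (|t| ^ M * ‖weightMellin (deriv f) L (σ + t * I + 1)‖) := by rw [hm]; ring
      _ ≤ L * (C * L ^ M / L) := by gcongr
      _ = _ := by rw [pow_succ]; ring

/-- Rapid decay of the Mellin transform of the rescaled weight on the scale `L`, uniformly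
in `L`. -/
theorem exists_norm_weightMellin_le (M : ℕ) (hf : ContDiff ℝ ∞ f)
    (hs : Function.support f ⊆ Icc (-1) 1) (σ : ℝ) : ∃ C, 0 ≤ C ∧ ∀ L : ℝ, 2 ≤ L → ∀ t : ℝ,
      ‖weightMellin f L (σ + t * I)‖ * (1 + |t| / L) ^ M ≤ C / L := by
  obtain ⟨C0, hC0, h0⟩ := exists_pow_mul_norm_weightMellin_le 0 f hf hs σ
  obtain ⟨C1, hC1, h1⟩ := exists_pow_mul_norm_weightMellin_le M f hf hs σ
  refine ⟨2 ^ M * (C0 + C1), by positivity, fun L hL t => ?_⟩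
  have hL0 : 0 < L := by linarith
  have a0 := h0 L hL t
  have a1 := h1 L hL t
  simp only [pow_zero, one_mul, mul_one] at a0
  have hp : (1 + |t| / L) ^ M ≤ 2 ^ M * (1 + |t| ^ M / L ^ M) := by
    have := add_pow_le (zero_le_one' ℝ) (by positivity : 0 ≤ |t| / L) M
    rw [one_pow, div_pow] at this
    refine this.trans ?_
    gcongr
    · norm_num
    · omega
  set m := ‖weightMellin f L (σ + t * I)‖
  calc m * (1 + |t| / L) ^ M ≤ m * (2 ^ M * (1 + |t| ^ M / L ^ M)) := by gcongr
    _ = 2 ^ M * (m + (|t| ^ M * m) / L ^ M) := by ring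
    _ ≤ 2 ^ M * (C0 / L + (C1 * L ^ M / L) / L ^ M) := by gcongr
    _ = _ := by field_simp

lemma locallyIntegrable_weight (hf : Continuous f) :
    LocallyIntegrableOn (fun u => (weight f L u : ℂ)) (Ioi 0) :=
  (continuous_ofReal.comp (continuous_weight hf)).locallyIntegrable.locallyIntegrableOn _

lemma differentiable_weightMellin (hf : Continuous f) (hs : Function.support f ⊆ Icc (-1) 1)
    (hL : 2 ≤ L) : Differentiable ℂ (weightMellin f L) := fun z => by
  refine mellin_differentiableAt_of_isBigO_rpow (a := z.re + 1) (b := z.re - 1)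
    (locallyIntegrable_weight hf) ?_ (by linarith) ?_ (by linarith)
  · refine Asymptotics.IsBigO.of_bound 0 ?_
    filter_upwards [eventually_gt_atTop (3 / 2)] with u hu
    simp [weight_eq_zero' hs hL (Or.inr hu)]
  · refine Asymptotics.IsBigO.of_bound 0 ?_
    filter_upwards [nhdsWithin_le_nhds (Iio_mem_nhds (by norm_num : (0 : ℝ) < 1 / 2))] with u hu
    simp [weight_eq_zero' hs hL (Or.inl hu)]

lemma mellinConvergent_weight (hf : Continuous f) (hs : Function.support f ⊆ Icc (-1) 1)
    (hL : 2 ≤ L) (z : ℂ) : MellinConvergent (fun u => (weight f L u : ℂ)) z := by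
  refine mellinConvergent_of_isBigO_rpow (a := z.re + 1) (b := z.re - 1)
    (locallyIntegrable_weight hf) ?_ (by linarith) ?_ (by linarith)
  · refine Asymptotics.IsBigO.of_bound 0 ?_
    filter_upwards [eventually_gt_atTop (3 / 2)] with u hu
    simp [weight_eq_zero' hs hL (Or.inr hu)]
  · refine Asymptotics.IsBigO.of_bound 0 ?_
    filter_upwards [nhdsWithin_le_nhds (Iio_mem_nhds (by norm_num : (0 : ℝ) < 1 / 2))] with u hu
    simp [weight_eq_zero' hs hL (Or.inl hu)]

/-- Polynomial growth of degree `r` on a vertical line is absorbed by the decay of the weight,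
with the correct dependence on the scale `L`. -/
theorem exists_integral_rpow_mul_norm_weightMellin_le (hf : ContDiff ℝ ∞ f)
    (hs : Function.support f ⊆ Icc (-1) 1) (σ : ℝ) {r : ℝ} (hr : 0 ≤ r) : ∃ C, 0 ≤ C ∧ ∀ L : ℝ,
      2 ≤ L → Integrable (fun t : ℝ => (1 + |t|) ^ r * ‖weightMellin f L (σ + t * I)‖) ∧
      ∫ t : ℝ, (1 + |t|) ^ r * ‖weightMellin f L (σ + t * I)‖ ≤ C * L ^ r := by
  obtain ⟨M, hM⟩ := exists_nat_ge (r + 2)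
  obtain ⟨C, hC, h⟩ := exists_norm_weightMellin_le M hf hs σ
  have hint : Integrable fun t : ℝ => (1 + |t|) ^ (-2 : ℝ) := by
    simpa using integrable_one_add_norm (E := ℝ) (μ := volume) (r := 2) (by simp)
  set J := ∫ t : ℝ, (1 + |t|) ^ (-2 : ℝ) with hJ
  have hJ0 : 0 ≤ J := integral_nonneg fun t => by positivity
  refine ⟨C * J, by positivity, fun L hL => ?_⟩
  have hL0 : 0 < L := by linarith
  have hb : ∀ t : ℝ, (1 + |t|) ^ r * ‖weightMellin f L (σ + t * I)‖ ≤
      C * L ^ r * (L⁻¹ * (1 + |L⁻¹ * t|) ^ (-2 : ℝ)) := fun t => by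
    set q := 1 + |t| / L with hq
    have hq1 : 1 ≤ q := by rw [hq]; linarith [(by positivity : 0 ≤ |t| / L)]
    have hq0 : 0 < q := by linarith
    have e1 : 1 + |L⁻¹ * t| = q := by
      rw [abs_mul, abs_of_pos (inv_pos.2 hL0), hq]; ring
    have e2 : 1 + |t| ≤ L * q := by
      rw [hq, mul_add, mul_div_cancel₀ _ hL0.ne']; linarith
    have e3 : q ^ r * ‖weightMellin f L (σ + t * I)‖ ≤ C / L * q ^ (-2 : ℝ) := by
      rw [Real.rpow_neg hq0.le, ← div_eq_mul_inv, le_div_iff₀ (by positivity), mul_right_comm,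
        ← Real.rpow_add hq0]
      calc _ ≤ q ^ (M : ℝ) * ‖weightMellin f L (σ + t * I)‖ := by gcongr
        _ = ‖weightMellin f L (σ + t * I)‖ * q ^ M := by rw [Real.rpow_natCast, mul_comm]
        _ ≤ _ := h L hL t
    rw [e1]
    calc (1 + |t|) ^ r * ‖weightMellin f L (σ + t * I)‖
        ≤ (L * q) ^ r * ‖weightMellin f L (σ + t * I)‖ := by gcongr
      _ = L ^ r * (q ^ r * ‖weightMellin f L (σ + t * I)‖) := by
          rw [Real.mul_rpow hL0.le hq0.le, mul_assoc]
      _ ≤ L ^ r * (C / L * q ^ (-2 : ℝ)) := by gcongr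
      _ = _ := by ring
  have hint2 : Integrable fun t : ℝ => C * L ^ r * (L⁻¹ * (1 + |L⁻¹ * t|) ^ (-2 : ℝ)) :=
    ((hint.comp_mul_left' (inv_ne_zero hL0.ne')).const_mul _).const_mul _
  have hcont : Continuous fun t : ℝ => (1 + |t|) ^ r * ‖weightMellin f L (σ + t * I)‖ := by
    refine Continuous.mul ?_ ?_
    · exact Continuous.rpow_const (by fun_prop) fun t => Or.inr hr
    · exact ((differentiable_weightMellin hf.continuous hs hL).continuous.comp (by fun_prop)).norm
  have hint3 := hint2.mono' hcont.aestronglyMeasurable (Eventually.of_forall fun t => by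
    rw [Real.norm_of_nonneg (by positivity)]; exact hb t)
  refine ⟨hint3, (integral_mono hint3 hint2 hb).trans (le_of_eq ?_)⟩
  rw [integral_const_mul, integral_const_mul,
    Measure.integral_comp_mul_left (fun t : ℝ => (1 + |t|) ^ (-2 : ℝ)) L⁻¹, inv_inv,
    abs_of_pos hL0, smul_eq_mul, ← hJ]
  field_simp

lemma integrable_weightMellin (hf : ContDiff ℝ ∞ f) (hs : Function.support f ⊆ Icc (-1) 1)
    (hL : 2 ≤ L) (σ : ℝ) : Integrable fun t : ℝ => weightMellin f L (σ + t * I) := by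
  obtain ⟨C, hC, h⟩ := exists_integral_rpow_mul_norm_weightMellin_le hf hs σ (r := 0) le_rfl
  have := (h L hL).1
  simp only [Real.rpow_zero, one_mul] at this
  refine (integrable_norm_iff ?_).1 this
  exact ((differentiable_weightMellin hf.continuous hs hL).continuous.comp
    (by fun_prop)).aestronglyMeasurable

/-- Mellin inversion for the weight. -/
theorem weight_eq_integral (hf : ContDiff ℝ ∞ f) (hs : Function.support f ⊆ Icc (-1) 1)
    (hL : 2 ≤ L) (σ : ℝ) {u : ℝ} (hu : 0 < u) :
    (2 * Real.pi : ℂ)⁻¹ * ∫ t : ℝ, (u : ℂ) ^ (-(σ + t * I)) * weightMellin f L (σ + t * I) =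
      weight f L u := by
  have := mellinInv_mellin_eq σ (fun u => (weight f L u : ℂ)) hu
    (mellinConvergent_weight hf.continuous hs hL σ) (integrable_weightMellin hf hs hL σ)
    (continuous_ofReal.comp (continuous_weight hf.continuous)).continuousAt
  rw [← this, mellinInv, Complex.real_smul]
  simp only [smul_eq_mul]
  congr 1
  push_cast; simp

end LocalMean

open Complex Filter Topology MeasureTheory Set
open scoped ContDiff

namespace LocalMean

/-! ### Mellin convolution of the weight with the Gamma function -/

variable {f : ℝ → ℝ} {L : ℝ}

lemma ofReal_cpow_eq_exp {x : ℝ} (hx : 0 < x) (z : ℂ) : (x : ℂ) ^ z = exp (Real.log x * z) := by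
  rw [cpow_def_of_ne_zero (by exact_mod_cast hx.ne'), ofReal_log hx.le]

lemma integrableOn_cpow_mul_weight_rpow (hf : Continuous f) (hs : Function.support f ⊆ Icc (-1) 1)
    (hL : 2 ≤ L) {a : ℝ} (ha : 0 < a) {Z : ℝ} (hZ : 0 < Z) (z : ℂ) :
    IntegrableOn (fun v : ℝ => (v : ℂ) ^ z * (weight f L (v ^ a / Z) : ℂ)) (Ioi 0) := by
  have hlo : 0 < (Z / 2) ^ (1 / a) := by positivity
  have hsub : Icc ((Z / 2) ^ (1 / a)) ((3 * Z / 2) ^ (1 / a)) ⊆ Ioi 0 :=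
    fun v hv => lt_of_lt_of_le hlo hv.1
  have h1 : IntegrableOn (fun v : ℝ => (v : ℂ) ^ z * (weight f L (v ^ a / Z) : ℂ))
      (Icc ((Z / 2) ^ (1 / a)) ((3 * Z / 2) ^ (1 / a))) := by
    refine ContinuousOn.integrableOn_compact isCompact_Icc ?_
    refine ((continuousOn_ofReal_cpow_Ioi z).mono hsub).mul ?_
    refine continuous_ofReal.comp_continuousOn ((continuous_weight hf).comp_continuousOn ?_)
    refine ContinuousOn.div_const ?_ _
    exact continuousOn_id.rpow_const fun v hv => Or.inl (hsub hv).ne'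
  refine h1.of_forall_sdiff_eq_zero measurableSet_Ioi fun v hv => ?_
  have hv0 : (0 : ℝ) < v := hv.1
  rw [weight_eq_zero' hs hL]
  · simp
  · by_contra h
    push Not at h
    refine hv.2 ⟨?_, ?_⟩
    · have := h.1
      rw [le_div_iff₀ hZ] at this
      rw [one_div, Real.rpow_inv_le_iff_of_pos (by positivity) hv0.le ha]; linarith
    · have := h.2
      rw [div_le_iff₀ hZ] at this
      rw [one_div, Real.le_rpow_inv_iff_of_pos hv0.le (by positivity) ha]; linarith

lemma integrableOn_rpow_mul_exp_neg_mul {x b : ℝ} (hx : 0 < x) (hb : 0 < b) :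
    IntegrableOn (fun v : ℝ => v ^ (x - 1) * Real.exp (-(b * v))) (Ioi 0) := by
  have := Real.GammaIntegral_convergent hx
  have h2 := (integrableOn_Ioi_comp_mul_left_iff
    (fun v : ℝ => Real.exp (-v) * v ^ (x - 1)) 0 hb).2 (by simpa using this)
  have h3 : IntegrableOn (fun v : ℝ => (b ^ (x - 1))⁻¹ *
      (Real.exp (-(b * v)) * (b * v) ^ (x - 1))) (Ioi 0) := Integrable.const_mul h2 _
  refine h3.congr_fun (fun v hv => ?_) measurableSet_Ioi
  have hpp : 0 < b ^ (x - 1) := Real.rpow_pos_of_pos hb _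
  simp only
  rw [Real.mul_rpow hb.le (le_of_lt hv)]
  field_simp

/-- Euler's integral for `Γ(q) p⁻ᵠ` with complex `p`, by analytic continuation from `p > 0`. -/
theorem integral_cpow_mul_exp_neg_mul_Ioi_of_re_pos {q p : ℂ} (hq : 0 < q.re) (hp : 0 < p.re) :
    ∫ v in Ioi (0 : ℝ), (v : ℂ) ^ (q - 1) * exp (-(p * v)) = (1 / p) ^ q * Gamma q := by
  set U : Set ℂ := {p : ℂ | 0 < p.re} with hU
  have hUo : IsOpen U := isOpen_lt continuous_const continuous_re
  have hnorm : ∀ (z w : ℂ) (v : ℝ), 0 < v →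
      ‖(v : ℂ) ^ z * exp (-(w * v))‖ = v ^ z.re * Real.exp (-(w.re * v)) := fun z w v hv => by
    rw [norm_mul, norm_cpow_eq_rpow_re_of_pos hv, norm_exp]; simp
  have hmeas : ∀ z w : ℂ, AEStronglyMeasurable (fun v : ℝ => (v : ℂ) ^ z * exp (-(w * v)))
      (volume.restrict (Ioi 0)) := fun z w => Measurable.aestronglyMeasurable (by fun_prop)
  have hd : DifferentiableOn ℂ (fun p : ℂ => ∫ v in Ioi (0 : ℝ), (v : ℂ) ^ (q - 1) * exp (-(p * v))) U := by
    intro p₀ hp₀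
    have hp₀' : 0 < p₀.re := hp₀
    have := hasDerivAt_integral_of_dominated_loc_of_deriv_le (μ := volume.restrict (Ioi (0 : ℝ)))
      (F := fun p v => (v : ℂ) ^ (q - 1) * exp (-(p * v)))
      (F' := fun p v => -((v : ℂ) ^ (q - 1) * v * exp (-(p * v)))) (x₀ := p₀)
      (bound := fun v => v ^ (q.re + 1 - 1) * Real.exp (-(p₀.re / 2 * v)))
      (Metric.ball_mem_nhds p₀ (half_pos hp₀')) (Eventually.of_forall fun p => hmeas _ _)
      ?_ ?_ ?_ (integrableOn_rpow_mul_exp_neg_mul (by linarith) (half_pos hp₀')) ?_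
    · exact this.2.differentiableAt.differentiableWithinAt
    · refine (integrableOn_rpow_mul_exp_neg_mul hq hp₀').mono' (hmeas _ _) ?_
      filter_upwards [ae_restrict_mem measurableSet_Ioi] with v hv
      rw [hnorm _ _ _ hv]; simp
    · exact Measurable.aestronglyMeasurable (by fun_prop)
    · filter_upwards [ae_restrict_mem measurableSet_Ioi] with v hv p hp
      have hv0 : (0 : ℝ) < v := hv
      have : (v : ℂ) ^ (q - 1) * v = (v : ℂ) ^ q := by
        have hvC : (v : ℂ) ≠ 0 := by exact_mod_cast hv0.ne'
        rw [cpow_sub _ _ hvC, cpow_one]; field_simp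
      rw [this, norm_neg, hnorm _ _ _ hv, add_sub_cancel_right]
      gcongr
      have h1 : |(p - p₀).re| < p₀.re / 2 :=
        (abs_re_le_norm _).trans_lt (by rwa [← dist_eq_norm])
      have := (abs_lt.1 h1).1
      rw [sub_re] at this; linarith
    · refine Eventually.of_forall fun v p _ => ?_
      have h1 : HasDerivAt (fun p : ℂ => exp (-(p * v))) (exp (-(p * v)) * (-(1 * v))) p :=
        (((hasDerivAt_id p).mul_const (v : ℂ)).neg).cexp
      have h2 := h1.const_mul ((v : ℂ) ^ (q - 1))
      exact h2.congr_deriv (by ring)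
  have hd2 : DifferentiableOn ℂ (fun p : ℂ => (1 / p) ^ q * Gamma q) U := by
    intro p hp
    have hp' : 0 < p.re := hp
    have hp0 : p ≠ 0 := fun h => by simp [h] at hp'
    refine DifferentiableAt.differentiableWithinAt ?_
    refine DifferentiableAt.mul_const (DifferentiableAt.cpow_const ?_ ?_) _
    · exact (differentiableAt_const _).div differentiableAt_id hp0
    · refine Or.inl ?_
      rw [one_div, inv_re]
      exact div_pos hp' (normSq_pos.2 hp0)
  have hpre : IsPreconnected U := (convex_halfSpace_re_gt 0).isPreconnected
  have heq : ∃ᶠ p in 𝓝[≠] (1 : ℂ), ∫ v in Ioi (0 : ℝ), (v : ℂ) ^ (q - 1) * exp (-(p * v)) =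
      (1 / p) ^ q * Gamma q := by
    have ht : Tendsto (fun x : ℝ => (x : ℂ)) (𝓝[>] 1) (𝓝[≠] 1) := by
      refine tendsto_nhdsWithin_iff.2 ⟨?_, ?_⟩
      · exact (continuous_ofReal.tendsto' _ _ (by simp)).mono_left nhdsWithin_le_nhds
      · filter_upwards [self_mem_nhdsWithin] with x hx
        have : x ≠ 1 := ne_of_gt hx
        simpa using this
    refine ht.frequently (Eventually.frequently ?_)
    filter_upwards [self_mem_nhdsWithin] with x hx
    exact integral_cpow_mul_exp_neg_mul_Ioi hq (zero_lt_one.trans hx)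
  exact (hd.analyticOnNhd hUo).eqOn_of_preconnected_of_frequently_eq (hd2.analyticOnNhd hUo) hpre
    (by simp [hU]) heq hp

/-- Mellin convolution of the weight with `e^{-pv}`, for `p` in the open right half-plane. -/
lemma integral_Gamma_mul_weightMellin_of_re_pos (hf : ContDiff ℝ ∞ f)
    (hs : Function.support f ⊆ Icc (-1) 1) (hL : 2 ≤ L) {a : ℝ} {κ : ℂ} {c : ℝ}
    (hc : 0 < κ.re + a * c) {Z : ℝ} (hZ : 0 < Z) {p : ℂ} (hp : 0 < p.re) :
    (2 * Real.pi : ℂ)⁻¹ * ∫ t : ℝ, Gamma (κ - a * (-c + t * I)) * (1 / p) ^ (κ - a * (-c + t * I)) *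
        ((Z : ℂ) ^ (-c + t * I : ℂ) * weightMellin f L (-c + t * I)) =
      ∫ v in Ioi (0 : ℝ), exp (-(p * v)) * ((v : ℂ) ^ (κ - 1) * (weight f L (v ^ a / Z) : ℂ)) := by
  have hmc : Continuous fun t : ℝ => weightMellin f L (-c + t * I) :=
    (differentiable_weightMellin hf.continuous hs hL).continuous.comp (by fun_prop)
  have hmi : Integrable fun t : ℝ => weightMellin f L (-c + t * I) := by
    simpa using integrable_weightMellin hf hs hL (-c)
  have hre : ∀ t : ℝ, (κ - a * (-c + t * I)).re = κ.re + a * c := fun t => by simp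
  have hG : ∀ t : ℝ, Gamma (κ - a * (-c + t * I)) * (1 / p) ^ (κ - a * (-c + t * I)) =
      ∫ v in Ioi (0 : ℝ), (v : ℂ) ^ (κ - a * (-c + t * I) - 1) * exp (-(p * v)) := fun t => by
    rw [integral_cpow_mul_exp_neg_mul_Ioi_of_re_pos (by rw [hre]; exact hc) hp, mul_comm]
  have hnorm := integrableOn_rpow_mul_exp_neg_mul hc hp
  have hint : Integrable (Function.uncurry fun (t v : ℝ) =>
      (v : ℂ) ^ (κ - a * (-c + t * I) - 1) * exp (-(p * v)) *
        ((Z : ℂ) ^ (-c + t * I : ℂ) * weightMellin f L (-c + t * I)))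
      (volume.prod (volume.restrict (Ioi 0))) := by
    have hprod := (hmi.norm.const_mul (Z ^ (-c))).mul_prod hnorm
    refine hprod.mono' ?_ ?_
    · refine Measurable.aestronglyMeasurable ?_
      unfold Function.uncurry
      have : Measurable fun x : ℝ × ℝ => weightMellin f L (-c + x.1 * I) :=
        hmc.measurable.comp measurable_fst
      fun_prop
    · have : ∀ᵐ x : ℝ × ℝ ∂(volume.prod (volume.restrict (Ioi 0))), x.2 ∈ Ioi (0 : ℝ) := by
        have h := Measure.quasiMeasurePreserving_snd (μ := (volume : Measure ℝ))
          (ν := (volume : Measure ℝ).restrict (Ioi 0))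
        exact h.ae (ae_restrict_mem measurableSet_Ioi)
      filter_upwards [this] with x hx
      have e1 : ‖(x.2 : ℂ) ^ (κ - a * (-c + x.1 * I) - 1)‖ = x.2 ^ (κ.re + a * c - 1) := by
        rw [norm_cpow_eq_rpow_re_of_pos hx, sub_re, hre, one_re]
      have e2 : ‖exp (-(p * x.2))‖ = Real.exp (-(p.re * x.2)) := by
        rw [norm_exp]; simp
      have e3 : ‖(Z : ℂ) ^ (-c + x.1 * I : ℂ)‖ = Z ^ (-c) := by
        rw [norm_cpow_eq_rpow_re_of_pos hZ]; simp
      simp only [Function.uncurry, norm_mul, e1, e2, e3]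
      apply le_of_eq; ring
  calc _ = (2 * Real.pi : ℂ)⁻¹ * ∫ t : ℝ, ∫ v in Ioi (0 : ℝ),
        (v : ℂ) ^ (κ - a * (-c + t * I) - 1) * exp (-(p * v)) *
        ((Z : ℂ) ^ (-c + t * I : ℂ) * weightMellin f L (-c + t * I)) := by
        congr 2; ext t; rw [hG, integral_mul_const]
    _ = (2 * Real.pi : ℂ)⁻¹ * ∫ v in Ioi (0 : ℝ), ∫ t : ℝ,
        (v : ℂ) ^ (κ - a * (-c + t * I) - 1) * exp (-(p * v)) *
        ((Z : ℂ) ^ (-c + t * I : ℂ) * weightMellin f L (-c + t * I)) := by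
        rw [integral_integral_swap hint]
    _ = ∫ v in Ioi (0 : ℝ), exp (-(p * v)) * ((v : ℂ) ^ (κ - 1) * (weight f L (v ^ a / Z) : ℂ)) := by
        rw [← integral_const_mul]
        refine setIntegral_congr_fun measurableSet_Ioi fun v hv => ?_
        have hv0 : (0 : ℝ) < v := hv
        have hu : 0 < v ^ a / Z := div_pos (Real.rpow_pos_of_pos hv0 _) hZ
        rw [← weight_eq_integral hf hs hL (-c) hu, ← integral_const_mul, ← integral_const_mul,
          ← integral_const_mul, ← integral_const_mul]
        congr 1; ext t
        rw [ofReal_cpow_eq_exp hv0, ofReal_cpow_eq_exp hv0, ofReal_cpow_eq_exp hZ,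
          ofReal_cpow_eq_exp hu, Real.log_div (Real.rpow_pos_of_pos hv0 _).ne' hZ.ne',
          Real.log_rpow hv0]
        have : exp (Real.log v * (κ - a * (-c + t * I) - 1)) * exp (Real.log Z * (-c + t * I)) =
            exp (Real.log v * (κ - 1)) *
            exp (((a * Real.log v - Real.log Z : ℝ) : ℂ) * -(((-c : ℝ) : ℂ) + t * I)) := by
          rw [← exp_add, ← exp_add]; congr 1; push_cast; ring
        push_cast at this ⊢
        linear_combination (2 * (Real.pi : ℂ))⁻¹ * exp (-(p * v)) *
          weightMellin f L (-c + t * I) * this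

/-- The limit of `integral_Gamma_mul_weightMellin_of_re_pos` as `p → ∓i`: the Mellin convolution
of the weight with `e^{±iv}`. -/
theorem integral_Gamma_mul_weightMellin (hf : ContDiff ℝ ∞ f)
    (hs : Function.support f ⊆ Icc (-1) 1) (hL : 2 ≤ L) {a : ℝ} (ha : 0 < a) {κ : ℂ} {c : ℝ}
    (hc : 0 < κ.re + a * c) {Z : ℝ} (hZ : 0 < Z) {C r : ℝ} (hr : 0 ≤ r)
    (hΓ : ∀ t : ℝ, ‖Gamma (κ - a * (-c + t * I))‖ * Real.exp (Real.pi / 2 * a * |t|) ≤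
      C * (1 + |t|) ^ r) {ε : ℝ} (hε : |ε| = 1) :
    (2 * Real.pi : ℂ)⁻¹ * ∫ t : ℝ, Gamma (κ - a * (-c + t * I)) *
        exp (ε * (Real.pi / 2) * I * (κ - a * (-c + t * I))) *
        ((Z : ℂ) ^ (-c + t * I : ℂ) * weightMellin f L (-c + t * I)) =
      ∫ v in Ioi (0 : ℝ), exp (ε * v * I) * ((v : ℂ) ^ (κ - 1) * (weight f L (v ^ a / Z) : ℂ)) := by
  have hmc : Continuous fun t : ℝ => weightMellin f L (-c + t * I) :=
    (differentiable_weightMellin hf.continuous hs hL).continuous.comp (by fun_prop)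
  have hre : ∀ t : ℝ, (κ - a * (-c + t * I)).re = κ.re + a * c := fun t => by simp
  have him : ∀ t : ℝ, (κ - a * (-c + t * I)).im = κ.im - a * t := fun t => by simp
  have hpi := Real.pi_pos
  have hΓc : Continuous fun t : ℝ => Gamma (κ - a * (-c + t * I)) := by
    rw [continuous_iff_continuousAt]
    intro t
    refine ContinuousAt.comp (g := Gamma) (f := fun t : ℝ => κ - a * (-c + t * I)) ?_ (by fun_prop)
    refine (differentiableAt_Gamma _ fun m h => ?_).continuousAt
    have := congrArg re h
    rw [hre] at this
    simp at this
    linarith [(m.cast_nonneg : (0 : ℝ) ≤ m)]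
  have hcs : ∀ θ : ℝ, Real.cos (ε * θ) = Real.cos θ := fun θ => by
    rcases eq_or_eq_neg_of_abs_eq hε with h | h <;> simp [h]
  have hnear : ∀ᶠ θ in 𝓝[<] (Real.pi / 2), θ ∈ Ioo 0 (Real.pi / 2) :=
    Ioo_mem_nhdsLT (by positivity)
  -- the identity for `p = e^{-iεθ}` with `0 < θ < π/2`; both sides are continuous as `θ → π/2`
  have key : ∀ᶠ θ : ℝ in 𝓝[<] (Real.pi / 2),
      (2 * Real.pi : ℂ)⁻¹ * ∫ t : ℝ, Gamma (κ - a * (-c + t * I)) *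
        exp (ε * θ * I * (κ - a * (-c + t * I))) *
        ((Z : ℂ) ^ (-c + t * I : ℂ) * weightMellin f L (-c + t * I)) =
      ∫ v in Ioi (0 : ℝ), exp (-(exp (-(ε * θ * I)) * v)) *
        ((v : ℂ) ^ (κ - 1) * (weight f L (v ^ a / Z) : ℂ)) := by
    filter_upwards [hnear] with θ hθ
    have hp : 0 < (exp (-(ε * θ * I))).re := by
      rw [exp_re]
      have : (-(ε * θ * I) : ℂ).im = -(ε * θ) := by simp
      rw [this, Real.cos_neg, hcs]
      have := Real.cos_pos_of_mem_Ioo (x := θ) ⟨by linarith [hθ.1], hθ.2⟩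
      positivity
    rw [← integral_Gamma_mul_weightMellin_of_re_pos hf hs hL hc hZ hp]
    congr 2; ext t
    congr 2
    rw [one_div, ← exp_neg, neg_neg, cpow_def_of_ne_zero (exp_ne_zero _), log_exp]
    · have : |ε * θ| < Real.pi := by
        rw [abs_mul, hε, one_mul, abs_of_pos hθ.1]; linarith [hθ.2]
      simpa using (abs_lt.1 this).1
    · have : |ε * θ| < Real.pi := by
        rw [abs_mul, hε, one_mul, abs_of_pos hθ.1]; linarith [hθ.2]
      simpa using (abs_lt.1 this).2.le
  have hL1 : Tendsto (fun θ : ℝ => ∫ t : ℝ, Gamma (κ - a * (-c + t * I)) *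
        exp (ε * θ * I * (κ - a * (-c + t * I))) *
        ((Z : ℂ) ^ (-c + t * I : ℂ) * weightMellin f L (-c + t * I))) (𝓝[<] (Real.pi / 2))
      (𝓝 (∫ t : ℝ, Gamma (κ - a * (-c + t * I)) *
        exp (ε * (Real.pi / 2) * I * (κ - a * (-c + t * I))) *
        ((Z : ℂ) ^ (-c + t * I : ℂ) * weightMellin f L (-c + t * I)))) := by
    -- the exponential growth of `e^{iεθq}` is compensated by the decay of `Γ(q)`, uniformly in `θ`
    obtain ⟨C', hC', hi⟩ := exists_integral_rpow_mul_norm_weightMellin_le hf hs (-c) hr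
    have hi := (hi L hL).1
    refine tendsto_integral_filter_of_dominated_convergence
      (fun t => C * Real.exp (Real.pi / 2 * |κ.im|) * Z ^ (-c) * ((1 + |t|) ^ r *
        ‖weightMellin f L (((-c : ℝ) : ℂ) + t * I)‖)) ?_ ?_ (hi.const_mul _) ?_
    · refine Eventually.of_forall fun θ => Continuous.aestronglyMeasurable ?_
      refine (hΓc.mul (by fun_prop)).mul (Continuous.mul ?_ hmc)
      exact Continuous.const_cpow (by fun_prop) (Or.inl (by exact_mod_cast hZ.ne'))
    · filter_upwards [hnear] with θ hθ
      refine Eventually.of_forall fun t => ?_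
      have e1 : ‖exp (ε * θ * I * (κ - a * (-c + t * I)))‖ ≤
          Real.exp (Real.pi / 2 * |κ.im|) * Real.exp (Real.pi / 2 * a * |t|) := by
        rw [norm_exp, ← Real.exp_add]
        refine Real.exp_le_exp.2 ?_
        have : (ε * θ * I * (κ - a * (-c + t * I)) : ℂ).re = -(ε * θ * (κ.im - a * t)) := by
          rw [← him, show (ε * θ * I * (κ - a * (-c + t * I)) : ℂ) =
            ((ε * θ : ℝ) : ℂ) * (I * (κ - a * (-c + t * I))) by push_cast; ring, re_ofReal_mul,
            I_mul_re]; ring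
        rw [this]
        refine (neg_le_abs _).trans ?_
        rw [abs_mul, abs_mul, hε, one_mul, abs_of_pos hθ.1]
        calc θ * |κ.im - a * t| ≤ Real.pi / 2 * (|κ.im| + a * |t|) := by
              gcongr
              · exact hθ.2.le
              · refine (abs_sub _ _).trans ?_
                rw [abs_mul, abs_of_pos ha]
          _ = _ := by ring
      have e3 : ‖(Z : ℂ) ^ (-c + t * I : ℂ)‖ = Z ^ (-c) := by
        rw [norm_cpow_eq_rpow_re_of_pos hZ]; simp
      rw [norm_mul, norm_mul, norm_mul, e3]
      push_cast
      calc _ ≤ ‖Gamma (κ - a * (-c + t * I))‖ *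
              (Real.exp (Real.pi / 2 * |κ.im|) * Real.exp (Real.pi / 2 * a * |t|)) *
              (Z ^ (-c) * ‖weightMellin f L (-c + t * I)‖) := by gcongr
        _ = (‖Gamma (κ - a * (-c + t * I))‖ * Real.exp (Real.pi / 2 * a * |t|)) *
              (Real.exp (Real.pi / 2 * |κ.im|) * Z ^ (-c) * ‖weightMellin f L (-c + t * I)‖) := by ring
        _ ≤ (C * (1 + |t|) ^ r) *
              (Real.exp (Real.pi / 2 * |κ.im|) * Z ^ (-c) * ‖weightMellin f L (-c + t * I)‖) := by
            exact mul_le_mul_of_nonneg_right (hΓ t) (by positivity)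
        _ = _ := by ring
    · refine Eventually.of_forall fun t => ?_
      have : Continuous fun θ : ℝ => Gamma (κ - a * (-c + t * I)) *
          exp (ε * θ * I * (κ - a * (-c + t * I))) *
          ((Z : ℂ) ^ (-c + t * I : ℂ) * weightMellin f L (-c + t * I)) := by fun_prop
      have := (this.tendsto (Real.pi / 2)).mono_left (nhdsWithin_le_nhds (s := Iio (Real.pi / 2)))
      simpa using this
  have hR1 : Tendsto (fun θ : ℝ => ∫ v in Ioi (0 : ℝ), exp (-(exp (-(ε * θ * I)) * v)) *
        ((v : ℂ) ^ (κ - 1) * (weight f L (v ^ a / Z) : ℂ))) (𝓝[<] (Real.pi / 2))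
      (𝓝 (∫ v in Ioi (0 : ℝ), exp (ε * v * I) *
        ((v : ℂ) ^ (κ - 1) * (weight f L (v ^ a / Z) : ℂ)))) := by
    have hi := integrableOn_cpow_mul_weight_rpow hf.continuous hs hL ha hZ (κ - 1)
    refine tendsto_integral_filter_of_dominated_convergence
      (fun v => ‖(v : ℂ) ^ (κ - 1) * (weight f L (v ^ a / Z) : ℂ)‖) ?_ ?_ hi.norm ?_
    · refine Eventually.of_forall fun θ => AEStronglyMeasurable.mul ?_ hi.aestronglyMeasurable
      exact Continuous.aestronglyMeasurable (by fun_prop)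
    · filter_upwards [hnear] with θ hθ
      filter_upwards [ae_restrict_mem measurableSet_Ioi] with v hv
      rw [norm_mul]
      refine mul_le_of_le_one_left (norm_nonneg _) ?_
      rw [norm_exp, Real.exp_le_one_iff]
      have : (-(exp (-(ε * θ * I)) * v)).re = -((exp (-(ε * θ * I))).re * v) := by simp
      rw [this, exp_re]
      have : (-(ε * θ * I) : ℂ).im = -(ε * θ) := by simp
      rw [this, Real.cos_neg, hcs]
      have := Real.cos_pos_of_mem_Ioo (x := θ) ⟨by linarith [hθ.1], hθ.2⟩
      have hv0 : (0 : ℝ) < v := hv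
      rw [neg_nonpos]; positivity
    · refine Eventually.of_forall fun v => ?_
      have h1 : Continuous fun θ : ℝ => exp (-(exp (-(ε * θ * I)) * v)) *
          ((v : ℂ) ^ (κ - 1) * (weight f L (v ^ a / Z) : ℂ)) := by fun_prop
      have h2 := (h1.tendsto (Real.pi / 2)).mono_left (nhdsWithin_le_nhds (s := Iio (Real.pi / 2)))
      have h3 : exp (-(ε * ((Real.pi / 2 : ℝ) : ℂ) * I)) = -(ε * I) := by
        rcases eq_or_eq_neg_of_abs_eq hε with h | h
        · rw [h, show (-(((1 : ℝ) : ℂ) * ((Real.pi / 2 : ℝ) : ℂ) * I)) = -Real.pi / 2 * I by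
            push_cast; ring, exp_neg_pi_div_two_mul_I]; simp
        · rw [h, show (-(((-1 : ℝ) : ℂ) * ((Real.pi / 2 : ℝ) : ℂ) * I)) = Real.pi / 2 * I by
            push_cast; ring, exp_pi_div_two_mul_I]; simp
      rw [h3] at h2
      rwa [show ε * v * I = -(-(ε * I) * v) by ring]
  have := (hL1.const_mul ((2 * Real.pi : ℂ)⁻¹)).congr' key
  exact tendsto_nhds_unique this hR1

end LocalMean

open Complex Filter Topology MeasureTheory Set

namespace LocalMean

/-! ### Moving a line of integration across a disc -/

/-- The integral along the boundary of the rectangle `[x₁, x₂] × [-T, T]`. -/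
noncomputable def rectIntegral (F : ℂ → ℂ) (x₁ x₂ T : ℝ) : ℂ :=
  (∫ x : ℝ in x₁..x₂, F (x + (-T : ℝ) * I)) - (∫ x : ℝ in x₁..x₂, F (x + T * I)) +
    I * (∫ y : ℝ in (-T)..T, F (x₂ + y * I)) - I * (∫ y : ℝ in (-T)..T, F (x₁ + y * I))

lemma rectIntegral_eq_zero {F : ℂ → ℂ} {x₁ x₂ T : ℝ}
    (hF : DifferentiableOn ℂ F (uIcc x₁ x₂ ×ℂ uIcc (-T) T)) : rectIntegral F x₁ x₂ T = 0 := by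
  have := integral_boundary_rect_eq_zero_of_differentiableOn F (x₁ + (-T : ℝ) * I) (x₂ + T * I)
    (by simpa using hF)
  simpa [rectIntegral] using this

lemma log_neg_of_im_pos {w : ℂ} (hw : 0 < w.im) : log (-w) = log w - Real.pi * I := by
  rw [log, log, norm_neg, arg_neg_eq_arg_sub_pi_of_im_pos hw]; push_cast; ring

lemma log_neg_of_im_neg {w : ℂ} (hw : w.im < 0) : log (-w) = log w + Real.pi * I := by
  rw [log, log, norm_neg, arg_neg_eq_arg_add_pi_of_im_neg hw]; push_cast; ring

/-- The winding number of a rectangle about an interior point, by explicit primitives: the two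
branches `log w` and `log (-w)` differ by `πi` or `-πi` at the corners. -/
lemma rectIntegral_sub_inv {x₁ x₂ T : ℝ} {z : ℂ} (h1 : x₁ < z.re) (h2 : z.re < x₂)
    (h3 : |z.im| < T) : rectIntegral (fun s => (s - z)⁻¹) x₁ x₂ T = 2 * Real.pi * I := by
  obtain ⟨h4, h5⟩ := abs_lt.1 h3
  have hne : ∀ p : ℝ → ℂ, (∀ u, p u - z ≠ 0) → Continuous p →
      ∀ a b : ℝ, IntervalIntegrable (fun u => (p u - z)⁻¹) volume a b := fun p hp hc a b =>
    ((hc.sub continuous_const).inv₀ hp).intervalIntegrable _ _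
  have hor : ∀ τ : ℝ, τ ≠ z.im → ∫ x : ℝ in x₁..x₂, ((x : ℂ) + τ * I - z)⁻¹ =
      log (x₂ + τ * I - z) - log (x₁ + τ * I - z) := fun τ hτ => by
    refine intervalIntegral.integral_eq_sub_of_hasDerivAt
      (f := fun x : ℝ => log ((x : ℂ) + τ * I - z)) (fun x _ => ?_) ?_
    · have h0 : HasDerivAt (fun x : ℂ => x + τ * I - z) 1 (x : ℂ) :=
        ((hasDerivAt_id (x : ℂ)).add_const _).sub_const _
      have := (h0.clog (Or.inr (by simpa [sub_eq_zero] using hτ))).comp_ofReal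
      simpa using this
    · exact hne _ (fun u h => hτ (by simpa [sub_eq_zero] using congrArg im h)) (by fun_prop) _ _
  have hright : I * ∫ y : ℝ in (-T)..T, ((x₂ : ℂ) + y * I - z)⁻¹ =
      log (x₂ + T * I - z) - log (x₂ + (-T : ℝ) * I - z) := by
    rw [← intervalIntegral.integral_const_mul]
    refine intervalIntegral.integral_eq_sub_of_hasDerivAt
      (f := fun y : ℝ => log ((x₂ : ℂ) + y * I - z)) (fun y _ => ?_) ?_
    · have h0 : HasDerivAt (fun y : ℂ => x₂ + y * I - z) (1 * I) (y : ℂ) :=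
        (((hasDerivAt_id (y : ℂ)).mul_const I).const_add _).sub_const _
      have := (h0.clog (Or.inl (by simpa using h2))).comp_ofReal
      simpa [div_eq_mul_inv] using this
    · refine (hne _ (fun u h => ?_) (by fun_prop) _ _).const_mul _
      have := congrArg re h; simp at this; linarith
  have hleft : I * ∫ y : ℝ in (-T)..T, ((x₁ : ℂ) + y * I - z)⁻¹ =
      log (-(x₁ + T * I - z)) - log (-(x₁ + (-T : ℝ) * I - z)) := by
    rw [← intervalIntegral.integral_const_mul]
    refine intervalIntegral.integral_eq_sub_of_hasDerivAt
      (f := fun y : ℝ => log (-((x₁ : ℂ) + y * I - z))) (fun y _ => ?_) ?_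
    · have h0 : HasDerivAt (fun y : ℂ => -(x₁ + y * I - z)) (-(1 * I)) (y : ℂ) :=
        ((((hasDerivAt_id (y : ℂ)).mul_const I).const_add _).sub_const _).neg
      have := (h0.clog (Or.inl (by simpa using h1))).comp_ofReal
      rw [neg_div_neg_eq] at this
      simpa [div_eq_mul_inv] using this
    · refine (hne _ (fun u h => ?_) (by fun_prop) _ _).const_mul _
      have := congrArg re h; simp at this; linarith
  rw [rectIntegral, hright, hleft, hor _ (by linarith), hor _ (by linarith),
    log_neg_of_im_pos (by simp; linarith), log_neg_of_im_neg (by simp; linarith)]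
  ring

lemma continuous_inv_sub_circleMap {R : ℝ} (hR : 0 ≤ R) {γ : ℝ → ℂ}
    (hγ : Continuous γ) (hγR : ∀ u, R < ‖γ u‖) :
    Continuous (Function.uncurry fun u θ : ℝ => (γ u - circleMap 0 R θ)⁻¹) := by
  unfold Function.uncurry
  refine Continuous.inv₀ ?_ fun x h => ?_
  · exact (hγ.comp continuous_fst).sub ((continuous_circleMap 0 R).comp continuous_snd)
  · have h1 : ‖circleMap 0 R x.2‖ = R := by
      simpa using circleMap_mem_sphere 0 hR x.2
    rw [sub_eq_zero] at h
    have := hγR x.1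
    rw [h, h1] at this
    exact lt_irrefl _ this

lemma circleIntegrable_integral_inv_mul {R a b : ℝ} (hR : 0 ≤ R) {f : ℂ → ℂ} {γ : ℝ → ℂ}
    (hf : ContinuousOn f (Metric.sphere 0 R)) (hγ : Continuous γ) (hγR : ∀ u, R < ‖γ u‖) :
    CircleIntegrable (fun z => (∫ u in a..b, (γ u - z)⁻¹) * f z) 0 R := by
  have hfc : Continuous fun θ : ℝ => f (circleMap 0 R θ) :=
    hf.comp_continuous (continuous_circleMap 0 R) fun θ => circleMap_mem_sphere 0 hR θ
  refine Continuous.intervalIntegrable (Continuous.mul ?_ hfc) _ _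
  exact intervalIntegral.continuous_parametric_intervalIntegral_of_continuous'
    (f := fun θ u => (γ u - circleMap 0 R θ)⁻¹) ((continuous_inv_sub_circleMap hR hγ hγR).comp continuous_swap) a b

lemma integral_circleIntegral_swap {R a b : ℝ} (hR : 0 ≤ R) {f : ℂ → ℂ} {γ : ℝ → ℂ}
    (hf : ContinuousOn f (Metric.sphere 0 R)) (hγ : Continuous γ) (hγR : ∀ u, R < ‖γ u‖) :
    ∫ u in a..b, ∮ z in C(0, R), (γ u - z)⁻¹ * f z =
      ∮ z in C(0, R), (∫ u in a..b, (γ u - z)⁻¹) * f z := by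
  unfold circleIntegral
  have hfc : Continuous fun θ : ℝ => f (circleMap 0 R θ) :=
    hf.comp_continuous (continuous_circleMap 0 R) fun θ => circleMap_mem_sphere 0 hR θ
  have hcont : Continuous (Function.uncurry fun u θ : ℝ =>
      deriv (circleMap 0 R) θ • ((γ u - circleMap 0 R θ)⁻¹ * f (circleMap 0 R θ))) := by
    have h0 := continuous_inv_sub_circleMap hR hγ hγR
    unfold Function.uncurry at h0 ⊢
    simp only [deriv_circleMap, smul_eq_mul]
    refine Continuous.mul ?_ (h0.mul (hfc.comp continuous_snd))
    exact ((continuous_circleMap 0 R).comp continuous_snd).mul continuous_const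
  rw [intervalIntegral_intervalIntegral_swap]
  · congr 1; ext θ
    rw [intervalIntegral.integral_smul, intervalIntegral.integral_mul_const]
  · exact (hcont.continuousOn.integrableOn_compact (isCompact_uIcc.prod isCompact_uIcc)).mono_set
      (prod_mono uIoc_subset_uIcc uIoc_subset_uIcc)

/-- The residue theorem in the form needed: the integral around a rectangle of a function that is
holomorphic outside a disc equals the integral around the disc. -/
theorem rectIntegral_eq_circleIntegral {R x₁ x₂ T : ℝ} (hR : 0 < R) (h1 : x₁ < -R) (h2 : R < x₂)
    (h3 : R < T) {f : ℂ → ℂ} (hf : ∀ s, R ≤ ‖s‖ → DifferentiableAt ℂ f s) :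
    rectIntegral f x₁ x₂ T = ∮ z in C(0, R), f z := by
  have hpi : (2 * Real.pi * I : ℂ) ≠ 0 := by simp [Real.pi_ne_zero]
  -- a disc that contains the rectangle
  set R₂ : ℝ := |x₁| + |x₂| + T + 1 with hR₂
  have hx1 : R < |x₁| := by rw [abs_of_neg (by linarith)]; linarith
  have hx2 : R < |x₂| := by rw [abs_of_pos (by linarith)]; linarith
  have hRR : R < R₂ := by linarith
  have hR₂0 : 0 < R₂ := by linarith
  have hfc : ∀ r, R ≤ r → ContinuousOn f (Metric.sphere 0 r) := fun r hr s hs => by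
    have : ‖s‖ = r := by simpa using hs
    exact (hf s (by rw [this]; exact hr)).continuousAt.continuousWithinAt
  -- Cauchy's formula on the annulus splits `f = f₁ + f₂ / (2πi)` with `f₁` holomorphic in the large
  -- disc; `f₁` integrates to `0` around the rectangle, and in the integral of `f₂` the Cauchy kernel
  -- is integrated first
  set f₁ : ℂ → ℂ := fun s => (2 * Real.pi * I : ℂ)⁻¹ • ∮ z in C(0, R₂), (z - s)⁻¹ • f z with hf₁
  set f₂ : ℂ → ℂ := fun s => ∮ z in C(0, R), (s - z)⁻¹ * f z with hf₂
  have hf₁d : DifferentiableOn ℂ f₁ (Metric.ball 0 R₂) := by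
    have := (hasFPowerSeriesOn_cauchy_integral (f := f) (c := 0) (R := ⟨R₂, hR₂0.le⟩)
      ((hfc _ hRR.le).circleIntegrable hR₂0.le) hR₂0).differentiableOn
    exact this.mono (Metric.eball_coe (ε := (⟨R₂, hR₂0.le⟩ : NNReal))).ge
  have hdec : ∀ s : ℂ, R < ‖s‖ → ‖s‖ < R₂ → f s = f₁ s + (2 * Real.pi * I : ℂ)⁻¹ * f₂ s := by
    intro s hs1 hs2
    have hA : Metric.closedBall (0 : ℂ) R₂ \ Metric.ball 0 R ∈ 𝓝 s := by
      refine inter_mem (Metric.closedBall_mem_nhds_of_mem (by simpa using hs2)) ?_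
      refine mem_of_superset ((isOpen_lt continuous_const continuous_norm).mem_nhds hs1) ?_
      intro z (hz : R < ‖z‖) h; simp at h; linarith
    have hann := circleIntegral_eq_of_differentiable_on_annulus_off_countable (c := 0) hR hRR.le
      (f := dslope f s) (countable_singleton s)
      ((continuousOn_dslope hA).2 ⟨fun z hz => (hf z (by simpa using hz.2)).continuousAt.continuousWithinAt,
        hf s hs1.le⟩)
      (fun z hz => (differentiableAt_dslope_of_ne (by simpa using hz.2)).2
        (hf z (by have := hz.1.2; simp at this; exact this.le)))
    have hcirc : ∀ r, 0 < r → R ≤ r → r ≠ ‖s‖ → ∮ z in C(0, r), dslope f s z =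
        (∮ z in C(0, r), (z - s)⁻¹ * f z) - (∮ z in C(0, r), (z - s)⁻¹) * f s := by
      intro r hr hRr hrs
      have hinv : ContinuousOn (fun z => (z - s)⁻¹) (Metric.sphere (0 : ℂ) r) := by
        refine ContinuousOn.inv₀ (by fun_prop) fun z hz h => hrs ?_
        rw [sub_eq_zero] at h
        rw [← h]; simpa using hz.symm
      have hconst : (∮ z in C(0, r), (z - s)⁻¹) * f s = ∮ z in C(0, r), (z - s)⁻¹ * f s := by
        simp only [circleIntegral, smul_eq_mul, ← mul_assoc]
        rw [intervalIntegral.integral_mul_const]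
      rw [hconst, ← circleIntegral.integral_sub]
      · refine circleIntegral.integral_congr hr.le fun z hz => ?_
        have hzs : z ≠ s := fun h => hrs (by rw [← h]; simpa using hz.symm)
        rw [dslope_of_ne _ hzs, slope_def_field]
        ring
      · exact (hinv.mul (hfc r hRr)).circleIntegrable hr.le
      · exact (hinv.mul continuousOn_const).circleIntegrable hr.le
    have hz0 : ∮ z in C(0, R), (z - s)⁻¹ = 0 := by
      refine DiffContOnCl.circleIntegral_eq_zero hR.le ?_
      refine DifferentiableOn.diffContOnCl fun z hz => ?_
      rw [closure_ball _ hR.ne'] at hz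
      have hzs : z - s ≠ 0 := fun h => by
        rw [sub_eq_zero] at h
        rw [h] at hz; simp at hz; linarith
      exact ((differentiableAt_id.sub_const s).inv hzs).differentiableWithinAt
    have hz1 : ∮ z in C(0, R₂), (z - s)⁻¹ = 2 * Real.pi * I :=
      circleIntegral.integral_sub_inv_of_mem_ball (by simpa using hs2)
    rw [hcirc R₂ hR₂0 hRR.le hs2.ne', hcirc R hR le_rfl hs1.ne, hz0, hz1, zero_mul, sub_zero] at hann
    simp only [hf₁, hf₂, smul_eq_mul]
    have hneg : ∮ z in C(0, R), (s - z)⁻¹ * f z = -∮ z in C(0, R), (z - s)⁻¹ * f z := by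
      rw [← neg_one_mul, ← circleIntegral.integral_const_mul]
      congr 1; ext z
      rw [← neg_sub z s, inv_neg]; ring
    rw [hneg, ← hann]
    field_simp
    ring
  -- points of the boundary lie between the two circles
  have hbd : ∀ x y : ℝ, |x| ≤ |x₁| + |x₂| → |y| ≤ T → ‖(x + y * I : ℂ)‖ < R₂ := fun x y hx hy => by
    have := norm_add_le (x : ℂ) (y * I)
    simp only [norm_mul, norm_real, norm_I, mul_one, Real.norm_eq_abs] at this
    linarith
  have hT0 : 0 < T := by linarith
  have habs : ∀ x ∈ uIcc x₁ x₂, |x| ≤ |x₁| + |x₂| := fun x hx => by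
    rw [uIcc_of_le (by linarith)] at hx
    rw [abs_le]
    constructor
    · linarith [neg_abs_le x₁, hx.1, abs_nonneg x₂]
    · linarith [le_abs_self x₂, hx.2, abs_nonneg x₁]
  have habsT : ∀ y ∈ uIcc (-T) T, |y| ≤ T := fun y hy => by
    rw [uIcc_of_le (by linarith)] at hy; exact abs_le.2 hy
  have hhor : ∀ τ : ℝ, |τ| = T → ∀ x : ℝ, R < ‖(x + τ * I : ℂ)‖ := fun τ hτ x => by
    have := abs_im_le_norm (x + τ * I : ℂ)
    simp [hτ] at this; linarith
  have hver : ∀ x : ℝ, R < |x| → ∀ y : ℝ, R < ‖(x + y * I : ℂ)‖ := fun x hx y => by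
    have := abs_re_le_norm (x + y * I : ℂ)
    simp at this; linarith
  have hfR := hfc R le_rfl
  have hpath : ∀ (γ : ℝ → ℂ) (a b : ℝ), Continuous γ → (∀ u, R < ‖γ u‖) →
      (∀ u ∈ uIcc a b, ‖γ u‖ < R₂) → ∫ u in a..b, f (γ u) = (∫ u in a..b, f₁ (γ u)) +
        (2 * Real.pi * I : ℂ)⁻¹ * ∮ z in C(0, R), (∫ u in a..b, (γ u - z)⁻¹) * f z := by
    intro γ a b hγ hγR hγ2
    have i1 : IntervalIntegrable (fun u => f₁ (γ u)) volume a b :=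
      (hf₁d.continuousOn.comp hγ.continuousOn
        fun u hu => by simpa using hγ2 u hu).intervalIntegrable
    have i2 : IntervalIntegrable (fun u => f (γ u)) volume a b :=
      (continuous_iff_continuousAt.2 fun u => ContinuousAt.comp (g := f) (f := γ)
        (hf _ (hγR u).le).continuousAt hγ.continuousAt).intervalIntegrable _ _
    rw [← integral_circleIntegral_swap hR.le hfR hγ hγR, ← sub_eq_iff_eq_add',
      ← intervalIntegral.integral_const_mul, ← intervalIntegral.integral_sub i2 i1]
    refine intervalIntegral.integral_congr fun u hu => ?_
    rw [hdec _ (hγR u) (hγ2 u hu)]; ring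
  have hint : ∀ (γ : ℝ → ℂ) (a b : ℝ), Continuous γ → (∀ u, R < ‖γ u‖) →
      CircleIntegrable (fun z => (∫ u in a..b, (γ u - z)⁻¹) * f z) 0 R := fun γ a b hγ hγR =>
    circleIntegrable_integral_inv_mul hR.le hfR hγ hγR
  have hzero : rectIntegral f₁ x₁ x₂ T = 0 := by
    refine rectIntegral_eq_zero (hf₁d.mono fun s hs => ?_)
    rw [mem_reProdIm] at hs
    simpa using hbd s.re s.im (habs _ hs.1) (habsT _ hs.2)
  have hTT : |(-T)| = T := by rw [abs_neg, abs_of_pos hT0]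
  have c1 : Continuous fun x : ℝ => (x + (-T : ℝ) * I : ℂ) := by fun_prop
  have c2 : Continuous fun x : ℝ => (x + T * I : ℂ) := by fun_prop
  have c3 : Continuous fun y : ℝ => (x₂ + y * I : ℂ) := by fun_prop
  have c4 : Continuous fun y : ℝ => (x₁ + y * I : ℂ) := by fun_prop
  have i1 := hint _ x₁ x₂ c1 (hhor _ hTT)
  have i2 := hint _ x₁ x₂ c2 (hhor _ (abs_of_pos hT0))
  have i3 := hint _ (-T) T c3 (hver _ hx2)
  have i4 := hint _ (-T) T c4 (hver _ hx1)
  have hx₁' : |x₁| ≤ |x₁| + |x₂| := by linarith [abs_nonneg x₂]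
  have hx₂' : |x₂| ≤ |x₁| + |x₂| := by linarith [abs_nonneg x₁]
  rw [rectIntegral] at hzero ⊢
  rw [hpath _ x₁ x₂ c1 (hhor _ hTT) fun u hu => hbd _ _ (habs u hu) hTT.le,
    hpath _ x₁ x₂ c2 (hhor _ (abs_of_pos hT0)) fun u hu => hbd _ _ (habs u hu) (abs_of_pos hT0).le,
    hpath _ (-T) T c3 (hver _ hx2) fun u hu => hbd _ _ hx₂' (habsT u hu),
    hpath _ (-T) T c4 (hver _ hx1) fun u hu => hbd _ _ hx₁' (habsT u hu)]
  have i3' : CircleIntegrable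
      (fun z => I * ((∫ u in (-T)..T, ((x₂ : ℂ) + u * I - z)⁻¹) * f z)) 0 R := i3.const_mul I
  have i4' : CircleIntegrable
      (fun z => I * ((∫ u in (-T)..T, ((x₁ : ℂ) + u * I - z)⁻¹) * f z)) 0 R := i4.const_mul I
  have i12 : CircleIntegrable (fun z => (∫ u in x₁..x₂, ((u : ℂ) + (-T : ℝ) * I - z)⁻¹) * f z -
      (∫ u in x₁..x₂, ((u : ℂ) + T * I - z)⁻¹) * f z) 0 R := i1.sub i2
  have i34 : CircleIntegrable
      (fun z => I * ((∫ u in (-T)..T, ((x₂ : ℂ) + u * I - z)⁻¹) * f z) -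
        I * ((∫ u in (-T)..T, ((x₁ : ℂ) + u * I - z)⁻¹) * f z)) 0 R := i3'.sub i4'
  have hsum : (∮ z in C(0, R), (∫ u in x₁..x₂, ((u : ℂ) + (-T : ℝ) * I - z)⁻¹) * f z) -
      (∮ z in C(0, R), (∫ u in x₁..x₂, ((u : ℂ) + T * I - z)⁻¹) * f z) +
      (I * (∮ z in C(0, R), (∫ u in (-T)..T, ((x₂ : ℂ) + u * I - z)⁻¹) * f z) -
      I * (∮ z in C(0, R), (∫ u in (-T)..T, ((x₁ : ℂ) + u * I - z)⁻¹) * f z)) =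
      (2 * Real.pi * I) * ∮ z in C(0, R), f z := by
    rw [← circleIntegral.integral_const_mul, ← circleIntegral.integral_const_mul,
      ← circleIntegral.integral_const_mul, ← circleIntegral.integral_sub i1 i2,
      ← circleIntegral.integral_sub i3' i4',
      ← circleIntegral.integral_add i12 i34]
    refine circleIntegral.integral_congr hR.le fun z hz => ?_
    have hzR : ‖z‖ = R := by simpa using hz
    have hre := abs_le.1 (hzR ▸ abs_re_le_norm z)
    have := rectIntegral_sub_inv (x₁ := x₁) (x₂ := x₂) (T := T) (z := z) (by linarith)
      (by linarith) ((hzR ▸ abs_im_le_norm z).trans_lt h3)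
    rw [rectIntegral] at this
    rw [← this]; ring
  linear_combination hzero + (2 * Real.pi * I : ℂ)⁻¹ * hsum +
    (∮ z in C(0, R), f z) * inv_mul_cancel₀ hpi

/-- Moving a line of integration across a disc that contains all singularities. -/
theorem integral_vertical_sub_eq_circleIntegral {R x₁ x₂ : ℝ} (hR : 0 < R) (h1 : x₁ < -R) (h2 : R < x₂)
    {F : ℂ → ℂ} (hF : ∀ s, R ≤ ‖s‖ → DifferentiableAt ℂ F s)
    (i₁ : Integrable fun t : ℝ => F (x₁ + t * I)) (i₂ : Integrable fun t : ℝ => F (x₂ + t * I))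
    (hdec : ∀ ε : ℝ, 0 < ε → ∃ T₀ : ℝ, ∀ s : ℂ, x₁ ≤ s.re → s.re ≤ x₂ → T₀ ≤ |s.im| → ‖F s‖ ≤ ε) :
    I * (∫ t : ℝ, F (x₂ + t * I)) - I * (∫ t : ℝ, F (x₁ + t * I)) = ∮ z in C(0, R), F z := by
  have hv : ∀ x : ℝ, Integrable (fun t : ℝ => F (x + t * I)) →
      Tendsto (fun T : ℝ => I * ∫ y in (-T)..T, F (x + y * I)) atTop
        (𝓝 (I * ∫ t : ℝ, F (x + t * I))) := fun x hx =>
    (intervalIntegral_tendsto_integral hx tendsto_neg_atTop_atBot tendsto_id).const_mul I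
  have hh : ∀ σ : ℝ → ℝ, (∀ T, 0 ≤ T → |σ T| = T) →
      Tendsto (fun T : ℝ => ∫ x : ℝ in x₁..x₂, F (x + σ T * I)) atTop (𝓝 0) := by
    intro σ hσ
    rw [Metric.tendsto_atTop]
    intro ε hε
    have hx : 0 < x₂ - x₁ := by linarith
    obtain ⟨T₀, hT₀⟩ := hdec (ε / (2 * (x₂ - x₁))) (by positivity)
    refine ⟨max T₀ 0, fun T hT => ?_⟩
    have hT1 : T₀ ≤ T := (le_max_left _ _).trans hT
    have hT2 : 0 ≤ T := (le_max_right _ _).trans hT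
    rw [dist_zero_right]
    refine (intervalIntegral.norm_integral_le_of_norm_le_const
      (C := ε / (2 * (x₂ - x₁))) fun x hx' => ?_).trans_lt ?_
    · rw [uIoc_of_le (by linarith)] at hx'
      refine hT₀ _ ?_ ?_ ?_
      · simpa using hx'.1.le
      · simpa using hx'.2
      · simpa [hσ T hT2] using hT1
    · rw [abs_of_pos hx]; field_simp; linarith
  have hlim := (((hh (fun T => -T) fun T hT => by rw [abs_neg, abs_of_nonneg hT]).sub
    (hh (fun T => T) fun T hT => abs_of_nonneg hT)).add (hv x₂ i₂)).sub (hv x₁ i₁)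
  rw [sub_zero, zero_add] at hlim
  refine tendsto_nhds_unique hlim (tendsto_const_nhds.congr' ?_)
  filter_upwards [eventually_gt_atTop R] with T hT
  rw [← rectIntegral_eq_circleIntegral hR h1 h2 hT hF]; rfl

/-- Moving a line of integration for a function whose growth in the strip is only known to be
slower than any Gaussian. The factor `exp (η s²)` makes the shift legitimate, and it is removed
by letting `η → 0` on the two lines, where the function is integrable; no convexity bound inside
the strip is needed. -/
theorem integral_vertical_sub_eq_circleIntegral_of_gaussian {R x₁ x₂ : ℝ} (hR : 0 < R) (h1 : x₁ < -R)
    (h2 : R < x₂) {Φ g : ℂ → ℂ} (hΦ : ∀ s, R ≤ ‖s‖ → DifferentiableAt ℂ Φ s)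
    (hg : Differentiable ℂ g) {K : ℝ} (hgK : ∀ s : ℂ, x₁ ≤ s.re → s.re ≤ x₂ → ‖g s‖ ≤ K)
    (hgrow : ∀ η : ℝ, 0 < η → ∃ C T₀ : ℝ, ∀ s : ℂ, x₁ ≤ s.re → s.re ≤ x₂ → T₀ ≤ |s.im| →
      ‖Φ s‖ ≤ C * Real.exp (η * s.im ^ 2))
    (i₁ : Integrable fun t : ℝ => Φ (x₁ + t * I) * g (x₁ + t * I))
    (i₂ : Integrable fun t : ℝ => Φ (x₂ + t * I) * g (x₂ + t * I)) :
    I * (∫ t : ℝ, Φ (x₂ + t * I) * g (x₂ + t * I)) - I * (∫ t : ℝ, Φ (x₁ + t * I) * g (x₁ + t * I)) =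
      ∮ z in C(0, R), Φ z * g z := by
  have hre : ∀ (η : ℝ) (s : ℂ), ‖exp (η * s ^ 2)‖ = Real.exp (η * (s.re ^ 2 - s.im ^ 2)) := by
    intro η s
    rw [norm_exp, re_ofReal_mul, sq s, mul_re]; ring_nf
  have hbound : ∀ (η x : ℝ), 0 < η → η < 1 → ∀ t : ℝ,
      ‖exp (η * (x + t * I : ℂ) ^ 2)‖ ≤ Real.exp (x ^ 2) := fun η x h0 h1 t => by
    rw [hre]
    refine Real.exp_le_exp.2 ?_
    simp only [add_re, ofReal_re, mul_re, I_re, mul_zero, ofReal_im, I_im, mul_one, sub_self, add_zero]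
    have : 0 ≤ (x + t * I : ℂ).im ^ 2 := sq_nonneg _
    nlinarith [sq_nonneg x]
  have hmeas : ∀ (η x : ℝ), Continuous fun t : ℝ => exp (η * (x + t * I : ℂ) ^ 2) := fun η x => by
    fun_prop
  have hnear : ∀ᶠ η : ℝ in 𝓝[>] 0, η ∈ Ioo (0 : ℝ) 1 := Ioo_mem_nhdsGT zero_lt_one
  have hline : ∀ x : ℝ, Integrable (fun t : ℝ => Φ (x + t * I) * g (x + t * I)) →
      Tendsto (fun η : ℝ => ∫ t : ℝ, Φ (x + t * I) * g (x + t * I) * exp (η * (x + t * I : ℂ) ^ 2))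
        (𝓝[>] 0) (𝓝 (∫ t : ℝ, Φ (x + t * I) * g (x + t * I))) := fun x hx => by
    refine tendsto_integral_filter_of_dominated_convergence
      (fun t => ‖Φ (x + t * I) * g (x + t * I)‖ * Real.exp (x ^ 2)) ?_ ?_ (hx.norm.mul_const _) ?_
    · exact Eventually.of_forall fun η => hx.aestronglyMeasurable.mul (hmeas η x).aestronglyMeasurable
    · filter_upwards [hnear] with η hη
      refine Eventually.of_forall fun t => ?_
      rw [norm_mul]
      gcongr
      exact hbound η x hη.1 hη.2 t
    · refine Eventually.of_forall fun t => ?_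
      have hc : Continuous fun η : ℝ => Φ (x + t * I) * g (x + t * I) * exp (η * (x + t * I : ℂ) ^ 2) := by
        fun_prop
      have := (hc.tendsto 0).mono_left (nhdsWithin_le_nhds (s := Ioi (0 : ℝ)))
      simpa using this
  have hcirc : Tendsto (fun η : ℝ => ∮ z in C(0, R), Φ z * g z * exp (η * z ^ 2)) (𝓝[>] 0)
      (𝓝 (∮ z in C(0, R), Φ z * g z)) := by
    have hΦc : Continuous fun θ : ℝ => Φ (circleMap 0 R θ) :=
      continuous_iff_continuousAt.2 fun θ => ContinuousAt.comp (g := Φ) (f := circleMap 0 R)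
        (hΦ _ (by simp [abs_of_pos hR])).continuousAt (continuous_circleMap 0 R).continuousAt
    have hcc := continuous_circleMap 0 R
    have hgc := hg.continuous.comp hcc
    have hc : Continuous fun η : ℝ => ∮ z in C(0, R), Φ z * g z * exp (η * z ^ 2) := by
      unfold circleIntegral
      refine intervalIntegral.continuous_parametric_intervalIntegral_of_continuous'
        (f := fun (η θ : ℝ) => deriv (circleMap 0 R) θ • (Φ (circleMap 0 R θ) * g (circleMap 0 R θ) *
          exp (η * (circleMap 0 R θ) ^ 2))) ?_ _ _
      unfold Function.uncurry
      simp only [deriv_circleMap, smul_eq_mul]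
      have a1 := hΦc.comp (continuous_snd (X := ℝ) (Y := ℝ))
      have a2 := hgc.comp (continuous_snd (X := ℝ) (Y := ℝ))
      have a3 := hcc.comp (continuous_snd (X := ℝ) (Y := ℝ))
      simp only [Function.comp_def] at a1 a2 a3
      exact (a3.mul continuous_const).mul ((a1.mul a2).mul
        (Continuous.cexp ((continuous_ofReal.comp continuous_fst).mul (a3.pow 2))))
    have := (hc.tendsto 0).mono_left (nhdsWithin_le_nhds (s := Ioi (0 : ℝ)))
    simpa using this
  refine tendsto_nhds_unique (((hline x₂ i₂).const_mul I).sub ((hline x₁ i₁).const_mul I))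
    (hcirc.congr' ?_)
  filter_upwards [hnear] with η hη
  have hint : ∀ x : ℝ, Integrable (fun t : ℝ => Φ (x + t * I) * g (x + t * I)) →
      Integrable (fun t : ℝ => Φ (x + t * I) * g (x + t * I) * exp (η * (x + t * I : ℂ) ^ 2)) :=
    fun x hx => hx.mul_bdd (c := Real.exp (x ^ 2)) (hmeas η x).aestronglyMeasurable
      (Eventually.of_forall (hbound η x hη.1 hη.2))
  symm
  refine integral_vertical_sub_eq_circleIntegral hR h1 h2
    (F := fun s => Φ s * g s * exp (η * s ^ 2)) (fun s hs => ?_) (hint _ i₁) (hint _ i₂) ?_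
  · exact ((hΦ s hs).mul (hg s)).mul (by fun_prop)
  · intro ε hε
    obtain ⟨C, T₀, hC⟩ := hgrow (η / 2) (half_pos hη.1)
    set M := |x₁| + |x₂| with hM
    set D := |C| * |K| * Real.exp (η * M ^ 2) with hD
    have hlim : Tendsto (fun T : ℝ => D * Real.exp (-(η / 2 * T ^ 2))) atTop (𝓝 0) := by
      rw [← mul_zero D]
      refine Tendsto.const_mul D (Real.tendsto_exp_neg_atTop_nhds_zero.comp ?_)
      exact (tendsto_pow_atTop two_ne_zero).const_mul_atTop (half_pos hη.1)
    obtain ⟨T₁, hT₁⟩ := eventually_atTop.1 (hlim.eventually_lt_const hε)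
    refine ⟨max T₀ T₁, fun s hs1 hs2 hs3 => ?_⟩
    have b1 := hC s hs1 hs2 ((le_max_left _ _).trans hs3)
    have b2 := hgK s hs1 hs2
    have b3 := hT₁ |s.im| ((le_max_right _ _).trans hs3)
    rw [sq_abs] at b3
    refine le_trans ?_ b3.le
    rw [norm_mul, norm_mul, hre]
    have b4 : s.re ^ 2 ≤ M ^ 2 := by
      rw [sq_le_sq, abs_of_nonneg (by positivity : 0 ≤ M), abs_le]
      constructor
      · linarith [neg_abs_le x₁, abs_nonneg x₂]
      · linarith [le_abs_self x₂, abs_nonneg x₁]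
    calc _ ≤ (|C| * Real.exp (η / 2 * s.im ^ 2)) * |K| * Real.exp (η * (M ^ 2 - s.im ^ 2)) := by
          have := hη.1
          gcongr
          · exact b1.trans (by gcongr; exact le_abs_self C)
          · exact b2.trans (le_abs_self K)
      _ = |C| * |K| * (Real.exp (η / 2 * s.im ^ 2) * Real.exp (η * (M ^ 2 - s.im ^ 2))) := by ring
      _ = _ := by rw [hD, mul_assoc _ (Real.exp _), ← Real.exp_add, ← Real.exp_add]; ring_nf

end LocalMean

open Complex Filter Topology MeasureTheory Set
open scoped ContDiff Real

namespace LocalMean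

/-! ### Averages of a series of cosine integrals -/

/-- Probability densities on `[-V, V]`, dilated from one smooth bump, whose Fourier transforms are
`O((V|l|)^{-N})` with a constant that does not depend on `V`. -/
theorem exists_oscillation_kernel (N : ℕ) : ∃ C : ℝ, 0 ≤ C ∧ ∀ V : ℝ, 0 < V → ∃ K : ℝ → ℝ,
    Continuous K ∧ (∀ v, 0 ≤ K v) ∧ (∀ v, v ∉ Icc (-V) V → K v = 0) ∧ ∫ v, K v = 1 ∧
    ∀ l : ℝ, (V * |l|) ^ N * ‖∫ v, (K v : ℂ) * exp (l * v * I)‖ ≤ C := by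
  let bump : ContDiffBump (0 : ℝ) := ⟨1 / 2, 1, by norm_num, by norm_num⟩
  set k : ℝ → ℝ := bump.normed volume with hk
  have hkc : Continuous k := bump.continuous_normed
  have hk0 : ∀ v, v ∉ Icc (-1 : ℝ) 1 → k v = 0 := by
    intro v hv
    by_contra h
    have : v ∈ Function.support k := h
    rw [hk, bump.support_normed_eq] at this
    simp only [Metric.mem_ball, dist_zero_right, Real.norm_eq_abs] at this
    exact hv (abs_le.1 (le_of_lt this))
  have hsupp : HasCompactSupport (fun v => (k v : ℂ)) :=
    (bump.hasCompactSupport_normed (μ := volume)).comp_left (g := fun x : ℝ => (x : ℂ)) ofReal_zero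
  have hsm : ContDiff ℝ ∞ (fun v => (k v : ℂ)) :=
    ofRealCLM.contDiff.comp (bump.contDiff_normed (n := ⊤))
  obtain ⟨C, hC⟩ := (SchwartzMap.fourierTransformCLM ℂ (hsupp.toSchwartzMap hsm)).decay N 0
  have hC' : ∀ w : ℝ, |w| ^ N * ‖∫ v, (k v : ℂ) * exp ((-2 * π * v * w : ℝ) * I)‖ ≤ C := by
    intro w
    have := hC.2 w
    rw [norm_iteratedFDeriv_zero, SchwartzMap.fourierTransformCLM_apply, SchwartzMap.fourier_coe,
      Real.fourier_real_eq_integral_exp_smul] at this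
    simpa [mul_comm] using this
  refine ⟨C * (2 * π) ^ N, by have := hC.1; positivity, fun V hV =>
    ⟨fun v => V⁻¹ * k (v / V), by fun_prop,
      fun v => mul_nonneg (inv_nonneg.2 hV.le) (bump.nonneg_normed _), fun v hv => ?_, ?_,
      fun l => ?_⟩⟩
  · have : v / V ∉ Icc (-1 : ℝ) 1 := by
      rw [mem_Icc, le_div_iff₀ hV, div_le_iff₀ hV]
      simpa using hv
    simp only [hk0 _ this, mul_zero]
  · rw [integral_const_mul, Measure.integral_comp_div, abs_of_pos hV, hk, bump.integral_normed]
    simp [hV.ne']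
  · have hscale : ∫ v, ((V⁻¹ * k (v / V) : ℝ) : ℂ) * exp (l * v * I) =
        ∫ v, (k v : ℂ) * exp ((-2 * π * v * (-(l * V) / (2 * π)) : ℝ) * I) := by
      have h1 := Measure.integral_comp_div
        (fun v => (V : ℂ)⁻¹ * ((k v : ℂ) * exp (l * V * v * I))) V
      rw [abs_of_pos hV, integral_const_mul, integral_const_mul, real_smul, ← mul_assoc,
        mul_inv_cancel₀ (by exact_mod_cast hV.ne'), one_mul] at h1
      refine Eq.trans ?_ (h1.trans ?_)
      · rw [← integral_const_mul]
        congr 1 with v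
        have : (V : ℂ) ≠ 0 := by exact_mod_cast hV.ne'
        rw [show (l : ℂ) * V * ((v / V : ℝ) : ℂ) = l * v by push_cast; field_simp]
        push_cast
        ring
      · congr 1 with v
        congr 3
        have : (π : ℂ) ≠ 0 := by exact_mod_cast Real.pi_ne_zero
        push_cast
        field_simp
    rw [hscale]
    have h2 := hC' (-(l * V) / (2 * π))
    have h3 : V * |l| = |-(l * V) / (2 * π)| * (2 * π) := by
      rw [abs_div, abs_neg, abs_mul, abs_of_pos hV, abs_of_pos Real.two_pi_pos]
      have := Real.pi_ne_zero
      field_simp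
    rw [h3, mul_pow, mul_right_comm]
    gcongr

/-- Averaging against such a kernel suppresses a cosine of frequency at least `m`. The phase `z`
may be complex. -/
theorem norm_integral_mul_cos_le {K : ℝ → ℝ} {N : ℕ} {C V : ℝ} (hV : 0 < V)
    (hKc : Continuous K) (hK0 : ∀ v, v ∉ Icc (-V) V → K v = 0)
    (hK : ∀ l : ℝ, (V * |l|) ^ N * ‖∫ v, (K v : ℂ) * exp (l * v * I)‖ ≤ C)
    {l m : ℝ} (hm : 0 < m) (hl : m ≤ |l|) (z : ℂ) :
    ‖∫ v, (K v : ℂ) * cos (l * v + z)‖ ≤ C * Real.exp |z.im| / (V * m) ^ N := by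
  have hsupp : HasCompactSupport K := HasCompactSupport.intro isCompact_Icc hK0
  have hi : ∀ e : ℝ, Integrable (fun v : ℝ => (K v : ℂ) * exp (e * v * I)) := fun e =>
    Continuous.integrable_of_hasCompactSupport (by fun_prop)
      ((hsupp.comp_left (g := fun x : ℝ => (x : ℂ)) ofReal_zero).mul_right)
  have hb : ∀ e : ℝ, m ≤ |e| → ‖∫ v, (K v : ℂ) * exp (e * v * I)‖ ≤ C / (V * m) ^ N := by
    intro e he
    rw [le_div_iff₀ (by positivity)]
    refine le_trans ?_ (hK e)
    rw [mul_comm]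
    gcongr
  have heq : ∫ v, (K v : ℂ) * cos (l * v + z) =
      exp (z * I) / 2 * (∫ v, (K v : ℂ) * exp (l * v * I)) +
        exp (-z * I) / 2 * ∫ v, (K v : ℂ) * exp ((-l : ℝ) * v * I) := by
    rw [← integral_const_mul, ← integral_const_mul, ← integral_add ((hi _).const_mul _)
      ((hi _).const_mul _)]
    congr 1 with v
    rw [Complex.cos, show (l * v + z) * I = z * I + l * v * I by ring,
      show -(l * v + z) * I = -z * I + ((-l : ℝ) : ℂ) * v * I by push_cast; ring, exp_add, exp_add]
    ring
  rw [heq]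
  have e1 : ‖exp (z * I) / 2‖ ≤ Real.exp |z.im| / 2 := by
    rw [norm_div, norm_exp]
    simp only [mul_re, I_re, I_im, mul_zero, mul_one, zero_sub, Complex.norm_ofNat]
    gcongr
    exact neg_le_abs _
  have e2 : ‖exp (-z * I) / 2‖ ≤ Real.exp |z.im| / 2 := by
    rw [norm_div, norm_exp]
    simp only [mul_re, I_re, I_im, mul_zero, mul_one, zero_sub, Complex.norm_ofNat, neg_im, neg_neg]
    gcongr
    exact le_abs_self _
  calc _ ≤ Real.exp |z.im| / 2 * (C / (V * m) ^ N) + Real.exp |z.im| / 2 * (C / (V * m) ^ N) := by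
        refine (norm_add_le _ _).trans ?_
        rw [norm_mul, norm_mul]
        gcongr
        · exact hb _ hl
        · exact hb _ (by rwa [abs_neg])
    _ = _ := by ring

/-- Multiplying the kernel by `1 + s cos(l₀v + z₀)` produces the frequencies `l` and `l ± l₀`; the
difference frequency `l - l₀` is small exactly when `l` is close to `l₀`. -/
theorem integral_mul_one_add_cos_mul_cos {K : ℝ → ℝ} (hKc : Continuous K)
    (hsupp : HasCompactSupport K) (s l₀ l : ℝ) (z₀ z : ℂ) :
    ∫ v, (K v : ℂ) * (1 + s * cos (l₀ * v + z₀)) * (2 * cos (l * v + z)) =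
      2 * (∫ v, (K v : ℂ) * cos (l * v + z)) +
        s * (∫ v, (K v : ℂ) * cos ((l + l₀ : ℝ) * v + (z + z₀))) +
        s * ∫ v, (K v : ℂ) * cos ((l - l₀ : ℝ) * v + (z - z₀)) := by
  have hi : ∀ (e : ℝ) (z : ℂ), Integrable (fun v : ℝ => (K v : ℂ) * cos (e * v + z)) := fun e z =>
    Continuous.integrable_of_hasCompactSupport (by fun_prop)
      ((hsupp.comp_left (g := fun x : ℝ => (x : ℂ)) ofReal_zero).mul_right)
  have hadd := integral_add
    (((hi l z).const_mul 2).add ((hi (l + l₀) (z + z₀)).const_mul s))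
    ((hi (l - l₀) (z - z₀)).const_mul s)
  rw [← integral_const_mul, ← integral_const_mul, ← integral_const_mul,
    ← integral_add ((hi _ _).const_mul _) ((hi _ _).const_mul _)]
  refine Eq.trans ?_ hadd
  congr 1 with v
  simp only [Pi.add_apply]
  have e1 : ((l + l₀ : ℝ) : ℂ) * v + (z + z₀) = (l * v + z) + (l₀ * v + z₀) := by push_cast; ring
  have e2 : ((l - l₀ : ℝ) : ℂ) * v + (z - z₀) = (l * v + z) - (l₀ * v + z₀) := by push_cast; ring
  rw [e1, e2, cos_add (l * v + z), cos_sub (l * v + z)]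
  ring

/-- If `q` is close to `w ≥ 0` and `re z` is small, then `re (q cos z)` is at least `w / 2`,
whatever `im z`: both the main term and the error scale with `cosh (im z)`. -/
theorem half_mul_le_re_mul_cos {w x : ℝ} {q z : ℂ} (hq : ‖q - w‖ ≤ w / 4) (hx : |x| ≤ 1 / 2)
    (hz : z.re = x) : w / 2 ≤ (q * cos z).re := by
  have hw : 0 ≤ w := by linarith [norm_nonneg (q - w)]
  have hcos : 7 / 8 ≤ Real.cos x := by
    have := Real.one_sub_sq_div_two_le_cos (x := x)
    have h2 := sq_le_sq' (abs_le.1 hx).1 (abs_le.1 hx).2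
    linarith
  have hcosh := Real.one_le_cosh z.im
  have hre : (cos z).re = Real.cos x * Real.cosh z.im := by
    rw [← hz, Complex.cos_eq z]
    simp [← ofReal_cos, ← ofReal_cosh, ← ofReal_sin, ← ofReal_sinh]
  have hn : ‖cos z‖ ≤ Real.cosh z.im := by
    rw [Complex.cos, Real.cosh_eq, norm_div, Complex.norm_ofNat]
    gcongr
    refine (norm_add_le _ _).trans (le_of_eq ?_)
    rw [norm_exp, norm_exp]
    simp [add_comm]
  have h1 : -(w / 4 * Real.cosh z.im) ≤ ((q - w) * cos z).re := by
    have h2 := (abs_le.1 (abs_re_le_norm ((q - w) * cos z))).1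
    rw [norm_mul] at h2
    have : ‖q - w‖ * ‖cos z‖ ≤ w / 4 * Real.cosh z.im := by gcongr
    linarith
  have h2 : (q * cos z).re = w * (Real.cos x * Real.cosh z.im) + ((q - w) * cos z).re := by
    rw [← hre, ← re_ofReal_mul, ← add_re]
    congr 1
    ring
  rw [h2]
  nlinarith [mul_nonneg hw (sub_nonneg.2 hcosh), mul_nonneg (mul_nonneg hw (sub_nonneg.2 hcos))
    (zero_le_one.trans hcosh)]

/-- The first frequency prevails on average. A series of cosine integrals with frequencies `ρ n * Y`
and a weight `w` concentrated near `1` takes values of either sign `s`, of size at least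
`c₀ ∫ w / 16`, in every window `[X - V, X + V]` of a fixed length, far out. The
function `q` stands for `w` times a factor close to `1`. The series is averaged against the kernel
`K(v)(1 + s cos(ρ₀(X + v) + re θ))`, for which only the first term has a resonant part. -/
theorem exists_abs_le_mul_re_tsum {ρ : ℕ → ℝ} (hρ : StrictMono ρ) (hρ0 : 0 < ρ 0) {c : ℕ → ℂ}
    {c₀ : ℝ} (hc₀ : 0 < c₀) (hc : c 0 = c₀) {N : ℕ} (hN : N ≠ 0)
    (hsum : Summable fun n => ‖c n‖ / ρ n ^ N) (θ : ℂ) :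
    ∃ V : ℝ, 0 < V ∧ ∃ η : ℝ, 0 < η ∧ ∃ X₁ : ℝ, ∀ X : ℝ, X₁ ≤ X → ∀ (w : ℝ → ℝ) (q : ℝ → ℂ),
      Continuous w → Continuous q → (∀ r, η / X < |r - 1| → w r = 0) → 0 < ∫ r, w r →
      (∀ r, ‖q r - w r‖ ≤ w r / 4) → ∀ u : ℕ → ℝ, Summable u →
      (∀ Y ∈ Icc (X - V) (X + V), ∀ n,
        ‖c n * ∫ r, q r * (2 * cos (ρ n * Y * r + θ))‖ ≤ u n) →
      ∀ s : ℝ, |s| = 1 → ∃ Y ∈ Icc (X - V) (X + V), c₀ / 16 * ∫ r, w r ≤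
        s * (∑' n, c n * ∫ r, q r * (2 * cos (ρ n * Y * r + θ))).re := by
  obtain ⟨C, hC0, hC⟩ := exists_oscillation_kernel N
  have hρpos : ∀ n, 0 < ρ n := fun n => hρ0.trans_le (hρ.monotone (Nat.zero_le n))
  -- the relative gap between the first two frequencies: all combined frequencies other than
  -- `ρ 0 * r - ρ 0` are at least `g * ρ n`
  set g : ℝ := (1 - ρ 0 / ρ 1) / 2 with hg
  have hq01 : ρ 0 / ρ 1 < 1 := (div_lt_one (hρpos 1)).2 (hρ Nat.zero_lt_one)
  have hq0 : 0 < ρ 0 / ρ 1 := div_pos hρ0 (hρpos 1)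
  have hg0 : 0 < g := by rw [hg]; linarith
  have hg1 : g < 1 / 2 := by rw [hg]; linarith
  set E : ℝ := C * Real.exp |θ.im| with hE
  have hE0 : 0 ≤ E := by positivity
  set D : ℝ := 5 * E * (∑' n, ‖c n‖ / ρ n ^ N) / g ^ N with hD
  -- so long a window that the nonresonant parts together are at most `c₀ / 4`
  set V : ℝ := max 1 (4 * D / c₀) with hV
  have hV1 : 1 ≤ V := le_max_left _ _
  have hV0 : 0 < V := by linarith
  have hDV : D / V ^ N ≤ c₀ / 4 := by
    have h1 : 4 * D / c₀ ≤ V ^ N := (le_max_right _ _).trans (le_self_pow₀ hV1 hN)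
    rw [div_le_iff₀ hc₀] at h1
    rw [div_le_iff₀ (by positivity)]
    linarith
  obtain ⟨K, hKc, hKnn, hK0, hK1, hK⟩ := hC V hV0
  have hKsupp : HasCompactSupport K := HasCompactSupport.intro isCompact_Icc hK0
  -- so narrow a weight that the resonant phase `ρ 0 * (X + v) * (r - 1)` is at most `1/2`
  set η : ℝ := 1 / (4 * ρ 0) with hη
  have hη0 : 0 < η := by positivity
  refine ⟨V, hV0, η, hη0, max V (η / g), fun X hX w q hwc hqc hw0 hW hqw u hu hcu s hs => ?_⟩
  have hXV : V ≤ X := (le_max_left _ _).trans hX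
  have hX0 : 0 < X := hV0.trans_le hXV
  have hηX : η / X ≤ g := by
    rw [div_le_iff₀ hX0, mul_comm, ← div_le_iff₀ hg0]
    exact (le_max_right _ _).trans hX
  have hwnn : ∀ r, 0 ≤ w r := fun r => by linarith [hqw r, norm_nonneg (q r - w r)]
  have hq5 : ∀ r, ‖q r‖ ≤ 5 / 4 * w r := fun r => by
    have := norm_add_le (q r - w r) (w r)
    rw [sub_add_cancel, norm_real, Real.norm_of_nonneg (hwnn r)] at this
    linarith [hqw r]
  have hwsupp : HasCompactSupport w := by
    refine HasCompactSupport.intro (isCompact_Icc (a := 1 - g) (b := 1 + g)) fun r hr => ?_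
    refine hw0 r (hηX.trans_lt ?_)
    by_contra! h
    rw [abs_le] at h
    exact hr ⟨by linarith, by linarith⟩
  have hqsupp : HasCompactSupport q := by
    refine hwsupp.mono fun r hr => ?_
    intro h
    have := hq5 r
    simp [h] at this
    exact hr this
  set W := ∫ r, w r with hWdef
  have hwi : Integrable w := hwc.integrable_of_hasCompactSupport hwsupp
  -- the kernel with the oscillating factor in resonance with the first frequency
  set κ : ℝ → ℝ := fun v => K v * (1 + s * Real.cos (ρ 0 * v + (ρ 0 * X + θ.re))) with hκ
  have hκc : Continuous κ := by fun_prop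
  have hκsupp : HasCompactSupport κ := hKsupp.mul_right
  have hscos : ∀ x, |s * Real.cos x| ≤ 1 := fun x => by
    rw [abs_mul, hs, one_mul]; exact Real.abs_cos_le_one x
  have hκnn : ∀ v, 0 ≤ κ v := fun v =>
    mul_nonneg (hKnn v) (by linarith [(abs_le.1 (hscos (ρ 0 * v + (ρ 0 * X + θ.re)))).1])
  have hκle : ∀ v, κ v ≤ 2 * K v := fun v => by
    rw [mul_comm 2]
    exact mul_le_mul_of_nonneg_left
      (by linarith [(abs_le.1 (hscos (ρ 0 * v + (ρ 0 * X + θ.re)))).2]) (hKnn v)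
  have hκi : Integrable κ := hκc.integrable_of_hasCompactSupport hκsupp
  have hKi : Integrable K := hKc.integrable_of_hasCompactSupport hKsupp
  have hκint : ∫ v, κ v ≤ 2 := by
    have := integral_mono hκi (hKi.const_mul 2) hκle
    rwa [integral_const_mul, hK1, mul_one] at this
  have hκzero : ∀ v, v ∉ Icc (-V) V → κ v = 0 := fun v hv => by simp [hκ, hK0 v hv]
  set J : ℕ → ℝ → ℂ := fun n Y => ∫ r, q r * (2 * cos (ρ n * Y * r + θ)) with hJ
  have hJc : ∀ n, Continuous (J n) := by
    intro n
    have := continuous_parametric_integral_of_continuous (μ := volume)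
      (f := fun (Y r : ℝ) => q r * (2 * cos (ρ n * Y * r + θ)))
      (by unfold Function.uncurry; fun_prop) hqsupp.isCompact
    refine this.congr fun Y => setIntegral_eq_integral_of_forall_compl_eq_zero fun r hr => ?_
    rw [image_eq_zero_of_notMem_tsupport hr, zero_mul]
  set F : ℕ → ℝ → ℂ := fun n v => (κ v : ℂ) * (c n * J n (X + v)) with hF
  have hκsuppC : HasCompactSupport fun v => (κ v : ℂ) :=
    hκsupp.comp_left (g := fun x : ℝ => (x : ℂ)) ofReal_zero
  have hFc : ∀ n, Continuous (F n) := fun n =>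
    (continuous_ofReal.comp hκc).mul
      (continuous_const.mul ((hJc n).comp (continuous_const.add continuous_id)))
  have hFi : ∀ n, Integrable (F n) := fun n =>
    (hFc n).integrable_of_hasCompactSupport hκsuppC.mul_right
  have hFle : ∀ n v, ‖F n v‖ ≤ κ v * u n := by
    intro n v
    by_cases hv : v ∈ Icc (-V) V
    · rw [norm_mul, norm_real, Real.norm_of_nonneg (hκnn v)]
      exact mul_le_mul_of_nonneg_left
        (hcu (X + v) ⟨by linarith [hv.1], by linarith [hv.2]⟩ n) (hκnn v)
    · simp [hF, hκzero v hv]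
  have hFsum : Summable fun n => ∫ v, ‖F n v‖ := by
    refine Summable.of_nonneg_of_le (fun n => integral_nonneg fun v => norm_nonneg _) (fun n => ?_)
      (hu.mul_left (∫ v, κ v))
    rw [← integral_mul_const]
    exact integral_mono (hFi n).norm (hκi.mul_const _) (hFle n)
  have hHS := hasSum_integral_of_summable_integral_norm hFi hFsum
  -- the averaged terms, after exchanging the integrals
  set T : ℕ → ℝ → ℂ := fun n r => ∫ v, (K v : ℂ) *
    (1 + s * cos ((ρ 0 : ℝ) * v + (ρ 0 * X + θ.re : ℝ))) *
      (2 * cos ((ρ n * r : ℝ) * v + (ρ n * X * r + θ))) with hT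
  have hswap : ∀ n, ∫ v, F n v = c n * ∫ r, q r * T n r := by
    intro n
    have h1 : ∀ v, F n v = c n * ∫ r, (κ v : ℂ) * (q r * (2 * cos (ρ n * (X + v : ℝ) * r + θ))) := by
      intro v
      rw [integral_const_mul]
      simp only [hF, hJ]
      ring
    simp only [h1]
    rw [integral_const_mul]
    congr 1
    rw [integral_integral_swap_of_hasCompactSupport]
    · congr 1 with r
      rw [hT, ← integral_const_mul]
      congr 1 with v
      simp only [hκ]
      push_cast
      rw [show (ρ n : ℂ) * (X + v) * r + θ = ρ n * r * v + (ρ n * X * r + θ) by ring]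
      ring
    · unfold Function.uncurry
      fun_prop
    · refine HasCompactSupport.intro (hκsuppC.isCompact.prod hqsupp.isCompact) fun p hp => ?_
      simp only [mem_prod, not_and_or] at hp
      unfold Function.uncurry
      rcases hp with hp | hp
      · have : (κ p.1 : ℂ) = 0 := 
          image_eq_zero_of_notMem_tsupport (f := fun v => (κ v : ℂ)) hp
        simp [this]
      · simp [image_eq_zero_of_notMem_tsupport hp]
  have hTc : ∀ n, Continuous (T n) := by
    intro n
    have := continuous_parametric_integral_of_continuous (μ := volume)
      (f := fun (r v : ℝ) => (K v : ℂ) *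
        (1 + s * cos ((ρ 0 : ℝ) * v + (ρ 0 * X + θ.re : ℝ))) *
          (2 * cos ((ρ n * r : ℝ) * v + (ρ n * X * r + θ))))
      (by unfold Function.uncurry; fun_prop) (isCompact_Icc (a := -V) (b := V))
    refine this.congr fun Y => setIntegral_eq_integral_of_forall_compl_eq_zero fun v hv => ?_
    rw [hK0 v hv, ofReal_zero, zero_mul, zero_mul]
  have hqT : ∀ n, Integrable fun r => q r * T n r := fun n =>
    (hqc.mul (hTc n)).integrable_of_hasCompactSupport hqsupp.mul_right
  set e : ℕ → ℝ := fun n => E / (V * (g * ρ n)) ^ N with he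
  have he0 : ∀ n, 0 ≤ e n := fun n => by have := (hρpos n).le; positivity
  have hcosle : ∀ n (l : ℝ) (z : ℂ), |z.im| = |θ.im| → g * ρ n ≤ |l| →
      ‖∫ v, (K v : ℂ) * cos (l * v + z)‖ ≤ e n := by
    intro n l z hz hl
    have := norm_integral_mul_cos_le hV0 hKc hK0 hK (mul_pos hg0 (hρpos n)) hl z
    rwa [hz] at this
  have hsplit := fun n r => integral_mul_one_add_cos_mul_cos hKc hKsupp s (ρ 0) (ρ n * r)
    (ρ 0 * X + θ.re : ℝ) (ρ n * X * r + θ)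
  have him : ∀ (n : ℕ) (r : ℝ), ((ρ n * X * r + θ : ℂ)).im = θ.im := fun n r => by simp
  have hzim : ∀ n (r : ℝ), |((ρ n * X * r + θ : ℂ) + (ρ 0 * X + θ.re : ℝ)).im| = |θ.im| :=
    fun n r => by rw [add_im, him, ofReal_im, add_zero]
  have hzim' : ∀ n (r : ℝ), |((ρ n * X * r + θ : ℂ) - (ρ 0 * X + θ.re : ℝ)).im| = |θ.im| :=
    fun n r => by rw [sub_im, him, ofReal_im, sub_zero]
  have hrange : ∀ r, w r ≠ 0 → |r - 1| ≤ η / X := fun r hr => by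
    by_contra! h
    exact hr (hw0 r h)
  have hrg : ∀ r, w r ≠ 0 → 1 - g ≤ r := fun r hr => by
    linarith [(abs_le.1 ((hrange r hr).trans hηX)).1]
  have hl1 : ∀ n r, w r ≠ 0 → g * ρ n ≤ |ρ n * r| := fun n r hr => by
    refine le_trans ?_ (le_abs_self _)
    rw [mul_comm]
    exact mul_le_mul_of_nonneg_left (by linarith [hrg r hr]) (hρpos n).le
  have hl2 : ∀ n r, w r ≠ 0 → g * ρ n ≤ |ρ n * r + ρ 0| := fun n r hr => by
    refine le_trans ?_ (le_abs_self _)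
    have : ρ n * g ≤ ρ n * r := mul_le_mul_of_nonneg_left (by linarith [hrg r hr]) (hρpos n).le
    linarith
  have hl3 : ∀ n r, w r ≠ 0 → g * ρ (n + 1) ≤ |ρ (n + 1) * r - ρ 0| := fun n r hr => by
    refine le_trans ?_ (le_abs_self _)
    have h1 : ρ (n + 1) * (1 - g) ≤ ρ (n + 1) * r :=
      mul_le_mul_of_nonneg_left (hrg r hr) (hρpos _).le
    have h2 : ρ 0 ≤ ρ (n + 1) * (1 - 2 * g) := by
      rw [show 1 - 2 * g = ρ 0 / ρ 1 by rw [hg]; ring, ← mul_div_assoc, le_div_iff₀ (hρpos 1),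
        mul_comm]
      exact mul_le_mul_of_nonneg_right (hρ.monotone (by omega)) hρ0.le
    linarith
  have hsn : ‖(s : ℂ)‖ = 1 := by rw [norm_real, Real.norm_eq_abs, hs]
  -- all frequencies but the first: the three parts are nonresonant
  have hfar : ∀ n r, ‖q r * T (n + 1) r‖ ≤ w r * (5 * e (n + 1)) := by
    intro n r
    rw [norm_mul]
    by_cases hr : w r = 0
    · have := hq5 r
      rw [hr, mul_zero] at this
      rw [hr, le_antisymm this (norm_nonneg _), zero_mul, zero_mul]
    · have hTle : ‖T (n + 1) r‖ ≤ 4 * e (n + 1) := by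
        rw [hT]
        simp only []
        rw [hsplit]
        refine (norm_add_le _ _).trans ((add_le_add_left (norm_add_le _ _) _).trans ?_)
        rw [norm_mul, norm_mul, norm_mul, hsn, Complex.norm_ofNat]
        linarith [hcosle (n + 1) _ _ (congrArg _ (him (n + 1) r)) (hl1 (n + 1) r hr),
          hcosle (n + 1) _ _ (hzim (n + 1) r) (hl2 (n + 1) r hr),
          hcosle (n + 1) _ _ (hzim' (n + 1) r) (hl3 n r hr)]
      calc _ ≤ 5 / 4 * w r * (4 * e (n + 1)) :=
            mul_le_mul (hq5 r) hTle (norm_nonneg _) (by have := hwnn r; positivity)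
        _ = _ := by ring
  -- the first frequency: the part with the difference frequency is resonant
  have hnear : ∀ r, w r * (1 / 2 - 15 / 4 * e 0) ≤ s * (q r * T 0 r).re := by
    intro r
    by_cases hr : w r = 0
    · have := hq5 r
      rw [hr, mul_zero] at this
      rw [hr, norm_le_zero_iff.1 this]
      simp
    · set a := ∫ v, (K v : ℂ) * cos ((ρ 0 * r : ℝ) * v + (ρ 0 * X * r + θ)) with ha
      set b := ∫ v, (K v : ℂ) * cos ((ρ 0 * r + ρ 0 : ℝ) * v +
        ((ρ 0 * X * r + θ) + (ρ 0 * X + θ.re : ℝ))) with hb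
      set m := ∫ v, (K v : ℂ) * cos ((ρ 0 * r - ρ 0 : ℝ) * v +
        ((ρ 0 * X * r + θ) - (ρ 0 * X + θ.re : ℝ))) with hm
      have hT0 : T 0 r = 2 * a + s * b + s * m := hsplit 0 r
      have hab : ‖2 * a + s * b‖ ≤ 3 * e 0 := by
        refine (norm_add_le _ _).trans ?_
        rw [norm_mul, norm_mul, hsn, Complex.norm_ofNat]
        linarith [hcosle 0 _ _ (congrArg _ (him 0 r)) (hl1 0 r hr),
          hcosle 0 _ _ (hzim 0 r) (hl2 0 r hr)]
      have hqab : ‖q r * (2 * a + s * b)‖ ≤ 15 / 4 * e 0 * w r := by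
        rw [norm_mul]
        calc _ ≤ 5 / 4 * w r * (3 * e 0) :=
              mul_le_mul (hq5 r) hab (norm_nonneg _) (by have := hwnn r; positivity)
          _ = _ := by ring
      have hqm : w r / 2 ≤ (q r * m).re := by
        have hi : Integrable fun v => q r * ((K v : ℂ) * cos ((ρ 0 * r - ρ 0 : ℝ) * v +
            ((ρ 0 * X * r + θ) - (ρ 0 * X + θ.re : ℝ)))) := by
          refine Integrable.const_mul (Continuous.integrable_of_hasCompactSupport (by fun_prop)
            ((hKsupp.comp_left (g := fun x : ℝ => (x : ℂ)) ofReal_zero).mul_right)) _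
        have h1 := reCLM.integral_comp_comm hi
        simp only [reCLM_apply] at h1
        rw [hm, ← integral_const_mul, ← h1]
        calc w r / 2 = ∫ v, K v * (w r / 2) := by rw [integral_mul_const, hK1, one_mul]
          _ ≤ _ := by
            refine integral_mono (hKi.mul_const _) hi.re fun v => ?_
            by_cases hv : v ∈ Icc (-V) V
            · simp only [mul_left_comm (q r), re_ofReal_mul]
              refine mul_le_mul_of_nonneg_left ?_ (hKnn v)
              refine half_mul_le_re_mul_cos (hqw r)
                (x := ρ 0 * (X + v) * (r - 1)) ?_ ?_
              · have hXv : |X + v| ≤ 2 * X := by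
                  rw [abs_le]
                  constructor <;> linarith [hv.1, hv.2]
                rw [abs_mul, abs_mul, abs_of_pos hρ0]
                calc _ ≤ ρ 0 * (2 * X) * (η / X) := by
                      have := hrange r hr
                      gcongr
                  _ = _ := by
                      rw [hη]
                      field_simp
                      norm_num
              · rw [add_re, sub_re, add_re, ofReal_re, re_ofReal_mul, ofReal_re,
                  ← ofReal_mul, re_ofReal_mul, ofReal_re]
                ring
            · simp [hK0 v hv]
      have hdecomp : s * (q r * T 0 r).re = s * (q r * (2 * a + s * b)).re + (q r * m).re := by
        have hss : s * s = 1 := by rw [← abs_mul_abs_self, hs, one_mul]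
        rw [hT0, mul_add (q r) (2 * a + s * b), add_re, mul_left_comm (q r) (s : ℂ) m,
          re_ofReal_mul, mul_add, ← mul_assoc s s, hss, one_mul]
      have h2 : |s * (q r * (2 * a + s * b)).re| ≤ 15 / 4 * e 0 * w r := by
        rw [abs_mul, hs, one_mul]
        exact (abs_re_le_norm _).trans hqab
      rw [hdecomp]
      linarith [(abs_le.1 h2).1]
  have hce : ∀ n, ‖c n‖ * e n = E / (V * g) ^ N * (‖c n‖ / ρ n ^ N) := fun n => by
    have := (hρpos n).ne'
    simp only [he]
    rw [← mul_assoc V, mul_pow]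
    field_simp
  have hces : Summable fun n => ‖c n‖ * e n := by
    simp only [hce]
    exact hsum.mul_left _
  have hceD : 5 * ∑' n, ‖c n‖ * e n ≤ c₀ / 4 := by
    refine le_of_eq_of_le ?_ hDV
    simp only [hce]
    rw [tsum_mul_left, hD, mul_pow]
    field_simp
  -- hence the average is large, while it would be at most `c₀ W / 8` if all values were small
  have hmain : c₀ / 4 * W ≤ s * (∫ v, ∑' n, F n v).re := by
    rw [← hHS.tsum_eq, hHS.summable.tsum_eq_zero_add]
    have hfirst : c₀ * (W * (1 / 2 - 15 / 4 * e 0)) ≤ s * (∫ v, F 0 v).re := by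
      have h1 := reCLM.integral_comp_comm (hqT 0)
      simp only [reCLM_apply] at h1
      rw [hswap, hc, re_ofReal_mul, mul_left_comm s, ← h1]
      refine mul_le_mul_of_nonneg_left ?_ hc₀.le
      rw [hWdef, ← integral_mul_const, ← integral_const_mul]
      exact integral_mono (hwi.mul_const _) ((hqT 0).re.const_mul s) hnear
    have hrest : ∀ n, ‖∫ v, F (n + 1) v‖ ≤ 5 * W * (‖c (n + 1)‖ * e (n + 1)) := by
      intro n
      have h1 : ‖∫ r, q r * T (n + 1) r‖ ≤ W * (5 * e (n + 1)) := by
        rw [hWdef, ← integral_mul_const]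
        exact norm_integral_le_of_norm_le (hwi.mul_const _) (Eventually.of_forall (hfar n))
      rw [hswap, norm_mul]
      calc _ ≤ ‖c (n + 1)‖ * (W * (5 * e (n + 1))) := by gcongr
        _ = _ := by ring
    have hrest' := tsum_of_norm_bounded
      (((summable_nat_add_iff 1).2 hces).mul_left (5 * W)).hasSum hrest
    rw [tsum_mul_left] at hrest'
    have h3 := hces.tsum_eq_zero_add
    have hc0n : ‖c 0‖ = c₀ := by rw [hc, norm_real, Real.norm_of_nonneg hc₀.le]
    rw [h3, hc0n] at hceD
    have h2 : |s * (∑' n, ∫ v, F (n + 1) v).re| ≤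
        5 * W * ∑' n, ‖c (n + 1)‖ * e (n + 1) := by
      rw [abs_mul, hs, one_mul]
      exact (abs_re_le_norm _).trans hrest'
    rw [add_re, mul_add]
    have h4 := (abs_le.1 h2).1
    have h5 := mul_le_mul_of_nonneg_left hceD hW.le
    have h6 : 0 ≤ W * (c₀ * e 0) := by have := he0 0; positivity
    linarith
  by_contra! hcon
  -- otherwise the average would have the junk value `0`, contrary to `hmain`
  have hGi : Integrable fun v => ∑' n, F n v := by
    by_contra h
    rw [integral_undef h, zero_re, mul_zero] at hmain
    have : 0 < c₀ / 4 * W := by positivity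
    linarith
  have hG : s * (∫ v, ∑' n, F n v).re ≤ ∫ v, κ v * (c₀ / 16 * W) := by
    have h1 := reCLM.integral_comp_comm hGi
    simp only [reCLM_apply] at h1
    rw [← h1, ← integral_const_mul]
    refine integral_mono (hGi.re.const_mul s) (hκi.mul_const _) fun v => ?_
    simp only [hF]
    rw [tsum_mul_left, re_ofReal_mul, mul_left_comm]
    by_cases hv : v ∈ Icc (-V) V
    · refine mul_le_mul_of_nonneg_left ?_ (hκnn v)
      have := (hcon (X + v) ⟨by linarith [hv.1], by linarith [hv.2]⟩).le
      simpa only [hJ] using this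
    · simp [hκzero v hv]
  rw [integral_mul_const] at hG
  have : (∫ v, κ v) * (c₀ / 16 * W) ≤ 2 * (c₀ / 16 * W) :=
    mul_le_mul_of_nonneg_right hκint (by positivity)
  have h7 : 0 < c₀ * W := by positivity
  linarith

end LocalMean

open Complex Filter Topology MeasureTheory Set
open scoped ContDiff

namespace LocalMean

/-! ### The local mean as an integral on a line to the left -/

/-- A codiscrete property holds almost everywhere on each vertical line, since the exceptional set
is countable. -/
theorem eventually_codiscrete_ae_vertical {p : ℂ → Prop} (h : ∀ᶠ s in codiscrete ℂ, p s) (x : ℝ) :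
    ∀ᵐ t : ℝ, p (x + t * I) := by
  have hd := (mem_codiscrete'.1 h).2
  have : DiscreteTopology ↑({s | p s}ᶜ) := hd.to_subtype
  have hc : ({s | p s}ᶜ).Countable := countable_of_Lindelof_of_discrete (X := ↑({s | p s}ᶜ))
  have hinj : Function.Injective fun t : ℝ => (x + t * I : ℂ) := fun a b hab => by
    simpa using hab
  filter_upwards [(hc.preimage hinj).ae_notMem volume] with t ht
  simpa using ht

namespace Data

variable {d : ℕ} {P : Data d} {Phi Psi : ℂ → ℂ} {R : ℝ}

theorem Admissible.eventually_codiscrete_sin_ne_zero (hP : P.Admissible) :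
    ∀ᶠ s in codiscrete ℂ, ∀ ν, sin (Real.pi * (P.alpha ν * s + P.beta ν)) ≠ 0 := by
  rw [eventually_all]
  intro ν
  have hα : (P.alpha ν : ℂ) ≠ 0 := by exact_mod_cast (hP.alpha_pos ν).ne'
  have hf : AnalyticOnNhd ℂ (fun s => sin (Real.pi * (P.alpha ν * s + P.beta ν))) univ :=
    (Differentiable.differentiableOn (by fun_prop)).analyticOnNhd isOpen_univ
  refine hf.preimage_zero_mem_codiscrete (x := (1 / 2 - P.beta ν) / P.alpha ν) ?_
  rw [mul_div_cancel₀ _ hα, sub_add_cancel, mul_one_div, sin_pi_div_two]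
  exact one_ne_zero

theorem Gamma_ne_zero_of_sin_ne_zero {z : ℂ} (hz : sin (Real.pi * z) ≠ 0) : Gamma z ≠ 0 := by
  intro h
  have := Gamma_mul_Gamma_one_sub z
  rw [h, zero_mul, eq_comm, div_eq_zero_iff] at this
  exact this.elim (by exact_mod_cast Real.pi_ne_zero) hz

theorem Admissible.eventually_codiscrete_Delta_ne_zero (hP : P.Admissible) :
    ∀ᶠ s in codiscrete ℂ, P.Delta s ≠ 0 := by
  filter_upwards [hP.eventually_codiscrete_sin_ne_zero] with s hs
  exact Finset.prod_ne_zero_iff.2 fun ν _ => Gamma_ne_zero_of_sin_ne_zero (hs ν)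

theorem differentiable_Delta_inv : Differentiable ℂ fun s => (P.Delta s)⁻¹ := by
  simp only [Delta, ← Finset.prod_inv_distrib]
  refine Differentiable.fun_finsetProd fun ν _ => ?_
  exact differentiable_one_div_Gamma.comp (by fun_prop : Differentiable ℂ fun s : ℂ =>
    (P.alpha ν : ℂ) * s + P.beta ν)

/-- `1/Δ` grows slower than any Gaussian in vertical strips. -/
theorem exists_norm_Delta_inv_le (P : Data d) (b b' : ℝ) {η : ℝ} (hη : 0 < η) :
    ∃ C : ℝ, 0 ≤ C ∧ ∀ s : ℂ, b ≤ s.re → s.re ≤ b' →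
      ‖(P.Delta s)⁻¹‖ ≤ C * Real.exp (η * s.im ^ 2) := by
  have hfac : ∀ ν, ∃ C : ℝ, 0 ≤ C ∧ ∀ s : ℂ, b ≤ s.re → s.re ≤ b' →
      ‖(Gamma (P.alpha ν * s + P.beta ν))⁻¹‖ ≤ C * Real.exp (η / (d + 1) * s.im ^ 2) := by
    intro ν
    set a := P.alpha ν
    set β := P.beta ν
    have hη' : 0 < η / (d + 1) / (2 * (a ^ 2 + 1)) := by positivity
    obtain ⟨C, hC, h⟩ := exists_norm_Gamma_inv_le (-(|a| * (|b| + |b'|)) + β.re)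
      (|a| * (|b| + |b'|) + β.re) hη'
    refine ⟨C * Real.exp (η / (d + 1) / (2 * (a ^ 2 + 1)) * (2 * β.im ^ 2)), by positivity,
      fun s h1 h2 => ?_⟩
    have hre : |a * s.re| ≤ |a| * (|b| + |b'|) := by
      rw [abs_mul]
      gcongr
      rw [abs_le]
      constructor <;> linarith [neg_abs_le b, le_abs_self b', abs_nonneg b, abs_nonneg b']
    have e1 : ((a : ℂ) * s + β).re = a * s.re + β.re := by simp
    have e2 : ((a : ℂ) * s + β).im = a * s.im + β.im := by simp
    refine (h _ (by rw [e1]; linarith [(abs_le.1 hre).1])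
      (by rw [e1]; linarith [(abs_le.1 hre).2])).trans ?_
    rw [mul_assoc, ← Real.exp_add, e2]
    gcongr
    have hid : η / (d + 1) * s.im ^ 2 = η / (d + 1) / (2 * (a ^ 2 + 1)) *
        (2 * (a ^ 2 + 1) * s.im ^ 2) := by
      have : a ^ 2 + 1 ≠ 0 := by positivity
      field_simp
    rw [hid, ← mul_add]
    refine mul_le_mul_of_nonneg_left ?_ hη'.le
    nlinarith [sq_nonneg (a * s.im - β.im), sq_nonneg s.im]
  choose C hC h using hfac
  refine ⟨∏ ν, C ν, Finset.prod_nonneg fun ν _ => hC ν, fun s h1 h2 => ?_⟩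
  rw [Delta, ← Finset.prod_inv_distrib, norm_prod]
  calc _ ≤ ∏ ν, C ν * Real.exp (η / (d + 1) * s.im ^ 2) :=
        Finset.prod_le_prod (fun ν _ => norm_nonneg _) fun ν _ => h ν s h1 h2
    _ = (∏ ν, C ν) * Real.exp (d * (η / (d + 1) * s.im ^ 2)) := by
        rw [Finset.prod_mul_distrib, Finset.prod_const, Finset.card_univ, Fintype.card_fin,
          ← Real.exp_nat_mul]
    _ ≤ _ := by
        have := Finset.prod_nonneg fun ν (_ : ν ∈ Finset.univ) => hC ν
        refine mul_le_mul_of_nonneg_left (Real.exp_le_exp.2 ?_) this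
        have : (d : ℝ) * (η / (d + 1) * s.im ^ 2) = (d / (d + 1)) * (η * s.im ^ 2) := by
          field_simp
        rw [this]
        refine mul_le_of_le_one_left (by positivity) ?_
        rw [div_le_one (by positivity)]
        linarith

/-- The normal form of the meromorphic function `φ`, which removes the junk values at removable
singularities. It is holomorphic outside the disc, because `Δφ` has no poles there and `1/Δ` is
entire, and it grows slower than any Gaussian in vertical strips, because `Δφ` is bounded there. -/
theorem FunctionalEquation.exists_regular (hP : P.Admissible)
    (hF : P.FunctionalEquation Phi Psi R) : ∃ Φ : ℂ → ℂ,
      (∀ s, R ≤ ‖s‖ → DifferentiableAt ℂ Φ s) ∧ (∀ᶠ s in codiscrete ℂ, Φ s = Phi s) ∧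
      ∀ x₁ x₂ η : ℝ, 0 < η → ∃ C T₀ : ℝ, ∀ s : ℂ, x₁ ≤ s.re → s.re ≤ x₂ → T₀ ≤ |s.im| →
        ‖Φ s‖ ≤ C * Real.exp (η * s.im ^ 2) := by
  have hmero : MeromorphicOn Phi univ := fun s _ => hF.phi_mero s
  have heq : ∀ᶠ s in codiscrete ℂ, toMeromorphicNFOn Phi univ s = Phi s := by
    filter_upwards [toMeromorphicNFOn_eqOn_codiscrete hmero] with s hs using hs.symm
  have hnhds : ∀ {p : ℂ → Prop} (s : ℂ), (∀ᶠ s in codiscrete ℂ, p s) → ∀ᶠ z in 𝓝[≠] s, p z := by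
    intro p s h
    have := mem_codiscrete.1 h s
    rwa [disjoint_principal_right, compl_compl] at this
  have hdiff : ∀ s, R ≤ ‖s‖ → DifferentiableAt ℂ (toMeromorphicNFOn Phi univ) s := by
    intro s hs
    refine AnalyticAt.differentiableAt ?_
    rw [← (meromorphicNFOn_toMeromorphicNFOn Phi univ
      (mem_univ s)).meromorphicOrderAt_nonneg_iff_analyticAt,
      meromorphicOrderAt_toMeromorphicNFOn hmero (mem_univ s)]
    have hinv : AnalyticAt ℂ (fun z => (P.Delta z)⁻¹) s := differentiable_Delta_inv.analyticAt s
    have hDelta : MeromorphicAt P.Delta s := by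
      have := hinv.meromorphicAt.inv
      refine this.congr (Eventually.of_forall fun z => ?_)
      simp
    have h1 : meromorphicOrderAt Phi s =
        meromorphicOrderAt ((fun z => (P.Delta z)⁻¹) * fun z => P.Delta z * Phi z) s := by
      refine meromorphicOrderAt_congr ?_
      filter_upwards [hnhds s hP.eventually_codiscrete_Delta_ne_zero] with z hz
      simp [inv_mul_cancel_left₀ hz]
    rw [h1, meromorphicOrderAt_mul hinv.meromorphicAt (hDelta.fun_mul (hF.phi_mero s))]
    exact add_nonneg hinv.meromorphicOrderAt_nonneg (hF.regular s hs)
  refine ⟨toMeromorphicNFOn Phi univ, hdiff, heq, fun x₁ x₂ η hη => ?_⟩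
  obtain ⟨C, hC, hinv⟩ := P.exists_norm_Delta_inv_le (x₁ - 1) (x₂ + 1) hη
  obtain ⟨T, hT⟩ := hF.decay (x₁ - 1) (x₂ + 1) 1 one_pos
  refine ⟨C, max R (T + 1), fun s h1 h2 h3 => ?_⟩
  have hcont : ContinuousAt (toMeromorphicNFOn Phi univ) s :=
    (hdiff s (((le_max_left _ _).trans h3).trans (abs_im_le_norm s))).continuousAt
  have hexp : ContinuousAt (fun z : ℂ => C * Real.exp (η * z.im ^ 2)) s := by fun_prop
  refine le_of_tendsto_of_tendsto (b := 𝓝[≠] s)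
    (hcont.norm.tendsto.mono_left nhdsWithin_le_nhds)
    (hexp.tendsto.mono_left nhdsWithin_le_nhds) ?_
  have e1 : ∀ᶠ z in 𝓝[≠] s, x₁ - 1 < z.re :=
    (continuous_re.continuousAt.eventually_const_lt (by linarith)).filter_mono nhdsWithin_le_nhds
  have e2 : ∀ᶠ z in 𝓝[≠] s, z.re < x₂ + 1 :=
    (continuous_re.continuousAt.eventually_lt_const (by linarith)).filter_mono nhdsWithin_le_nhds
  have e3 : ∀ᶠ z in 𝓝[≠] s, T < |z.im| :=
    (continuous_im.abs.continuousAt.eventually_const_lt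
      (by linarith [(le_max_right R (T + 1)).trans h3])).filter_mono nhdsWithin_le_nhds
  filter_upwards [e1, e2, e3, hnhds s heq, hnhds s hP.eventually_codiscrete_Delta_ne_zero]
    with z h1 h2 h3 h4 h5
  have h6 := hT z h1.le h2.le h3.le
  have h7 := hinv z h1.le h2.le
  rw [h4, ← inv_mul_cancel_left₀ h5 (Phi z), norm_mul]
  exact (mul_le_of_le_one_right (norm_nonneg _) h6.le).trans h7

/-- The functional equation in the half-plane where `ψ(1 - s)` is a Dirichlet series. -/
theorem FunctionalEquation.eventually_codiscrete_eq (hP : P.Admissible)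
    (hF : P.FunctionalEquation Phi Psi R) : ∀ᶠ s in codiscrete ℂ, P.sigmaStar < (1 - s).re →
      Phi s = P.omega * P.gammaQuotient s * P.psiSeries (1 - s) := by
  filter_upwards [hF.func_eq, hP.eventually_codiscrete_sin_ne_zero,
    hP.eventually_codiscrete_Delta_ne_zero] with s h1 h2 h3 h4
  have h5 : P.gammaQuotient s = P.DeltaTilde (1 - s) * (P.Delta s)⁻¹ := by
    rw [gammaQuotient, DeltaTilde, Delta, ← Finset.prod_inv_distrib, ← Finset.prod_mul_distrib]
    refine Finset.prod_congr rfl fun ν _ => ?_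
    congr 1
    have h6 := Gamma_mul_Gamma_one_sub (P.alpha ν * s + P.beta ν)
    have h7 := Gamma_ne_zero_of_sin_ne_zero (h2 ν)
    rw [eq_div_iff (h2 ν)] at h6
    have hpi : (Real.pi : ℂ) ≠ 0 := by exact_mod_cast Real.pi_ne_zero
    rw [div_eq_iff hpi, eq_inv_mul_iff_mul_eq₀ h7, ← mul_assoc]
    exact h6
  rw [h5, ← hF.psi_eq _ h4]
  field_simp
  rw [← h1]
  ring

theorem integrable_mul_weightMellin {f : ℝ → ℝ} {L : ℝ} (hf : ContDiff ℝ ∞ f)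
    (hs : Function.support f ⊆ Icc (-1) 1) (hL : 2 ≤ L) {y : ℝ} (hy : 0 < y) (σ : ℝ) {G : ℝ → ℂ}
    (hG : AEStronglyMeasurable G) {C r : ℝ} (hr : 0 ≤ r)
    (hGle : ∀ᵐ t : ℝ, ‖G t‖ ≤ C * (1 + |t|) ^ r) :
    Integrable fun t : ℝ => G t * (weightMellin f L (σ + t * I) * (y : ℂ) ^ (σ + t * I : ℂ)) := by
  obtain ⟨C', -, h⟩ := exists_integral_rpow_mul_norm_weightMellin_le hf hs σ hr
  have hW := (differentiable_weightMellin hf.continuous hs hL).continuous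
  have hy' : (y : ℂ) ≠ 0 := by exact_mod_cast hy.ne'
  refine Integrable.mono' ((h L hL).1.const_mul (C * y ^ σ)) (hG.mul ?_) ?_
  · refine Continuous.aestronglyMeasurable ?_
    exact (hW.comp (by fun_prop)).mul
      (Continuous.const_cpow (by fun_prop) (Or.inl hy'))
  · filter_upwards [hGle] with t ht
    rw [norm_mul, norm_mul, norm_cpow_eq_rpow_re_of_pos hy]
    simp only [add_re, ofReal_re, mul_re, I_re, mul_zero, ofReal_im, I_im, mul_one, sub_self,
      add_zero]
    calc _ ≤ C * (1 + |t|) ^ r * (‖weightMellin f L (σ + t * I)‖ * y ^ σ) := by gcongr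
      _ = _ := by ring

theorem norm_phiSeries_le (hP : P.Admissible) {s : ℂ} (hs : P.sigmaStar ≤ s.re) :
    ‖P.phiSeries s‖ ≤ ∑' n, ‖P.a n‖ * P.lam n ^ (-s.re) := by
  refine (norm_tsum_le_tsum_norm (hP.phi_abs s hs)).trans (le_of_eq ?_)
  congr 1 with n
  rw [norm_mul, norm_cpow_eq_rpow_re_of_pos (hP.lam_pos n), neg_re]

theorem norm_psiSeries_le (hP : P.Admissible) {s : ℂ} (hs : P.sigmaStar ≤ s.re) :
    ‖P.psiSeries s‖ ≤ ∑' n, ‖P.b n‖ * P.mu n ^ (-s.re) := by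
  refine (norm_tsum_le_tsum_norm (hP.psi_abs s hs)).trans (le_of_eq ?_)
  congr 1 with n
  rw [norm_mul, norm_cpow_eq_rpow_re_of_pos (hP.mu_pos n), neg_re]

theorem summable_norm_mul_rpow_lam (hP : P.Admissible) {c : ℝ} (hc : P.sigmaStar ≤ c) :
    Summable fun n => ‖P.a n‖ * P.lam n ^ (-c) := by
  refine (hP.phi_abs c (by simpa using hc)).congr fun n => ?_
  rw [norm_mul, norm_cpow_eq_rpow_re_of_pos (hP.lam_pos n), neg_re, ofReal_re]

theorem summable_norm_mul_rpow_mu (hP : P.Admissible) {c : ℝ} (hc : P.sigmaStar ≤ c) :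
    Summable fun n => ‖P.b n‖ * P.mu n ^ (-c) := by
  refine (hP.psi_abs c (by simpa using hc)).congr fun n => ?_
  rw [norm_mul, norm_cpow_eq_rpow_re_of_pos (hP.mu_pos n), neg_re, ofReal_re]

/-- Mellin inversion: the weighted sum as an integral on a line to the right. -/
theorem tsum_mul_weight_eq_integral (hP : P.Admissible) {f : ℝ → ℝ} {L : ℝ} (hf : ContDiff ℝ ∞ f)
    (hs : Function.support f ⊆ Icc (-1) 1) (hL : 2 ≤ L) {y : ℝ} (hy : 0 < y) {σ : ℝ}
    (hσ : P.sigmaStar ≤ σ) :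
    ∑' n, P.a n * (weight f L (P.lam n / y) : ℂ) = (2 * Real.pi : ℂ)⁻¹ *
      ∫ t : ℝ, P.phiSeries (σ + t * I) *
        (weightMellin f L (σ + t * I) * (y : ℂ) ^ (σ + t * I : ℂ)) := by
  have hre : ∀ t : ℝ, (σ + t * I : ℂ).re = σ := fun t => by simp
  set F : ℕ → ℝ → ℂ := fun n t => P.a n * (P.lam n : ℂ) ^ (-(σ + t * I : ℂ)) *
    (weightMellin f L (σ + t * I) * (y : ℂ) ^ (σ + t * I : ℂ)) with hFdef
  have hnorm : ∀ n (t : ℝ), ‖P.a n * (P.lam n : ℂ) ^ (-(σ + t * I : ℂ))‖ =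
      ‖P.a n‖ * P.lam n ^ (-σ) := fun n t => by
    rw [norm_mul, norm_cpow_eq_rpow_re_of_pos (hP.lam_pos n), neg_re, hre]
  have hFi : ∀ n, Integrable (F n) := by
    intro n
    refine integrable_mul_weightMellin hf hs hL hy σ (C := ‖P.a n‖ * P.lam n ^ (-σ)) (r := 0) ?_
      le_rfl (Eventually.of_forall fun t => ?_)
    · have : (P.lam n : ℂ) ≠ 0 := by exact_mod_cast (hP.lam_pos n).ne'
      exact (continuous_const.mul
        (Continuous.const_cpow (by fun_prop) (Or.inl this))).aestronglyMeasurable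
    · rw [Real.rpow_zero, mul_one, hnorm]
  have hFsum : Summable fun n => ∫ t, ‖F n t‖ := by
    have : ∀ n, ∫ t, ‖F n t‖ = ‖P.a n‖ * P.lam n ^ (-σ) *
        ∫ t : ℝ, ‖weightMellin f L (σ + t * I) * (y : ℂ) ^ (σ + t * I : ℂ)‖ := fun n => by
      rw [← integral_const_mul]
      congr 1 with t
      rw [hFdef, norm_mul, hnorm]
    simp only [this]
    exact (summable_norm_mul_rpow_lam hP hσ).mul_right _
  have hHS := hasSum_integral_of_summable_integral_norm hFi hFsum
  have hlhs : ∀ n, P.a n * (weight f L (P.lam n / y) : ℂ) =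
      (2 * Real.pi : ℂ)⁻¹ * ∫ t, F n t := by
    intro n
    rw [← weight_eq_integral hf hs hL σ (div_pos (hP.lam_pos n) hy), mul_left_comm,
      ← integral_const_mul]
    congr 2 with t
    have hl := hP.lam_pos n
    have hyc : (y : ℂ) ≠ 0 := by exact_mod_cast hy.ne'
    have h1 : ((P.lam n / y : ℝ) : ℂ) ^ (-(σ + t * I : ℂ)) =
        (P.lam n : ℂ) ^ (-(σ + t * I : ℂ)) * (y : ℂ) ^ (σ + t * I : ℂ) := by
      rw [div_eq_mul_inv, ofReal_mul, mul_cpow_ofReal_nonneg hl.le (inv_nonneg.2 hy.le),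
        ofReal_inv, cpow_neg (y⁻¹ : ℂ), inv_cpow _ _ (by
          rw [arg_ofReal_of_nonneg hy.le]; exact Real.pi_ne_zero.symm), inv_inv]
    rw [h1, hFdef]
    ring
  simp only [hlhs]
  rw [tsum_mul_left, hHS.tsum_eq]
  congr 2 with t
  rw [phiSeries, ← tsum_mul_right]

/-- Moving the line of integration to the left across the disc subtracts the residual term, and the
functional equation then expresses the mean through the dual series. -/
theorem FunctionalEquation.S_eq_integral (hP : P.Admissible)
    (hF : P.FunctionalEquation Phi Psi R) {f : ℝ → ℝ} {L : ℝ} (hf : ContDiff ℝ ∞ f)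
    (hs : Function.support f ⊆ Icc (-1) 1) (hL : 2 ≤ L) {y : ℝ} (hy : 0 < y) {c : ℝ} (hc : R < c)
    (hcσ : P.sigmaStar < 1 + c) {C r : ℝ} (hr : 0 ≤ r)
    (hle : ∀ t : ℝ, ‖P.gammaQuotient (-c + t * I)‖ ≤ C * (1 + |t|) ^ r) :
    (Integrable fun t : ℝ => P.omega * P.gammaQuotient (-c + t * I) *
      P.psiSeries (1 - (-c + t * I)) *
        (weightMellin f L (-c + t * I) * (y : ℂ) ^ (-c + t * I : ℂ))) ∧
    P.S Phi R (weight f L) y = (2 * Real.pi : ℂ)⁻¹ *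
      ∫ t : ℝ, P.omega * P.gammaQuotient (-c + t * I) * P.psiSeries (1 - (-c + t * I)) *
        (weightMellin f L (-c + t * I) * (y : ℂ) ^ (-c + t * I : ℂ)) := by
  obtain ⟨Φ, hΦd, hΦeq, hΦgrow⟩ := hF.exists_regular hP
  have hR := hF.R_pos
  have hyc : (y : ℂ) ≠ 0 := by exact_mod_cast hy.ne'
  set σ : ℝ := max R P.sigmaStar + 1 with hσ
  have hσR : R < σ := by linarith [le_max_left R P.sigmaStar]
  have hσs : P.sigmaStar < σ := by linarith [le_max_right R P.sigmaStar]
  have hre : ∀ x t : ℝ, (x + t * I : ℂ).re = x := fun x t => by simp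
  have hnorm : ∀ x t : ℝ, R < |x| → R ≤ ‖(x + t * I : ℂ)‖ := fun x t hx => by
    have := abs_re_le_norm (x + t * I : ℂ)
    rw [hre] at this
    linarith
  have hmeas : ∀ x : ℝ, R < |x| → AEStronglyMeasurable fun t : ℝ => Φ (x + t * I) := fun x hx => by
    refine Continuous.aestronglyMeasurable (continuous_iff_continuousAt.2 fun t => ?_)
    exact ContinuousAt.comp (g := Φ) (f := fun t : ℝ => (x + t * I : ℂ))
      (hΦd _ (hnorm x t hx)).continuousAt (by fun_prop)
  have hσabs : R < |σ| := hσR.trans_le (le_abs_self _)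
  have hcabs : R < |-c| := by rw [abs_neg]; exact hc.trans_le (le_abs_self _)
  have hright : ∀ᵐ t : ℝ, Φ (σ + t * I) = P.phiSeries (σ + t * I) := by
    filter_upwards [eventually_codiscrete_ae_vertical hΦeq σ] with t ht
    rw [ht, hF.phi_eq _ (by rw [hre]; exact hσs)]
  have hleft : ∀ᵐ t : ℝ, Φ ((-c : ℝ) + t * I) = P.omega * P.gammaQuotient ((-c : ℝ) + t * I) *
      P.psiSeries (1 - ((-c : ℝ) + t * I)) := by
    filter_upwards [eventually_codiscrete_ae_vertical hΦeq (-c),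
      eventually_codiscrete_ae_vertical (hF.eventually_codiscrete_eq hP) (-c)] with t h1 h2
    rw [h1, h2]
    rw [sub_re, hre, one_re]
    linarith
  set g : ℂ → ℂ := fun s => weightMellin f L s * (y : ℂ) ^ s with hg
  have i₂ : Integrable fun t : ℝ => Φ (σ + t * I) * g (σ + t * I) := by
    refine integrable_mul_weightMellin hf hs hL hy σ (hmeas σ hσabs) le_rfl
      (C := ∑' n, ‖P.a n‖ * P.lam n ^ (-σ)) ?_
    filter_upwards [hright] with t ht
    rw [Real.rpow_zero, mul_one, ht]
    refine (norm_phiSeries_le hP (by rw [hre]; exact hσs.le)).trans (le_of_eq ?_)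
    simp only [hre]
  have i₁ : Integrable fun t : ℝ => Φ ((-c : ℝ) + t * I) * g ((-c : ℝ) + t * I) := by
    refine integrable_mul_weightMellin hf hs hL hy (-c) (hmeas (-c) hcabs) hr
      (C := C * ∑' n, ‖P.b n‖ * P.mu n ^ (-(1 + c))) ?_
    filter_upwards [hleft] with t ht
    have h1 : (1 - ((-c : ℝ) + t * I : ℂ)).re = 1 + c := by
      rw [sub_re, hre, one_re]; ring
    have h2 := norm_psiSeries_le hP (s := 1 - ((-c : ℝ) + t * I : ℂ)) (by rw [h1]; exact hcσ.le)
    simp only [h1] at h2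
    have h3 := hle t
    rw [ht, norm_mul, norm_mul, hP.omega_norm, one_mul]
    push_cast at h2 ⊢
    calc _ ≤ C * (1 + |t|) ^ r * ∑' n, ‖P.b n‖ * P.mu n ^ (-(1 + c)) :=
          mul_le_mul h3 h2 (norm_nonneg _) ((norm_nonneg _).trans h3)
      _ = _ := by ring
  obtain ⟨K, hK0, hK⟩ := exists_abs_le_of_support hf.continuous hs
  have hcontour := integral_vertical_sub_eq_circleIntegral_of_gaussian hR (x₁ := -c) (x₂ := σ)
    (by linarith) hσR hΦd (g := g)
    ((differentiable_weightMellin hf.continuous hs hL).mul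
      (differentiable_id.const_cpow (Or.inl hyc)))
    (K := 2 ^ (c + σ + 1) * K * 2 / L * Real.exp (|Real.log y| * (c + σ))) (fun s h1 h2 => by
      have habs : |s.re| ≤ c + σ := abs_le.2 ⟨by linarith, by linarith⟩
      rw [hg, norm_mul]
      gcongr
      · refine (norm_weightMellin_le hs hK hL s).trans ?_
        gcongr
        · norm_num
        · exact (abs_sub _ _).trans (by rw [abs_one]; linarith)
      · rw [norm_cpow_eq_rpow_re_of_pos hy, Real.rpow_def_of_pos hy]
        refine Real.exp_le_exp.2 ((le_abs_self _).trans ?_)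
        rw [abs_mul]
        gcongr) (hΦgrow _ _) i₁ i₂
  have hcirc : ∮ s in C(0, R), Phi s * mellin (fun u => (weight f L u : ℂ)) s * (y : ℂ) ^ s =
      ∮ s in C(0, R), Φ s * g s := by
    refine circleIntegral.circleIntegral_congr_codiscreteWithin ?_ hR.ne'
    refine codiscreteWithin_mono (subset_univ _) ?_
    filter_upwards [hΦeq] with s hs
    rw [hs, mul_assoc]
    rfl
  have hright' : ∫ t : ℝ, P.phiSeries (σ + t * I) *
      (weightMellin f L (σ + t * I) * (y : ℂ) ^ (σ + t * I : ℂ)) =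
      ∫ t : ℝ, Φ (σ + t * I) * g (σ + t * I) :=
    integral_congr_ae (hright.mono fun t ht => by simp only [ht, hg])
  have hfin : (fun t : ℝ => Φ ((-c : ℝ) + t * I) * g ((-c : ℝ) + t * I)) =ᵐ[volume]
      fun t : ℝ => P.omega * P.gammaQuotient (-c + t * I) * P.psiSeries (1 - (-c + t * I)) *
        (weightMellin f L (-c + t * I) * (y : ℂ) ^ (-c + t * I : ℂ)) := by
    refine hleft.mono fun t ht => ?_
    simp only [ht, hg]
    push_cast
    rfl
  refine ⟨i₁.congr hfin, ?_⟩
  rw [S, M, hcirc, ← hcontour, tsum_mul_weight_eq_integral hP hf hs hL hy hσs.le, hright',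
    ← integral_congr_ae hfin,
    ← mul_sub, mul_inv (2 * (Real.pi : ℂ)) I, mul_assoc _ I⁻¹, inv_mul_cancel_left₀ I_ne_zero,
    mul_sub, sub_sub_cancel]

end Data

end LocalMean

open Complex Filter Topology MeasureTheory Set
open scoped ContDiff

namespace LocalMean

/-! ### The dual expansion of the local mean -/

/-- The weight in the variable `r = u^{1/a}`: the function `r ↦ f((r^a - 1)L)`, set to `0` for
`r ≤ 0`, where `r ^ a` has no meaning. -/
noncomputable def dualWeight (f : ℝ → ℝ) (L a : ℝ) : ℝ → ℝ :=
  (Ioi 0).indicator fun r => weight f L (r ^ a)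

namespace Data

variable {d : ℕ} (P : Data d)

/-- The phase of the cosines in the dual expansion, for which `trigSum` is a combination of
`e^{±iθ}` with the factors `e^{±iπq/2}`, `q = κ - 2As`, that rotate Euler's integral for `Γ(q)`. It
need not be real. -/
noncomputable def theta : ℂ := Real.pi * d / 2 - Real.pi * P.B - Real.pi * P.kappa / 2

/-- The frequencies `(hμₙ)^{1/2A}` of the dual expansion in the variable `Y = y^{1/2A}`. -/
noncomputable def rho (n : ℕ) : ℝ := (P.h * P.mu n) ^ (1 / (2 * P.A))

/-- The coefficients of the dual expansion, normalised by `ς` and by `(μ₁hy)^{iξ}`, so that the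
first one is positive. -/
noncomputable def coef (n : ℕ) : ℂ :=
  (‖P.b 0‖ : ℂ) / P.b 0 * P.b n * (P.mu n : ℂ)⁻¹ * (2 * (P.h : ℂ))⁻¹ *
    ((P.h * P.mu n) ^ (1 - P.vartheta) : ℝ) * ((P.mu n / P.mu 0 : ℝ) : ℂ) ^ (I * P.xi)

/-- The cosine integral in the term with number `n` of the dual expansion, at `Y = y^{1/2A}`. -/
noncomputable def cosIntegral (f : ℝ → ℝ) (L Y : ℝ) (n : ℕ) : ℂ :=
  ∫ r : ℝ, (r : ℂ) ^ (P.kappa - 1) * (dualWeight f L (2 * P.A) r : ℂ) *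
    (2 * cos (P.rho n * Y * r + P.theta))

variable {P} {Phi Psi : ℂ → ℂ} {R : ℝ}

/-- The shift `κ` in terms of the exponents `ϑ` and `ξ` of the asymptotic formula. -/
theorem Admissible.kappa_eq (hP : P.Admissible) :
    P.kappa = 2 * P.A * ((1 - P.vartheta : ℝ) + I * P.xi) := by
  have hA : (P.A : ℂ) ≠ 0 := by exact_mod_cast hP.A_pos.ne'
  have h1 : ((1 - P.vartheta : ℝ) + I * P.xi : ℂ) = 1 + P.shift := by
    rw [vartheta, xi]
    conv_rhs => rw [← re_add_im P.shift]
    push_cast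
    ring
  rw [h1, kappa, shift]
  field_simp
  ring

theorem Admissible.kappa_re (hP : P.Admissible) : P.kappa.re = 2 * P.A * (1 - P.vartheta) := by
  rw [hP.kappa_eq, ← ofReal_ofNat, ← ofReal_mul, re_ofReal_mul]
  simp

theorem Admissible.e0_eq (hP : P.Admissible) :
    P.e0 = 2 * P.h * ((Real.sqrt (2 * Real.pi) : ℂ)⁻¹ * P.ampl) := by
  have h1 : ∏ ν, ((2 * P.A / P.alpha ν : ℝ) : ℂ) ^ ((P.alpha ν : ℂ) + P.beta ν - P.betaTilde ν) =
      P.h * P.ampl := by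
    rw [h, ampl, ofReal_prod, ← Finset.prod_mul_distrib]
    refine Finset.prod_congr rfl fun ν _ => ?_
    have hr := hP.ratio_pos ν
    rw [ofReal_cpow hr.le, ← cpow_add _ _ (by exact_mod_cast hr.ne')]
    congr 1
    push_cast
    ring
  have h2 : (Real.sqrt (2 / Real.pi) : ℝ) = 2 * (Real.sqrt (2 * Real.pi))⁻¹ := by
    rw [Real.sqrt_div zero_le_two, Real.sqrt_mul zero_le_two]
    have h3 : Real.sqrt 2 ≠ 0 := by positivity
    have h4 : Real.sqrt Real.pi ≠ 0 := by have := Real.pi_pos; positivity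
    field_simp
    rw [Real.sq_sqrt zero_le_two]
  rw [e0, h1, h2]
  push_cast
  ring

theorem Admissible.ampl_ne_zero (hP : P.Admissible) : P.ampl ≠ 0 := by
  rw [hP.ampl_eq]
  exact exp_ne_zero _

/-- The two exponentials of `trigSum`, each split into a constant phase and one of the factors
`e^{±iπq/2}`, `q = κ - 2As`, to which `integral_Gamma_mul_weightMellin` applies. -/
theorem trigSum_eq (P : Data d) (s : ℂ) : P.trigSum s =
    exp (P.theta * I) * exp ((1 : ℝ) * (Real.pi / 2) * I * (P.kappa - 2 * P.A * s)) +
      exp (-P.theta * I) * exp ((-1 : ℝ) * (Real.pi / 2) * I * (P.kappa - 2 * P.A * s)) := by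
  have h1 : I ^ d = exp (d * (Real.pi / 2 * I)) := by
    rw [exp_nat_mul, exp_pi_div_two_mul_I]
  have h2 : (-I) ^ d = exp (d * (-Real.pi / 2 * I)) := by
    rw [exp_nat_mul, exp_neg_pi_div_two_mul_I]
  rw [trigSum, h1, h2, ← exp_add, ← exp_add, ← exp_add, ← exp_add, theta]
  push_cast
  congr 2 <;> ring

theorem continuous_modelQuotient (hP : P.Admissible) {c : ℝ} (hc : 0 < P.kappa.re + 2 * P.A * c) :
    Continuous fun t : ℝ => P.modelQuotient (-c + t * I) := by
  have hh : (P.h : ℂ) ≠ 0 := by exact_mod_cast hP.h_pos.ne'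
  have hΓ : Continuous fun t : ℝ => Gamma (P.kappa - 2 * P.A * (-c + t * I)) := by
    refine continuous_iff_continuousAt.2 fun t => ?_
    refine ContinuousAt.comp (g := Gamma) (f := fun t : ℝ => P.kappa - 2 * P.A * (-c + t * I))
      (differentiableAt_Gamma _ fun m hm => ?_).continuousAt (by fun_prop)
    have := congrArg re hm
    simp at this
    have h2 : (0 : ℝ) ≤ m := m.cast_nonneg
    linarith
  unfold modelQuotient trigSum
  refine ((continuous_const.mul (Continuous.const_cpow (by fun_prop) (Or.inl hh))).mul hΓ).mul ?_
  fun_prop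

/-- The contribution of the term with number `n` of `ψ(1 - s)` when the gamma factors are replaced
by their model. -/
theorem integral_modelQuotient_mul (hP : P.Admissible) {f : ℝ → ℝ} {L : ℝ} (hf : ContDiff ℝ ∞ f)
    (hs : Function.support f ⊆ Icc (-1) 1) (hL : 2 ≤ L) {y : ℝ} (hy : 0 < y) {c : ℝ}
    (hc : 0 < P.kappa.re + 2 * P.A * c) {C r : ℝ} (hr : 0 ≤ r)
    (hΓ : ∀ t : ℝ, ‖Gamma (P.kappa - 2 * P.A * (-c + t * I))‖ * Real.exp (Real.pi * P.A * |t|) ≤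
      C * (1 + |t|) ^ r) (n : ℕ) :
    (2 * Real.pi : ℂ)⁻¹ * ∫ t : ℝ, P.modelQuotient (-c + t * I) *
        (P.mu n : ℂ) ^ (-(1 - (-c + t * I : ℂ))) *
        (weightMellin f L (-c + t * I) * (y : ℂ) ^ (-c + t * I : ℂ)) =
      (Real.sqrt (2 * Real.pi) : ℂ)⁻¹ * P.ampl * (P.mu n : ℂ)⁻¹ *
        ((P.h * P.mu n * y : ℝ) : ℂ) ^ ((1 - P.vartheta : ℝ) + I * P.xi : ℂ) *
        P.cosIntegral f L (y ^ (1 / (2 * P.A))) n := by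
  have hA := hP.A_pos
  have ha : 0 < 2 * P.A := by positivity
  have hh := hP.h_pos
  have hμ := hP.mu_pos n
  set Z : ℝ := P.h * P.mu n * y with hZdef
  have hZ : 0 < Z := by positivity
  set q : ℝ → ℂ := fun t => P.kappa - (2 * P.A : ℝ) * (-c + t * I) with hq
  have hq' : ∀ t : ℝ, P.kappa - 2 * P.A * (-c + t * I) = q t := fun t => by
    rw [hq]; push_cast; rfl
  have hΓ' : ∀ t : ℝ, ‖Gamma (q t)‖ * Real.exp (Real.pi / 2 * (2 * P.A) * |t|) ≤
      C * (1 + |t|) ^ r := fun t => by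
    rw [← hq', show Real.pi / 2 * (2 * P.A) = Real.pi * P.A by ring]
    exact hΓ t
  have hkey := fun (ε : ℝ) (hε : |ε| = 1) =>
    integral_Gamma_mul_weightMellin hf hs hL ha hc hZ hr hΓ' hε
  set F : ℝ → ℝ → ℂ := fun ε t => Gamma (q t) * exp (ε * (Real.pi / 2) * I * q t) *
    ((Z : ℂ) ^ (-c + t * I : ℂ) * weightMellin f L (-c + t * I)) with hF
  have hFi : ∀ ε : ℝ, |ε| = 1 → Integrable (F ε) := by
    intro ε hε
    have hqc : Continuous q := by fun_prop
    have h1 := integrable_mul_weightMellin hf hs hL hZ (-c)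
      (G := fun t => Gamma (q t) * exp (ε * (Real.pi / 2) * I * q t)) (r := r)
      (C := Real.exp (Real.pi / 2 * |P.kappa.im|) * C) ?_ hr (Eventually.of_forall fun t => ?_)
    · refine h1.congr (Eventually.of_forall fun t => ?_)
      simp only [hF]
      push_cast
      ring
    · refine (Continuous.mul ?_ (by fun_prop)).aestronglyMeasurable
      refine continuous_iff_continuousAt.2 fun t => ?_
      refine ContinuousAt.comp (g := Gamma) (f := q)
        (differentiableAt_Gamma _ fun m hm => ?_).continuousAt hqc.continuousAt
      have := congrArg re hm
      simp [hq] at this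
      have h2 : (0 : ℝ) ≤ m := m.cast_nonneg
      linarith
    · rw [norm_mul, norm_exp]
      have him : (ε * (Real.pi / 2) * I * q t).re = -(ε * (Real.pi / 2) * (q t).im) := by
        rw [show (ε * (Real.pi / 2) * I * q t : ℂ) = ((ε * (Real.pi / 2) : ℝ) : ℂ) * (I * q t) by
          push_cast; ring, re_ofReal_mul]
        simp
      have hqim : (q t).im = P.kappa.im - 2 * P.A * t := by simp [hq]
      have hle : (ε * (Real.pi / 2) * I * q t).re ≤
          Real.pi / 2 * |P.kappa.im| + Real.pi / 2 * (2 * P.A) * |t| := by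
        rw [him]
        refine (neg_le_abs _).trans ?_
        rw [abs_mul, abs_mul, hε, one_mul, abs_of_pos Real.pi_div_two_pos, hqim,
          mul_assoc (Real.pi / 2) (2 * P.A), ← mul_add]
        refine mul_le_mul_of_nonneg_left ?_ Real.pi_div_two_pos.le
        refine (abs_sub _ _).trans ?_
        rw [abs_mul, abs_of_pos ha]
      calc _ ≤ ‖Gamma (q t)‖ * (Real.exp (Real.pi / 2 * |P.kappa.im|) *
            Real.exp (Real.pi / 2 * (2 * P.A) * |t|)) := by
            rw [← Real.exp_add]
            gcongr
        _ = Real.exp (Real.pi / 2 * |P.kappa.im|) *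
            (‖Gamma (q t)‖ * Real.exp (Real.pi / 2 * (2 * P.A) * |t|)) := by ring
        _ ≤ Real.exp (Real.pi / 2 * |P.kappa.im|) * (C * (1 + |t|) ^ r) :=
            mul_le_mul_of_nonneg_left (hΓ' t) (Real.exp_nonneg _)
        _ = _ := by ring
  set E : ℂ := (Real.sqrt (2 * Real.pi) : ℂ)⁻¹ * P.ampl * (P.mu n : ℂ)⁻¹ with hE
  have hint : ∀ t : ℝ, P.modelQuotient (-c + t * I) * (P.mu n : ℂ) ^ (-(1 - (-c + t * I : ℂ))) *
      (weightMellin f L (-c + t * I) * (y : ℂ) ^ (-c + t * I : ℂ)) =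
      E * exp (P.theta * I) * F 1 t + E * exp (-P.theta * I) * F (-1) t := by
    intro t
    have hμc : (P.mu n : ℂ) ≠ 0 := by exact_mod_cast hμ.ne'
    have hZs : (Z : ℂ) ^ (-c + t * I : ℂ) = (P.h : ℂ) ^ (-c + t * I : ℂ) *
        (P.mu n : ℂ) ^ (-c + t * I : ℂ) * (y : ℂ) ^ (-c + t * I : ℂ) := by
      rw [hZdef, ofReal_mul, mul_cpow_ofReal_nonneg (by positivity) hy.le, ofReal_mul,
        mul_cpow_ofReal_nonneg hh.le hμ.le]
    have hμs : (P.mu n : ℂ) ^ (-(1 - (-c + t * I : ℂ))) =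
        (P.mu n : ℂ)⁻¹ * (P.mu n : ℂ) ^ (-c + t * I : ℂ) := by
      rw [show (-(1 - (-c + t * I : ℂ))) = -1 + (-c + t * I : ℂ) by ring, cpow_add _ _ hμc,
        cpow_neg_one]
    simp only [hF, modelQuotient, trigSum_eq, hq', hZs, hμs, hE]
    ring
  have hsum : (2 * Real.pi : ℂ)⁻¹ * ∫ t : ℝ, P.modelQuotient (-c + t * I) *
        (P.mu n : ℂ) ^ (-(1 - (-c + t * I : ℂ))) *
        (weightMellin f L (-c + t * I) * (y : ℂ) ^ (-c + t * I : ℂ)) =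
      E * ∫ v in Ioi (0 : ℝ), (v : ℂ) ^ (P.kappa - 1) * (weight f L (v ^ (2 * P.A) / Z) : ℂ) *
        (2 * cos (v + P.theta)) := by
    have hIi : ∀ ε : ℝ, IntegrableOn (fun v : ℝ => exp (ε * v * I) *
        ((v : ℂ) ^ (P.kappa - 1) * (weight f L (v ^ (2 * P.A) / Z) : ℂ))) (Ioi 0) := fun ε => by
      refine (integrableOn_cpow_mul_weight_rpow hf.continuous hs hL ha hZ (P.kappa - 1)).bdd_mul
        (c := 1) (Continuous.aestronglyMeasurable (by fun_prop)) (Eventually.of_forall fun v => ?_)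
      rw [← ofReal_mul, norm_exp_ofReal_mul_I]
    simp only [hint]
    rw [integral_add ((hFi 1 (by simp)).const_mul _) ((hFi (-1) (by simp)).const_mul _),
      integral_const_mul, integral_const_mul]
    have k1 := hkey 1 (by simp)
    have k2 := hkey (-1) (by simp)
    calc _ = E * exp (P.theta * I) * ((2 * Real.pi : ℂ)⁻¹ * ∫ t, F 1 t) +
          E * exp (-P.theta * I) * ((2 * Real.pi : ℂ)⁻¹ * ∫ t, F (-1) t) := by ring
      _ = _ := by
        rw [k1, k2, mul_assoc E, mul_assoc E, ← mul_add, ← integral_const_mul, ← integral_const_mul,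
          ← integral_add ((hIi _).const_mul _) ((hIi _).const_mul _)]
        congr 2 with v
        rw [Complex.cos, show (v + P.theta) * I = P.theta * I + ((1 : ℝ) : ℂ) * v * I by
            push_cast; ring,
          show -(v + P.theta) * I = -P.theta * I + ((-1 : ℝ) : ℂ) * v * I by push_cast; ring,
          exp_add, exp_add]
        ring
  rw [hsum]
  -- the substitution `v = k r` turns the weight into the dual weight
  set k : ℝ := Z ^ (1 / (2 * P.A)) with hk
  have hk0 : 0 < k := Real.rpow_pos_of_pos hZ _
  have hkY : k = P.rho n * y ^ (1 / (2 * P.A)) := by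
    rw [hk, hZdef, rho, Real.mul_rpow (by positivity) hy.le]
  have hka : k ^ (2 * P.A) = Z := by
    rw [hk, ← Real.rpow_mul hZ.le, one_div_mul_cancel ha.ne', Real.rpow_one]
  have hkκ : (k : ℂ) ^ P.kappa = (Z : ℂ) ^ ((1 - P.vartheta : ℝ) + I * P.xi : ℂ) := by
    rw [ofReal_cpow_eq_exp hk0, ofReal_cpow_eq_exp hZ, hk, Real.log_rpow hZ, hP.kappa_eq]
    congr 1
    have : (P.A : ℂ) ≠ 0 := by exact_mod_cast hA.ne'
    push_cast
    field_simp
  have hsub : ∫ v in Ioi (0 : ℝ), (v : ℂ) ^ (P.kappa - 1) * (weight f L (v ^ (2 * P.A) / Z) : ℂ) *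
        (2 * cos (v + P.theta)) = (k : ℂ) ^ P.kappa *
      P.cosIntegral f L (y ^ (1 / (2 * P.A))) n := by
    have h1 := integral_comp_mul_left_Ioi (fun v : ℝ => (v : ℂ) ^ (P.kappa - 1) *
      (weight f L (v ^ (2 * P.A) / Z) : ℂ) * (2 * cos (v + P.theta))) 0 hk0
    rw [mul_zero, real_smul] at h1
    have hkc : (k : ℂ) ≠ 0 := by exact_mod_cast hk0.ne'
    have h2 : ∫ r in Ioi (0 : ℝ), ((k * r : ℝ) : ℂ) ^ (P.kappa - 1) *
        (weight f L ((k * r) ^ (2 * P.A) / Z) : ℂ) * (2 * cos ((k * r : ℝ) + P.theta)) =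
        (k : ℂ) ^ (P.kappa - 1) * P.cosIntegral f L (y ^ (1 / (2 * P.A))) n := by
      rw [cosIntegral, ← integral_const_mul, ← integral_indicator measurableSet_Ioi]
      congr 1 with r
      by_cases hr : r ∈ Ioi (0 : ℝ)
      · have hr0 : 0 < r := hr
        rw [indicator_of_mem hr, dualWeight, indicator_of_mem hr, ofReal_mul,
          mul_cpow_ofReal_nonneg hk0.le hr0.le, Real.mul_rpow hk0.le hr0.le, hka,
          mul_div_cancel_left₀ _ hZ.ne', ← ofReal_mul, hkY]
        push_cast
        ring
      · rw [indicator_of_notMem hr, dualWeight, indicator_of_notMem hr]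
        simp
    rw [h2] at h1
    calc _ = (k : ℂ) * (((k⁻¹ : ℝ) : ℂ) * ∫ v in Ioi (0 : ℝ), (v : ℂ) ^ (P.kappa - 1) *
          (weight f L (v ^ (2 * P.A) / Z) : ℂ) * (2 * cos (v + P.theta))) := by
          rw [ofReal_inv, mul_inv_cancel_left₀ hkc]
      _ = _ := by
          rw [← h1, ← mul_assoc]
          congr 1
          rw [cpow_sub _ _ hkc, cpow_one, mul_div_cancel₀ _ hkc]
  rw [hsub, hkκ]
  ring

/-- The normalisation by `ς` and `(μ₁hy)^{iξ}` removes the constants of the model and the oscillating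
factor `y^{iξ}`. -/
theorem Admissible.varsigma_inv_mul (hP : P.Admissible) {y : ℝ} (hy : 0 < y) (n : ℕ) (J : ℂ) :
    P.varsigma⁻¹ * (P.omega * P.b n * ((Real.sqrt (2 * Real.pi) : ℂ)⁻¹ * P.ampl * (P.mu n : ℂ)⁻¹ *
        ((P.h * P.mu n * y : ℝ) : ℂ) ^ ((1 - P.vartheta : ℝ) + I * P.xi : ℂ) * J) /
        ((P.mu 0 * P.h * y : ℝ) : ℂ) ^ (I * P.xi)) =
      (y ^ (1 - P.vartheta) : ℝ) * (P.coef n * J) := by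
  have hh := hP.h_pos
  have hμ := hP.mu_pos n
  have hμ0 := hP.mu_pos 0
  have hω : P.omega ≠ 0 := norm_ne_zero_iff.1 (by rw [hP.omega_norm]; exact one_ne_zero)
  have hb := hP.b_ne
  have hbn : (‖P.b 0‖ : ℂ) ≠ 0 := by exact_mod_cast norm_ne_zero_iff.2 hb
  have hE := hP.ampl_ne_zero
  have hs : (Real.sqrt (2 * Real.pi) : ℂ) ≠ 0 := by
    have : 0 < Real.sqrt (2 * Real.pi) := Real.sqrt_pos.2 Real.two_pi_pos
    exact_mod_cast this.ne'
  have hhc : (P.h : ℂ) ≠ 0 := by exact_mod_cast hh.ne'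
  have hZ0 : ((P.mu 0 * P.h * y : ℝ) : ℂ) ≠ 0 := by
    have : 0 < P.mu 0 * P.h * y := by positivity
    exact_mod_cast this.ne'
  have hZ : ((P.h * P.mu n * y : ℝ) : ℂ) ≠ 0 := by
    have : 0 < P.h * P.mu n * y := by positivity
    exact_mod_cast this.ne'
  have h1 : ((P.h * P.mu n * y : ℝ) : ℂ) ^ ((1 - P.vartheta : ℝ) + I * P.xi : ℂ) =
      ((P.h * P.mu n) ^ (1 - P.vartheta) : ℝ) * (y ^ (1 - P.vartheta) : ℝ) *
        (((P.mu n / P.mu 0 : ℝ) : ℂ) ^ (I * P.xi) * ((P.mu 0 * P.h * y : ℝ) : ℂ) ^ (I * P.xi)) := by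
    rw [cpow_add _ _ hZ, ← ofReal_cpow (by positivity), Real.mul_rpow (by positivity) hy.le,
      ofReal_mul, ← mul_cpow_ofReal_nonneg (by positivity) (by positivity), ← ofReal_mul]
    congr 3
    rw [← ofReal_mul]
    congr 1
    field_simp
  rw [h1, varsigma, hP.e0_eq, coef]
  have hc : ((P.mu 0 * P.h * y : ℝ) : ℂ) ^ (I * P.xi) ≠ 0 := by
    rw [Ne, cpow_eq_zero_iff]; tauto
  generalize ((P.mu 0 * P.h * y : ℝ) : ℂ) ^ (I * P.xi) = c at hc ⊢
  field_simp

/-- The dual expansion. With `X = x^{1/2A}`, `y` of order `x` and `L` of order `X`, the error is of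
order `x^{1-ϑ} L⁻¹ X^{-1/2}`. The bound for the single terms shows that the series converges. -/
theorem FunctionalEquation.exists_abs_normalizedMean_sub_le (hP : P.Admissible)
    (hF : P.FunctionalEquation Phi Psi R) {f : ℝ → ℝ} (hf : ContDiff ℝ ∞ f)
    (hs : Function.support f ⊆ Icc (-1) 1) : ∃ c C : ℝ, 0 ≤ C ∧
      (Summable fun n => ‖P.b n‖ * P.mu n ^ (-(1 + c))) ∧ ∀ L : ℝ, 2 ≤ L → ∀ y : ℝ, 0 < y →
        (∀ n, ‖P.coef n * P.cosIntegral f L (y ^ (1 / (2 * P.A))) n‖ ≤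
          C * y ^ (-c - (1 - P.vartheta)) * L ^ P.growth c * (‖P.b n‖ * P.mu n ^ (-(1 + c)))) ∧
        |P.normalizedMean Phi R (weight f L) y - y ^ (1 - P.vartheta) *
            (∑' n, P.coef n * P.cosIntegral f L (y ^ (1 / (2 * P.A))) n).re| ≤
          C * y ^ (-c) * L ^ (P.growth c - 1) := by
  have hA := hP.A_pos
  obtain ⟨W, hW, hmodel⟩ := hP.exists_norm_gammaQuotient_sub_le
  -- far enough to the left for all estimates on the line to apply
  obtain ⟨c, hcW, hcR, hcσ, hcg⟩ : ∃ c, W ≤ c ∧ R < c ∧ P.sigmaStar < 1 + c ∧ 1 ≤ P.growth c := by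
    refine ⟨|W| + |R| + |P.sigmaStar| + 1 + |3 / 2 - P.kappa.re| / (2 * P.A), ?_, ?_, ?_, ?_⟩
    all_goals
      have h1 : 0 ≤ |3 / 2 - P.kappa.re| / (2 * P.A) := by positivity
    · linarith [le_abs_self W, abs_nonneg R, abs_nonneg P.sigmaStar]
    · linarith [abs_nonneg W, le_abs_self R, abs_nonneg P.sigmaStar]
    · linarith [abs_nonneg W, abs_nonneg R, le_abs_self P.sigmaStar]
    · rw [growth, mul_add, mul_div_cancel₀ _ (by positivity)]
      have : 0 ≤ 2 * P.A * (|W| + |R| + |P.sigmaStar| + 1) := by positivity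
      linarith [le_abs_self (3 / 2 - P.kappa.re)]
  have hκc : 0 < P.kappa.re + 2 * P.A * c := by
    rw [growth] at hcg
    linarith
  obtain ⟨C, hC, hCle⟩ := hmodel c hcW (by linarith)
  obtain ⟨C₁, hC₁, hW1⟩ := exists_integral_rpow_mul_norm_weightMellin_le hf hs (-c)
    (r := P.growth c) (by linarith)
  obtain ⟨C₂, hC₂, hW2⟩ := exists_integral_rpow_mul_norm_weightMellin_le hf hs (-c)
    (r := P.growth c - 1) (by linarith)
  have hsumb := summable_norm_mul_rpow_mu hP hcσ.le
  set Sb := ∑' n, ‖P.b n‖ * P.mu n ^ (-(1 + c)) with hSb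
  have hSb0 : 0 ≤ Sb := tsum_nonneg fun n =>
    mul_nonneg (norm_nonneg _) (Real.rpow_nonneg (hP.mu_pos n).le _)
  refine ⟨c, ‖P.varsigma⁻¹‖ * (C * C₁) + ‖P.varsigma⁻¹‖ * (C * Sb * C₂), by positivity,
    hsumb, fun L hL y hy => ?_⟩
  have hyc : (y : ℂ) ≠ 0 := by exact_mod_cast hy.ne'
  have hL0 : 0 < L := by linarith
  have hre : ∀ t : ℝ, (-c + t * I : ℂ).re = -c := fun t => by simp
  have hre1 : ∀ t : ℝ, (1 - (-c + t * I : ℂ)).re = 1 + c := fun t => by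
    rw [sub_re, hre, one_re]; ring
  have hgle : ∀ t : ℝ, ‖P.gammaQuotient (-c + t * I)‖ ≤ 2 * C * (1 + |t|) ^ P.growth c := by
    intro t
    have h1 := norm_add_le (P.gammaQuotient (-c + t * I) - P.modelQuotient (-c + t * I))
      (P.modelQuotient (-c + t * I))
    rw [sub_add_cancel] at h1
    have h2 : (1 + |t|) ^ (P.growth c - 1) ≤ (1 + |t|) ^ P.growth c :=
      Real.rpow_le_rpow_of_exponent_le (by linarith [abs_nonneg t]) (by linarith)
    have h3 := mul_le_mul_of_nonneg_left h2 hC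
    linarith [(hCle t).1, (hCle t).2.1]
  obtain ⟨hSi, hS⟩ := hF.S_eq_integral hP hf hs hL hy hcR hcσ (by linarith) hgle
  set G : ℝ → ℂ := fun t => weightMellin f L (-c + t * I) * (y : ℂ) ^ (-c + t * I : ℂ) with hG
  have hGn : ∀ t, ‖G t‖ = ‖weightMellin f L (-c + t * I)‖ * y ^ (-c) := fun t => by
    rw [hG, norm_mul, norm_cpow_eq_rpow_re_of_pos hy, hre]
  have hGc : Continuous G :=
    ((differentiable_weightMellin hf.continuous hs hL).continuous.comp (by fun_prop)).mul
      (Continuous.const_cpow (by fun_prop) (Or.inl hyc))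
  have hmc := continuous_modelQuotient hP hκc
  -- the terms of the main part
  set F : ℕ → ℝ → ℂ := fun n t => P.modelQuotient (-c + t * I) *
    (P.mu n : ℂ) ^ (-(1 - (-c + t * I : ℂ))) * G t with hFdef
  have hμn : ∀ n (t : ℝ), ‖(P.mu n : ℂ) ^ (-(1 - (-c + t * I : ℂ)))‖ = P.mu n ^ (-(1 + c)) :=
    fun n t => by rw [norm_cpow_eq_rpow_re_of_pos (hP.mu_pos n), neg_re, hre1]
  have hFle : ∀ n t, ‖F n t‖ ≤ C * P.mu n ^ (-(1 + c)) * y ^ (-c) *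
      ((1 + |t|) ^ P.growth c * ‖weightMellin f L ((-c : ℝ) + t * I)‖) := by
    intro n t
    have hμ' := Real.rpow_nonneg (hP.mu_pos n).le (-(1 + c))
    rw [hFdef, norm_mul, norm_mul, hμn, hGn]
    push_cast
    calc _ ≤ C * (1 + |t|) ^ P.growth c * P.mu n ^ (-(1 + c)) *
          (‖weightMellin f L (-c + t * I)‖ * y ^ (-c)) := by
          have := (hCle t).2.1
          gcongr
      _ = _ := by ring
  have hFc : ∀ n, Continuous (F n) := fun n => by
    have : (P.mu n : ℂ) ≠ 0 := by exact_mod_cast (hP.mu_pos n).ne'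
    exact (hmc.mul (Continuous.const_cpow (by fun_prop) (Or.inl this))).mul hGc
  have hFi : ∀ n, Integrable (F n) := fun n =>
    Integrable.mono' ((hW1 L hL).1.const_mul _) (hFc n).aestronglyMeasurable
      (Eventually.of_forall (hFle n))
  have hFint : ∀ n, ∫ t, ‖F n t‖ ≤ C * P.mu n ^ (-(1 + c)) * y ^ (-c) * (C₁ * L ^ P.growth c) := by
    intro n
    have hμ' := Real.rpow_nonneg (hP.mu_pos n).le (-(1 + c))
    refine (integral_mono (hFi n).norm ((hW1 L hL).1.const_mul _) (hFle n)).trans ?_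
    rw [integral_const_mul]
    have := (hW1 L hL).2
    gcongr
  have hbFi : ∀ n, Integrable fun t => P.b n * F n t := fun n => (hFi n).const_mul _
  have hbFsum : Summable fun n => ∫ t, ‖P.b n * F n t‖ := by
    refine Summable.of_nonneg_of_le (fun n => integral_nonneg fun t => norm_nonneg _) (fun n => ?_)
      (hsumb.mul_left (C * y ^ (-c) * (C₁ * L ^ P.growth c)))
    simp only [norm_mul]
    simp only [← norm_mul]
    have : ∫ t, ‖P.b n * F n t‖ = ‖P.b n‖ * ∫ t, ‖F n t‖ := by
      rw [← integral_const_mul]; simp only [norm_mul]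
    rw [this]
    refine (mul_le_mul_of_nonneg_left (hFint n) (norm_nonneg _)).trans (le_of_eq (by ring))
  have hHS := hasSum_integral_of_summable_integral_norm hbFi hbFsum
  have htsum : ∀ t : ℝ, ∑' n, P.b n * F n t =
      P.modelQuotient (-c + t * I) * P.psiSeries (1 - (-c + t * I)) * G t := by
    intro t
    rw [psiSeries, ← tsum_mul_left, ← tsum_mul_right]
    congr 1 with n
    simp only [hFdef]
    ring
  simp only [htsum] at hHS
  set Z0 : ℂ := ((P.mu 0 * P.h * y : ℝ) : ℂ) ^ (I * P.xi) with hZ0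
  have hZ0n : ‖Z0‖ = 1 := by
    have : 0 < P.mu 0 * P.h * y := by
      have := hP.mu_pos 0; have := hP.h_pos; positivity
    rw [hZ0, norm_cpow_eq_rpow_re_of_pos this]
    simp
  have hterm : ∀ n, P.varsigma⁻¹ * (P.omega * P.b n * ((2 * Real.pi : ℂ)⁻¹ * ∫ t, F n t) / Z0) =
      (y ^ (1 - P.vartheta) : ℝ) *
        (P.coef n * P.cosIntegral f L (y ^ (1 / (2 * P.A))) n) := by
    intro n
    rw [← hP.varsigma_inv_mul hy n, hFdef, hG]
    rw [integral_modelQuotient_mul hP hf hs hL hy hκc (by linarith : 0 ≤ P.growth c)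
      (fun t => (hCle t).2.2) n]
  have hpi : ‖(2 * Real.pi : ℂ)⁻¹‖ ≤ 1 := by
    rw [norm_inv, norm_mul, Complex.norm_ofNat, norm_real, Real.norm_of_nonneg Real.pi_pos.le]
    exact inv_le_one_of_one_le₀ (by linarith [Real.pi_gt_three])
  refine ⟨fun n => ?_, ?_⟩
  · have h1 := congrArg norm (hterm n)
    have hyp : 0 < y ^ (1 - P.vartheta) := Real.rpow_pos_of_pos hy _
    rw [norm_mul _ (P.coef n * _), norm_real, Real.norm_of_nonneg hyp.le] at h1
    have hμ' := Real.rpow_nonneg (hP.mu_pos n).le (-(1 + c))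
    have h2 : ‖P.varsigma⁻¹ * (P.omega * P.b n * ((2 * Real.pi : ℂ)⁻¹ * ∫ t, F n t) / Z0)‖ ≤
        ‖P.varsigma⁻¹‖ * (C * C₁) * y ^ (-c) * L ^ P.growth c * (‖P.b n‖ * P.mu n ^ (-(1 + c))) := by
      rw [norm_mul, norm_div, hZ0n, div_one, norm_mul, norm_mul, hP.omega_norm, one_mul, norm_mul]
      have h3 := (norm_integral_le_integral_norm (F n)).trans (hFint n)
      calc _ ≤ ‖P.varsigma⁻¹‖ * (‖P.b n‖ * (1 *
            (C * P.mu n ^ (-(1 + c)) * y ^ (-c) * (C₁ * L ^ P.growth c)))) := by gcongr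
        _ = _ := by ring
    rw [h1] at h2
    rw [Real.rpow_sub hy, mul_div_assoc', div_mul_eq_mul_div, div_mul_eq_mul_div,
      le_div_iff₀ hyp, mul_comm]
    refine h2.trans ?_
    gcongr
    have : 0 ≤ ‖P.varsigma⁻¹‖ * (C * Sb * C₂) := by positivity
    linarith
  · have hψ : Continuous fun t : ℝ => P.psiSeries (1 - (-c + t * I)) := by
      unfold psiSeries
      refine continuous_tsum (fun n => ?_) hsumb fun n t => ?_
      · have : (P.mu n : ℂ) ≠ 0 := by exact_mod_cast (hP.mu_pos n).ne'
        exact continuous_const.mul (Continuous.const_cpow (by fun_prop) (Or.inl this))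
      · rw [norm_mul, hμn]
    have hψle : ∀ t : ℝ, ‖P.psiSeries (1 - (-c + t * I))‖ ≤ Sb := fun t => by
      have := norm_psiSeries_le hP (s := 1 - (-c + t * I)) (by rw [hre1]; exact hcσ.le)
      simpa only [hre1] using this
    have hmainI : Integrable fun t : ℝ => P.modelQuotient (-c + t * I) *
        P.psiSeries (1 - (-c + t * I)) * G t := by
      refine Integrable.mono' ((hW1 L hL).1.const_mul (C * Sb * y ^ (-c)))
        ((hmc.mul hψ).mul hGc).aestronglyMeasurable (Eventually.of_forall fun t => ?_)
      rw [norm_mul, norm_mul, hGn]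
      push_cast
      calc _ ≤ C * (1 + |t|) ^ P.growth c * Sb *
            (‖weightMellin f L (-c + t * I)‖ * y ^ (-c)) := by
            have := (hCle t).2.1
            have := hψle t
            gcongr
        _ = _ := by ring
    -- the error from the model of the gamma factors is smaller by one power of `L`
    set err : ℂ := (2 * Real.pi : ℂ)⁻¹ * ∫ t : ℝ, P.omega *
      (P.gammaQuotient (-c + t * I) - P.modelQuotient (-c + t * I)) *
        P.psiSeries (1 - (-c + t * I)) * G t with herr
    have herrle : ‖err‖ ≤ C * Sb * y ^ (-c) * (C₂ * L ^ (P.growth c - 1)) := by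
      rw [herr, norm_mul]
      refine (mul_le_of_le_one_left (norm_nonneg _) hpi).trans ?_
      refine (norm_integral_le_of_norm_le ((hW2 L hL).1.const_mul (C * Sb * y ^ (-c)))
        (Eventually.of_forall fun t => ?_)).trans ?_
      · rw [norm_mul, norm_mul, norm_mul, hP.omega_norm, one_mul, hGn]
        push_cast
        calc _ ≤ C * (1 + |t|) ^ (P.growth c - 1) * Sb *
              (‖weightMellin f L (-c + t * I)‖ * y ^ (-c)) := by
              have := (hCle t).1
              have := hψle t
              gcongr
          _ = _ := by ring
      · rw [integral_const_mul]
        have := (hW2 L hL).2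
        gcongr
    have hsplit : P.S Phi R (weight f L) y =
        P.omega * ((2 * Real.pi : ℂ)⁻¹ * ∑' n, ∫ t, P.b n * F n t) + err := by
      rw [hS, hHS.tsum_eq, herr, mul_left_comm, ← mul_add,
        ← integral_const_mul P.omega]
      congr 1
      rw [← sub_eq_iff_eq_add', ← integral_sub hSi (hmainI.const_mul _)]
      congr 1 with t
      ring
    have hmain : P.varsigma⁻¹ * (P.omega * ((2 * Real.pi : ℂ)⁻¹ * ∑' n, ∫ t, P.b n * F n t) / Z0) =
        (y ^ (1 - P.vartheta) : ℝ) *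
          ∑' n, P.coef n * P.cosIntegral f L (y ^ (1 / (2 * P.A))) n := by
      rw [← tsum_mul_left, ← tsum_mul_left, ← tsum_mul_left, ← tsum_div_const, ← tsum_mul_left]
      refine tsum_congr fun n => ?_
      rw [← hterm, integral_const_mul]
      ring
    rw [normalizedMean, hsplit, add_div, mul_add, ← hZ0, hmain, add_re, re_ofReal_mul,
      add_sub_cancel_left]
    refine (abs_re_le_norm _).trans ?_
    rw [norm_mul, norm_div, hZ0n, div_one]
    calc _ ≤ ‖P.varsigma⁻¹‖ * (C * Sb * y ^ (-c) * (C₂ * L ^ (P.growth c - 1))) := by gcongr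
      _ = ‖P.varsigma⁻¹‖ * (C * Sb * C₂) * y ^ (-c) * L ^ (P.growth c - 1) := by ring
      _ ≤ _ := by
        gcongr
        have : 0 ≤ ‖P.varsigma⁻¹‖ * (C * C₁) := by positivity
        linarith

end Data

end LocalMean

open Complex Filter Topology MeasureTheory Set
open scoped ContDiff

namespace LocalMean

/-! ### The dual weight and the dual coefficients -/

theorem abs_rpow_sub_one_le {u : ℝ} (h1 : 1 / 2 ≤ u) (h2 : u ≤ 2) (p : ℝ) :
    |u ^ p - 1| ≤ |p| * 2 ^ |p - 1| * |u - 1| := by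
  have hd : ∀ v ∈ Icc (1 / 2 : ℝ) 2, HasDerivWithinAt (fun v : ℝ => v ^ p) (p * v ^ (p - 1))
      (Icc (1 / 2) 2) v := fun v hv =>
    (Real.hasDerivAt_rpow_const (Or.inl (by linarith [hv.1]))).hasDerivWithinAt
  have := (convex_Icc (1 / 2 : ℝ) 2).norm_image_sub_le_of_norm_hasDerivWithin_le hd
    (C := |p| * 2 ^ |p - 1|) (fun v hv => ?_) (x := 1) (y := u) ⟨by norm_num, by norm_num⟩ ⟨h1, h2⟩
  · simpa using this
  · rw [norm_mul, Real.norm_eq_abs, Real.norm_of_nonneg (Real.rpow_nonneg (by linarith [hv.1]) _)]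
    gcongr
    exact rpow_le_two_rpow_abs hv.1 hv.2 _

section DualWeight

variable {f : ℝ → ℝ} {L a : ℝ}

/-- The dual weight lives on an interval about `1` of length `O(1/L)`. -/
theorem dualWeight_ne_zero (hs : Function.support f ⊆ Icc (-1) 1) (hL : 2 ≤ L) (ha : 0 < a) {r : ℝ}
    (hr : dualWeight f L a r ≠ 0) :
    0 < r ∧ |r ^ a - 1| ≤ 1 / L ∧ 1 / 2 ≤ r ^ a ∧ r ^ a ≤ 2 ∧
      |r - 1| ≤ |1 / a| * 2 ^ |1 / a - 1| / L := by
  have hr0 : 0 < r := by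
    by_contra h
    exact hr (by rw [dualWeight, indicator_of_notMem (by simpa using h)])
  have hw : f ((r ^ a - 1) * L) ≠ 0 := by
    rwa [dualWeight, indicator_of_mem (mem_Ioi.2 hr0)] at hr
  have hL0 : 0 < L := by linarith
  have h1 : |r ^ a - 1| ≤ 1 / L := by
    have h := abs_le.2 (hs hw)
    rwa [abs_mul, abs_of_pos hL0, ← le_div_iff₀ hL0] at h
  have h2 : 1 / L ≤ 1 / 2 := one_div_le_one_div_of_le two_pos hL
  have h3 := abs_le.1 (h1.trans h2)
  have h4 : 1 / 2 ≤ r ^ a := by linarith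
  have h5 : r ^ a ≤ 2 := by linarith
  refine ⟨hr0, h1, h4, h5, ?_⟩
  have h6 := abs_rpow_sub_one_le h4 h5 (1 / a)
  rw [← Real.rpow_mul hr0.le, mul_one_div_cancel ha.ne', Real.rpow_one] at h6
  refine h6.trans ?_
  rw [div_eq_mul_one_div _ L]
  gcongr

theorem continuous_cpow_mul_dualWeight (hf : Continuous f) (hs : Function.support f ⊆ Icc (-1) 1)
    (hL : 2 ≤ L) (ha : 0 < a) (z : ℂ) :
    Continuous fun r : ℝ => (r : ℂ) ^ z * (dualWeight f L a r : ℂ) := by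
  have hw := continuous_weight (L := L) hf
  refine continuous_iff_continuousAt.2 fun r => ?_
  have hlo : 0 < (1 / 2 : ℝ) ^ (1 / a) := by positivity
  by_cases hr : 0 < r
  · have h1 : (fun r : ℝ => (r : ℂ) ^ z * (dualWeight f L a r : ℂ)) =ᶠ[𝓝 r]
        fun r => (r : ℂ) ^ z * (weight f L (r ^ a) : ℂ) := by
      filter_upwards [lt_mem_nhds hr] with t ht
      rw [dualWeight, indicator_of_mem (mem_Ioi.2 ht)]
    refine ContinuousAt.congr ?_ h1.symm
    refine ContinuousAt.mul ?_ (continuous_ofReal.continuousAt.comp (hw.continuousAt.comp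
      (Real.continuousAt_rpow_const r a (Or.inl hr.ne'))))
    exact (continuousOn_ofReal_cpow_Ioi z).continuousAt (Ioi_mem_nhds hr)
  · have h1 : (fun r : ℝ => (r : ℂ) ^ z * (dualWeight f L a r : ℂ)) =ᶠ[𝓝 r] fun _ => 0 := by
      filter_upwards [gt_mem_nhds (lt_of_le_of_lt (not_lt.1 hr) hlo)] with t ht
      by_contra h
      obtain ⟨ht0, -, h2, -⟩ := dualWeight_ne_zero hs hL ha (r := t) fun h0 => h (by rw [h0]; simp)
      have h3 := Real.rpow_lt_rpow ht0.le ht ha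
      rw [← Real.rpow_mul (by norm_num), one_div_mul_cancel ha.ne', Real.rpow_one] at h3
      linarith
    exact continuousAt_const.congr h1.symm

theorem continuous_dualWeight (hf : Continuous f) (hs : Function.support f ⊆ Icc (-1) 1)
    (hL : 2 ≤ L) (ha : 0 < a) : Continuous (dualWeight f L a) := by
  have := continuous_re.comp (continuous_cpow_mul_dualWeight hf hs hL ha 0)
  simpa [Function.comp_def] using this

theorem hasCompactSupport_dualWeight (hs : Function.support f ⊆ Icc (-1) 1) (hL : 2 ≤ L)
    (ha : 0 < a) : HasCompactSupport (dualWeight f L a) := by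
  refine HasCompactSupport.intro (isCompact_closedBall (1 : ℝ) (|1 / a| * 2 ^ |1 / a - 1| / L))
    fun r hr => ?_
  by_contra h
  exact hr (by simpa [Real.dist_eq] using (dualWeight_ne_zero hs hL ha h).2.2.2.2)

/-- The mass of the dual weight is at least of order `1/L`, by the substitution `u = r^a`. -/
theorem inv_le_mul_integral_dualWeight (hf : Continuous f) (hf0 : ∀ u, 0 ≤ f u)
    (hs : Function.support f ⊆ Icc (-1) 1) (hint : 1 ≤ ∫ u, f u) (hL : 2 ≤ L) (ha : 0 < a) :
    L⁻¹ ≤ a * 2 ^ |(a - 1) / a| * ∫ r, dualWeight f L a r := by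
  have hL0 : 0 < L := by linarith
  have h1 : ∫ u, weight f L u = L⁻¹ * ∫ u, f u := by
    have h2 := integral_sub_right_eq_self (μ := volume) (fun u => f (u * L)) 1
    have h3 := Measure.integral_comp_mul_right f L
    simp only [weight]
    rw [h2, h3, abs_of_pos (inv_pos.2 hL0), smul_eq_mul]
  have h2 : ∫ u in Ioi (0 : ℝ), weight f L u = ∫ u, weight f L u := by
    refine setIntegral_eq_integral_of_forall_compl_eq_zero fun u hu => ?_
    exact weight_eq_zero' hs hL (Or.inl (by linarith [not_lt.1 (mem_Ioi.not.1 hu)]))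
  have h3 := integral_comp_rpow_Ioi_of_pos (g := weight f L) ha
  have h4 : ∫ r in Ioi (0 : ℝ), (a * r ^ (a - 1)) • weight f L (r ^ a) =
      ∫ r, a * r ^ (a - 1) * dualWeight f L a r := by
    rw [← integral_indicator measurableSet_Ioi]
    congr 1 with r
    by_cases hr : r ∈ Ioi (0 : ℝ)
    · rw [indicator_of_mem hr, dualWeight, indicator_of_mem hr, smul_eq_mul]
    · rw [indicator_of_notMem hr, dualWeight, indicator_of_notMem hr, mul_zero]
  have h0 : ∀ r, 0 ≤ dualWeight f L a r := fun r => indicator_nonneg (fun r _ => hf0 _) r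
  have hcont := continuous_dualWeight hf hs hL ha
  have hi := hcont.integrable_of_hasCompactSupport (μ := volume)
    (hasCompactSupport_dualWeight hs hL ha)
  calc L⁻¹ ≤ L⁻¹ * ∫ u, f u := le_mul_of_one_le_right (inv_nonneg.2 hL0.le) hint
    _ = ∫ r, a * r ^ (a - 1) * dualWeight f L a r := by rw [← h1, ← h2, ← h3, h4]
    _ ≤ ∫ r, a * 2 ^ |(a - 1) / a| * dualWeight f L a r := by
      refine integral_mono_of_nonneg (Eventually.of_forall fun r => ?_) (hi.const_mul _)
        (Eventually.of_forall fun r => ?_)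
      all_goals
        by_cases hr : dualWeight f L a r = 0
        · simp [hr]
        obtain ⟨hr0, -, h5, h6, -⟩ := dualWeight_ne_zero hs hL ha hr
        have := h0 r
      · positivity
      · simp only
        gcongr
        have h7 := rpow_le_two_rpow_abs h5 h6 ((a - 1) / a)
        rwa [← Real.rpow_mul hr0.le, mul_div_cancel₀ _ ha.ne'] at h7
    _ = _ := integral_const_mul _ _

end DualWeight

namespace Data

variable {d : ℕ} {P : Data d}

theorem Admissible.rho_strictMono (hP : P.Admissible) : StrictMono P.rho := fun m n hmn =>
  Real.rpow_lt_rpow (mul_pos hP.h_pos (hP.mu_pos m)).le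
    (mul_lt_mul_of_pos_left (hP.mu_mono hmn) hP.h_pos) (by have := hP.A_pos; positivity)

theorem Admissible.rho_pos (hP : P.Admissible) (n : ℕ) : 0 < P.rho n :=
  Real.rpow_pos_of_pos (mul_pos hP.h_pos (hP.mu_pos n)) _

theorem Admissible.coef_zero (hP : P.Admissible) : P.coef 0 =
    (‖P.b 0‖ * (P.mu 0)⁻¹ * (2 * P.h)⁻¹ * (P.h * P.mu 0) ^ (1 - P.vartheta) : ℝ) := by
  have hb := hP.b_ne
  rw [coef, div_self (hP.mu_pos 0).ne', div_mul_cancel₀ _ hb, ofReal_one, one_cpow]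
  push_cast
  ring

theorem Admissible.norm_coef (hP : P.Admissible) (n : ℕ) : ‖P.coef n‖ =
    ‖P.b n‖ * (P.mu n)⁻¹ * (2 * P.h)⁻¹ * (P.h * P.mu n) ^ (1 - P.vartheta) := by
  have hb : ‖P.b 0‖ ≠ 0 := norm_ne_zero_iff.2 hP.b_ne
  have hh := hP.h_pos
  have hμ := hP.mu_pos n
  have hμ0 := hP.mu_pos 0
  rw [coef, norm_mul, norm_mul, norm_mul, norm_mul, norm_mul, norm_div, norm_real, norm_norm,
    div_self hb, one_mul, norm_cpow_eq_rpow_re_of_pos (div_pos hμ hμ0), norm_inv, norm_inv, norm_mul,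
    Complex.norm_ofNat, norm_real, norm_real, norm_real, Real.norm_of_nonneg hμ.le,
    Real.norm_of_nonneg hh.le, Real.norm_of_nonneg (Real.rpow_nonneg (by positivity) _)]
  simp

/-- Absolute convergence of `ψ` in a half-plane, in terms of the dual coefficients and
frequencies. -/
theorem Admissible.exists_summable_norm_coef_div (hP : P.Admissible) :
    ∃ N : ℕ, N ≠ 0 ∧ Summable fun n => ‖P.coef n‖ / P.rho n ^ N := by
  have hA := hP.A_pos
  have hh := hP.h_pos
  obtain ⟨N, hN⟩ := exists_nat_ge (2 * P.A * (P.sigmaStar + |P.vartheta|))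
  refine ⟨N + 1, N.succ_ne_zero, ?_⟩
  have hσ : P.sigmaStar ≤ P.vartheta + (N + 1 : ℕ) / (2 * P.A) := by
    have : P.sigmaStar + |P.vartheta| ≤ (N + 1 : ℕ) / (2 * P.A) := by
      rw [le_div_iff₀ (by positivity)]
      push_cast
      linarith
    linarith [neg_abs_le P.vartheta]
  refine ((summable_norm_mul_rpow_mu hP hσ).mul_left
    ((2 * P.h)⁻¹ * P.h ^ (1 - P.vartheta) / P.h ^ (((N + 1 : ℕ) : ℝ) / (2 * P.A)))).congr fun n => ?_
  have hμ := hP.mu_pos n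
  rw [hP.norm_coef, rho, ← Real.rpow_natCast, ← Real.rpow_mul (by positivity), one_div_mul_eq_div,
    Real.mul_rpow hh.le hμ.le, Real.mul_rpow hh.le hμ.le, neg_add, Real.rpow_add hμ,
    Real.rpow_neg hμ.le (_ / _), Real.rpow_sub hμ, Real.rpow_neg hμ.le, Real.rpow_one]
  field_simp

end Data

end LocalMean

open Complex Filter Topology MeasureTheory Set
open scoped ContDiff

/-! ### Oscillation of the local mean -/

theorem theorem2 {d : ℕ} (P : LocalMean.Data d) (hP : P.Admissible) :
    ∀ ε : ℝ, 0 < ε → ∃ δ : ℝ, 0 < δ ∧ δ < ε ∧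
      ∃ c₀ cp cm : ℝ, 0 < c₀ ∧ 0 < cp ∧ 0 < cm ∧
        ∀ (Phi Psi : ℂ → ℂ) (R : ℝ), P.FunctionalEquation Phi Psi R →
          ∀ φ₀ : ℝ → ℝ, LocalMean.IsProfile φ₀ →
            ∃ X₀ : ℝ, ∀ x : ℝ, 0 < x → X₀ ≤ x →
              (∃ xp ∈ Set.Icc (x - c₀ * x ^ (1 - 1 / (2 * P.A)))
                  (x + c₀ * x ^ (1 - 1 / (2 * P.A))),
                cp * x ^ (1 - P.vartheta) * (P.L δ x)⁻¹ <
                  P.normalizedMean Phi R (LocalMean.weight φ₀ (P.L δ x)) xp) ∧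
              (∃ xm ∈ Set.Icc (x - c₀ * x ^ (1 - 1 / (2 * P.A)))
                  (x + c₀ * x ^ (1 - 1 / (2 * P.A))),
                cm * x ^ (1 - P.vartheta) * (P.L δ x)⁻¹ <
                  -P.normalizedMean Phi R (LocalMean.weight φ₀ (P.L δ x)) xm) := by
  intro ε hε
  have hA := hP.A_pos
  set a : ℝ := 2 * P.A with ha
  have ha0 : 0 < a := by positivity
  set p : ℝ := 1 - P.vartheta with hp
  obtain ⟨N, hN, hsum⟩ := hP.exists_summable_norm_coef_div
  have hb0 : 0 < ‖P.b 0‖ := norm_pos_iff.2 hP.b_ne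
  have hc1 : 0 < ‖P.b 0‖ * (P.mu 0)⁻¹ * (2 * P.h)⁻¹ * (P.h * P.mu 0) ^ (1 - P.vartheta) := by
    have := hP.h_pos
    have := hP.mu_pos 0
    positivity
  obtain ⟨V, hV, η, hη, X₁, hosc⟩ := LocalMean.exists_abs_le_mul_re_tsum hP.rho_strictMono
    (hP.rho_pos 0) hc1 hP.coef_zero hN hsum P.theta
  set c₁ := ‖P.b 0‖ * (P.mu 0)⁻¹ * (2 * P.h)⁻¹ * (P.h * P.mu 0) ^ (1 - P.vartheta) with hc₁
  -- the weight in the dual variable is supported on `|r - 1| ≤ K / L`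
  set K : ℝ := |1 / a| * 2 ^ |1 / a - 1| with hK
  have hK0 : 0 < K := by
    have : 0 < |1 / a| := abs_pos.2 (by positivity)
    positivity
  set δ : ℝ := min (ε / 2) (η / K) with hδ
  have hδ0 : 0 < δ := lt_min (half_pos hε) (div_pos hη hK0)
  have hδη : K * δ ≤ η := by
    have := (le_div_iff₀ hK0).1 (min_le_right (ε / 2) (η / K))
    linarith
  set D : ℝ := a * 2 ^ |(a - 1) / a| with hD
  have hD0 : 0 < D := by positivity
  set cp : ℝ := c₁ / (32 * D * 2 ^ |a * p|) with hcp
  have hcp0 : 0 < cp := by positivity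
  have hc₀ : 0 < a * 2 ^ |a - 1| * V := by positivity
  refine ⟨δ, hδ0, (min_le_left _ _).trans_lt (half_lt_self hε), a * 2 ^ |a - 1| * V, cp, cp, hc₀,
    hcp0, hcp0, fun Phi Psi R hF f hf => ?_⟩
  obtain ⟨c, C, hC, hsumb, hexp⟩ := hF.exists_abs_normalizedMean_sub_le hP hf.smooth hf.supp
  set g := P.growth c with hg
  have hcont := hf.smooth.continuous
  -- near `r = 1` the factor `r ^ (κ - 1)` is close to `1`
  obtain ⟨τ, hτ, hτle⟩ : ∃ τ : ℝ, 0 < τ ∧ ∀ r : ℝ, |r - 1| < τ →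
      ‖(r : ℂ) ^ (P.kappa - 1) - 1‖ ≤ 1 / 4 := by
    have h1 : ContinuousAt (fun r : ℝ => (r : ℂ) ^ (P.kappa - 1)) 1 :=
      (LocalMean.continuousOn_ofReal_cpow_Ioi _).continuousAt (Ioi_mem_nhds one_pos)
    obtain ⟨τ, hτ, h⟩ := Metric.continuousAt_iff.1 h1 (1 / 4) (by norm_num)
    refine ⟨τ, hτ, fun r hr => ?_⟩
    have := h (x := r) (by rwa [Real.dist_eq])
    rw [dist_eq_norm, ofReal_one, one_cpow] at this
    exact this.le
  -- the error in the dual expansion is at most `Cerr X^{-1/2}` times `x^p L⁻¹`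
  set Cerr : ℝ := C * 2 ^ |a * -c| * δ ^ (-g) with hCerr
  have hCerr0 : 0 ≤ Cerr := by positivity
  set X₀ : ℝ := max (max X₁ (max 1 (2 * V)))
    (max (2 * δ) (max (2 * (K * δ / τ)) ((Cerr / cp + 1) ^ 2))) with hX₀
  have hX₀0 : 0 ≤ X₀ := zero_le_one.trans ((le_max_left _ _).trans
    ((le_max_right _ _).trans (le_max_left _ _)))
  refine ⟨X₀ ^ a, fun x hx0 hx => ?_⟩
  set X : ℝ := x ^ (1 / a) with hX
  have hXa : X ^ a = x := by
    rw [hX, ← Real.rpow_mul hx0.le, one_div_mul_cancel ha0.ne', Real.rpow_one]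
  have hX₀X : X₀ ≤ X := by
    have := Real.rpow_le_rpow (Real.rpow_nonneg hX₀0 _) hx (by positivity : 0 ≤ 1 / a)
    rwa [← Real.rpow_mul hX₀0, mul_one_div_cancel ha0.ne', Real.rpow_one] at this
  simp only [hX₀, max_le_iff] at hX₀X
  obtain ⟨⟨hXX₁, hX1, hX2V⟩, hX2δ, hXτ, hXerr⟩ := hX₀X
  have hX0 : 0 < X := by linarith
  have hL : P.L δ x = X / δ := by
    rw [LocalMean.Data.L, ← ha, ← hX, div_eq_inv_mul]
  rw [hL]
  set L : ℝ := X / δ with hLdef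
  have hL2 : 2 ≤ L := by rwa [hLdef, le_div_iff₀ hδ0]
  have hL0 : 0 < L := by linarith
  have hKL : K / L = K * δ / X := by rw [hLdef]; field_simp
  set w := LocalMean.dualWeight f L a with hw
  have hwc : Continuous w := LocalMean.continuous_dualWeight hcont hf.supp hL2 ha0
  have hwsupp : ∀ r, w r ≠ 0 → |r - 1| ≤ K / L := fun r hr =>
    (LocalMean.dualWeight_ne_zero hf.supp hL2 ha0 hr).2.2.2.2
  have hw0 : ∀ r, 0 ≤ w r := fun r => indicator_nonneg (fun r _ => hf.nonneg _) r
  have hW : L⁻¹ ≤ D * ∫ r, w r := LocalMean.inv_le_mul_integral_dualWeight hcont hf.nonneg hf.supp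
    hf.one_le_integral hL2 ha0
  have hWpos : 0 < ∫ r, w r := by
    have : 0 < D * ∫ r, w r := (inv_pos.2 hL0).trans_le hW
    exact (mul_pos_iff_of_pos_left hD0).1 this
  have hq : ∀ r : ℝ, ‖(r : ℂ) ^ (P.kappa - 1) * (w r : ℂ) - w r‖ ≤ w r / 4 := by
    intro r
    by_cases hr : w r = 0
    · simp [hr]
    · have h1 : |r - 1| < τ := by
        refine (hwsupp r hr).trans_lt ?_
        rw [hKL, div_lt_iff₀ hX0]
        have h2 : K * δ / τ * 2 ≤ X := by linarith
        have h3 : 0 < K * δ := by positivity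
        rw [div_mul_eq_mul_div, div_le_iff₀ hτ] at h2
        linarith
      have h2 := hτle r h1
      rw [← sub_one_mul, norm_mul, norm_real, Real.norm_of_nonneg (hw0 r)]
      calc _ ≤ 1 / 4 * w r := by gcongr; exact hw0 r
        _ = _ := by ring
  -- points of the window: `y = Yᵃ` with `Y = X u`, `1/2 ≤ u ≤ 2`
  have hwin : ∀ Y ∈ Icc (X - V) (X + V), 0 < Y ∧ 1 / 2 ≤ Y / X ∧ Y / X ≤ 2 ∧ |Y / X - 1| ≤ V / X := by
    intro Y hY
    have h1 : |Y / X - 1| ≤ V / X := by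
      rw [div_sub_one hX0.ne', abs_div, abs_of_pos hX0]
      gcongr
      exact abs_le.2 ⟨by linarith [hY.1], by linarith [hY.2]⟩
    have h2 : V / X ≤ 1 / 2 := by
      rw [div_le_iff₀ hX0]
      linarith
    have h3 := abs_le.1 (h1.trans h2)
    exact ⟨by linarith [hY.1], by linarith, by linarith, h1⟩
  have hYx : ∀ Y ∈ Icc (X - V) (X + V), ∀ e : ℝ, (Y ^ a) ^ e = x ^ e * (Y / X) ^ (a * e) := by
    intro Y hY e
    obtain ⟨hY0, -⟩ := hwin Y hY
    rw [Real.rpow_mul (div_nonneg hY0.le hX0.le) a e, Real.div_rpow hY0.le hX0.le, hXa,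
      Real.div_rpow (Real.rpow_nonneg hY0.le _) hx0.le, mul_div_cancel₀]
    exact (Real.rpow_pos_of_pos hx0 _).ne'
  have hYle : ∀ Y ∈ Icc (X - V) (X + V), ∀ e : ℝ, (Y ^ a) ^ e ≤ x ^ e * 2 ^ |a * e| := by
    intro Y hY e
    obtain ⟨hY0, h1, h2, -⟩ := hwin Y hY
    rw [hYx Y hY]
    have := LocalMean.rpow_le_two_rpow_abs h1 h2 (a * e)
    gcongr
  have hYge : ∀ Y ∈ Icc (X - V) (X + V), x ^ p / 2 ^ |a * p| ≤ (Y ^ a) ^ p := by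
    intro Y hY
    obtain ⟨hY0, h1, h2, -⟩ := hwin Y hY
    have h3 := LocalMean.rpow_le_two_rpow_abs h1 h2 (-(a * p))
    have h4 : 0 < Y / X := div_pos hY0 hX0
    rw [abs_neg, Real.rpow_neg h4.le] at h3
    rw [hYx Y hY, div_eq_mul_inv]
    gcongr
    rw [inv_le_comm₀ (by positivity) (by positivity)]
    exact h3
  have hroot : ∀ Y ∈ Icc (X - V) (X + V), (Y ^ a) ^ (1 / a) = Y := fun Y hY => by
    rw [← Real.rpow_mul (hwin Y hY).1.le, mul_one_div_cancel ha0.ne', Real.rpow_one]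
  -- the two signs `s = 1` and `s = -1` at once
  have key : ∀ s : ℝ, |s| = 1 → ∃ y ∈ Icc (x - a * 2 ^ |a - 1| * V * x ^ (1 - 1 / a))
      (x + a * 2 ^ |a - 1| * V * x ^ (1 - 1 / a)), cp * x ^ p * L⁻¹ <
        s * P.normalizedMean Phi R (LocalMean.weight f L) y := by
    intro s hs
    obtain ⟨Y, hY, hYs⟩ := hosc X hXX₁ w (fun r => (r : ℂ) ^ (P.kappa - 1) * (w r : ℂ)) hwc
      (LocalMean.continuous_cpow_mul_dualWeight hcont hf.supp hL2 ha0 _) (fun r hr => by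
        by_contra h
        have := hwsupp r h
        rw [hKL] at this
        have h2 : K * δ / X ≤ η / X := by gcongr
        linarith) hWpos hq
      (fun n => C * (x ^ (-c - p) * 2 ^ |a * (-c - p)|) * L ^ g *
        (‖P.b n‖ * P.mu n ^ (-(1 + c)))) (hsumb.mul_left _) (fun Y hY n => by
        have h1 := (hexp L hL2 (Y ^ a) (Real.rpow_pos_of_pos (hwin Y hY).1 _)).1 n
        rw [hroot Y hY] at h1
        refine h1.trans ?_
        have := hYle Y hY (-c - p)
        have := Real.rpow_nonneg (hP.mu_pos n).le (-(1 + c))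
        gcongr) s hs
    obtain ⟨hY0, hu1, hu2, hu3⟩ := hwin Y hY
    refine ⟨Y ^ a, ?_, ?_⟩
    · have h1 := LocalMean.abs_rpow_sub_one_le hu1 hu2 a
      have h2 : |Y ^ a - x| ≤ a * 2 ^ |a - 1| * V * x ^ (1 - 1 / a) := by
        have h3 : Y ^ a - x = x * ((Y / X) ^ a - 1) := by
          rw [Real.div_rpow hY0.le hX0.le, hXa]
          field_simp
        have h4 : x ^ (1 - 1 / a) = x / X := by
          rw [Real.rpow_sub hx0, Real.rpow_one]
        rw [h3, abs_mul, abs_of_pos hx0, h4]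
        rw [abs_of_pos ha0] at h1
        calc _ ≤ x * (a * 2 ^ |a - 1| * (V / X)) := by
              refine mul_le_mul_of_nonneg_left (h1.trans ?_) hx0.le
              gcongr
          _ = _ := by ring
      have h5 := abs_le.1 h2
      exact ⟨by linarith [h5.1], by linarith [h5.2]⟩
    · have h1 := (hexp L hL2 (Y ^ a) (Real.rpow_pos_of_pos hY0 _)).2
      rw [hroot Y hY] at h1
      set T : ℝ := (∑' n, P.coef n * P.cosIntegral f L Y n).re with hT
      have hTs : c₁ / 16 * ∫ r, w r ≤ s * T := hYs
      set n := P.normalizedMean Phi R (LocalMean.weight f L) (Y ^ a) with hn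
      have hxp : 0 < x ^ p := Real.rpow_pos_of_pos hx0 _
      have hmain : 2 * (cp * x ^ p * L⁻¹) ≤ (Y ^ a) ^ p * (s * T) := by
        calc 2 * (cp * x ^ p * L⁻¹) ≤ 2 * (cp * x ^ p * (D * ∫ r, w r)) := by gcongr
          _ = x ^ p / 2 ^ |a * p| * (c₁ / 16 * ∫ r, w r) := by
            rw [hcp]
            field_simp
            ring
          _ ≤ _ := mul_le_mul (hYge Y hY) hTs (by positivity) (by positivity)
      have herr : C * (Y ^ a) ^ (-c) * L ^ (g - 1) < cp * x ^ p * L⁻¹ := by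
        have h2 : x ^ (-c) * L ^ (g - 1) = δ ^ (-g) * (X ^ (-(1 / 2) : ℝ)) * (x ^ p * L⁻¹) := by
          rw [Real.rpow_sub hL0, Real.rpow_one, hLdef, Real.div_rpow hX0.le hδ0.le, ← hXa,
            ← Real.rpow_mul hX0.le, ← Real.rpow_mul hX0.le, Real.rpow_neg hδ0.le]
          have h3 : X ^ (a * -c) * X ^ g = X ^ (-(1 / 2) : ℝ) * X ^ (a * p) := by
            rw [← Real.rpow_add hX0, ← Real.rpow_add hX0]
            congr 1
            rw [hg, LocalMean.Data.growth, hP.kappa_re, ha, hp]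
            ring
          calc _ = X ^ (a * -c) * X ^ g * (δ ^ g)⁻¹ * (X / δ)⁻¹ := by ring
            _ = _ := by rw [h3]; ring
        have h4 : Cerr * X ^ (-(1 / 2) : ℝ) < cp := by
          rw [Real.rpow_neg hX0.le, ← Real.sqrt_eq_rpow, ← div_eq_mul_inv,
            div_lt_iff₀ (Real.sqrt_pos.2 hX0), ← div_lt_iff₀' hcp0]
          refine lt_of_lt_of_le (lt_add_one _) ((Real.le_sqrt' ?_).2 hXerr)
          positivity
        have h5 : 0 < x ^ p * L⁻¹ := by positivity
        calc C * (Y ^ a) ^ (-c) * L ^ (g - 1) ≤ C * (x ^ (-c) * 2 ^ |a * -c|) * L ^ (g - 1) := by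
              have := hYle Y hY (-c)
              gcongr
          _ = C * 2 ^ |a * -c| * (x ^ (-c) * L ^ (g - 1)) := by ring
          _ = Cerr * X ^ (-(1 / 2) : ℝ) * (x ^ p * L⁻¹) := by rw [h2, hCerr]; ring
          _ < cp * (x ^ p * L⁻¹) := by gcongr
          _ = _ := by ring
      have h6 : |s * n - (Y ^ a) ^ p * (s * T)| ≤ C * (Y ^ a) ^ (-c) * L ^ (g - 1) := by
        rw [mul_left_comm, ← mul_sub, abs_mul, hs, one_mul]
        exact h1
      linarith [(abs_le.1 h6).1]
  refine ⟨?_, ?_⟩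
  · obtain ⟨y, hy, h⟩ := key 1 (by simp)
    exact ⟨y, hy, by rwa [one_mul] at h⟩
  · obtain ⟨y, hy, h⟩ := key (-1) (by simp)
    exact ⟨y, hy, by rwa [neg_one_mul] at h⟩
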